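/- Let $\varepsilon>0$, $\alpha>0$, $w(R)=R^{1-\varepsilon}(1+R)^{1+2\varepsilon}$ and $\mu(R)=w(R)e^{2\alpha R}$ for $R>0$. Let $V$ be a real, measurable, rotationally invariant nonlocal potential on $\mathbb{R}^3\times\mathbb{R}^3$, i.e. $V(x,y)=V(R,R';\cos\eta)$ with $R=|x|$, $R'=|y|$ and $\eta$ the angle between $x$ and $y$, such that $V(x,y)=V(y,x)$ for a.e. $(x,y)$ and $$\int_{\mathbb{R}^3}\mu(|x|)\int_{\mathbb{R}^3}\mu(|y|)\,V(x,y)^2\,dy\,dx<\infty .$$ For integers $\ell\ge 0$, $R,R'>0$ and $k\in\mathbb{C}$ put, with $P_\ell$ the Legendre polynomials, $$V_\ell(R,R')=2\pi RR'\int_{-1}^1V(R,R';t)P_\ell(t)\,dt,$$ $$G_\ell(k;R,R')=-2\pi RR'\int_{-1}^1\frac{e^{iku(t)}}{4\pi u(t)}P_\ell(t)\,dt,\qquad u(t)=\sqrt{R^2+R'^2-2RR't}$$ (an entire function of $k$, equal to $-ikRR'\,j_\ell(k\min(R,R'))\,h^{(1)}_\ell(k\max(R,R'))$ for $k\neq0$),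 and let $L_\ell(k)$ be the integral operator with kernel $$L_\ell(k;R,R')=\int_0^\infty V_\ell(R,R'')\,G_\ell(k;R'',R')\,dR''.$$ Let $X=L^2((0,\infty),\mu(R)\,dR)$, and let $\widehat X$ be the Hilbert space of kernels $K(R,R')$ on $(0,\infty)^2$ with Hilbert–Schmidt norm $\|K\|_{HS}=\big[\int_0^\infty\!\int_0^\infty\frac{\mu(R)}{\mu(R')}|K(R,R')|^2\,dR'\,dR\big]^{1/2}<\infty$. Let $\Pi_\alpha=\{k\in\mathbb{C}:\operatorname{Im}k>-\alpha\}$ and $\overline\Pi_\alpha$ its closure. For $n\ge2$ let $\rho_n=\operatorname{Tr}[L_\ell(k)^n]$. For $n\ge 0$ let $Q_n$ be the $n\times n$ matrix with zero diagonal, superdiagonal $(n-1,n-2,\dots,1)$, entries $\rho_{i-j+1}$ at the places $(i,j)$ with $i>j$, and zeros elsewhere; let $\sigma_{\ell,n}(k)=\frac{(-1)^n}{n!}\det Q_n$ (so $\sigma_{\ell,0}=1$, $\sigma_{\ell,1}=0$). Let $\Delta_{\ell,n}(k)$ be $\frac{(-1)^n}{n!}$ times the determinant of the $(n+1)\times(n+1)$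 array with first column $(\mathbb{I},L_\ell(k),\dots,L_\ell(k)^n)$, first row $(\mathbb{I},n,0,\dots,0)$ and remaining $n\times n$ block $Q_n$ (so $\Delta_{\ell,0}=\mathbb{I}$), and let $N_{\ell,n}(k)=L_\ell(k)\Delta_{\ell,n}(k)$. Define $$\sigma_\ell(k;g)=\sum_{n\ge0}\sigma_{\ell,n}(k)\,g^n,\qquad N_\ell(k;g)=\sum_{n\ge0}N_{\ell,n}(k)\,g^n,$$ the second series being taken in $\widehat X$. Then for all integers $\ell\ge0$ and all $(k,g)\in\overline\Pi_\alpha\times\mathbb{C}$ these objects are well defined: the integrals defining $V_\ell$, $L_\ell(k)$ and the powers of $L_\ell(k)$ converge absolutely for a.e. $(R,R')$, those defining $G_\ell$ and $\rho_n$ converge absolutely, all $L_\ell(k)^n$ ($n\ge1$) and $N_{\ell,n}(k)$ ($n\ge0$) lie in $\widehat X$, and the two series converge absolutely, in $\mathbb{C}$ and in the norm of $\widehat X$ respectively. Moreover: 1. Properties of $\sigma_\ell$: (a) for each $\ell$ there is a function $\Phi_\ell$ such that $|\sigma_\ell(k;g)|\le\Phi_\ell(|g|)$ on $\overline\Pi_\alpha\times\mathbb{C}$,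 and $\sigma_\ell$ is continuous on $\overline\Pi_\alpha\times\mathbb{C}$ and holomorphic on $\Pi_\alpha\times\mathbb{C}$; (b) $\overline{\sigma_\ell(k;g)}=\sigma_\ell(-\overline k;\overline g)$ on $\overline\Pi_\alpha\times\mathbb{C}$; (c) for each fixed $g\in\mathbb{C}$, $\displaystyle\sup\{|\sigma_\ell(k;g)-1| : k\in\overline\Pi_\alpha,\ \ell\ge 0,\ \max(|k|,\ell)\ge r\}\to0$ as $r\to+\infty$. 2. Properties of $N_\ell$: the integral operator with kernel $N_\ell(k;g)$ acts on $X$ as a bounded operator of norm at most $\|N_\ell(k;g)\|_{HS}$ (a Hilbert–Schmidt operator), and for each $\ell$ there is a function $\Psi_\ell$ such that $\|N_\ell(k;g)\|_{HS}\le\Psi_\ell(|g|)$ on $\overline\Pi_\alpha\times\mathbb{C}$; (a) the $\widehat X$-valued function $(k,g)\mapsto N_\ell(k;g)$ is continuous on $\overline\Pi_\alpha\times\mathbb{C}$ and holomorphic on $\Pi_\alpha\times\mathbb{C}$; (b) $\overline{N_\ell(k;g;R,R')}=N_\ell(-\overline k;\overline g;R,R')$ for a.e. $(R,R')$, for all $(k,g)\in\overline\Pi_\alpha\times\mathbb{C}$;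 (c) for each fixed $g\in\mathbb{C}$, $\displaystyle\sup\{\|N_\ell(k;g)\|_{HS} : k\in\overline\Pi_\alpha,\ \ell\ge 0,\ \max(|k|,\ell)\ge r\}\to0$ as $r\to+\infty$. -/

import Mathlib

open MeasureTheory Set Filter Topology
open scoped ENNReal ComplexConjugate

noncomputable section

namespace NonlocalPotential

/-- Three-dimensional Euclidean space. -/
abbrev E3 : Type := EuclideanSpace ℝ (Fin 3)

/-! ### Rotationally invariant nonlocal potentials -/

/-- The weight `w^(ε)(R) = R^(1-ε) (1+R)^(1+2ε)`. -/
def weight (ε R : ℝ) : ℝ := R ^ (1 - ε) * (1 + R) ^ (1 + 2 * ε)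

/-- The function `μ(R) = w(R) exp(2αR)`. -/
def expWeight (w : ℝ → ℝ) (α R : ℝ) : ℝ := w R * Real.exp (2 * α * R)

/-- The nonlocal potential `V(x,y) = U(|x|, |y|; cos η)` on `ℝ³ × ℝ³`, where `η` is the angle
between `x` and `y`. Rotationally invariant potentials are represented by their profile `U`. -/
def potential (U : ℝ → ℝ → ℝ → ℝ) (x y : E3) : ℝ :=
  U ‖x‖ ‖y‖ (inner ℝ x y / (‖x‖ * ‖y‖))

/-- The squared norm `C(V)² = ∫ w(R) e^(2αR) ∫ w(R') e^(2αR') V(x,y)² dy dx`, `R = |x|`,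
`R' = |y|`. -/
def potentialNormSq (w : ℝ → ℝ) (α : ℝ) (U : ℝ → ℝ → ℝ → ℝ) : ℝ≥0∞ :=
  ∫⁻ x : E3, ENNReal.ofReal (expWeight w α ‖x‖) *
    ∫⁻ y : E3, ENNReal.ofReal (expWeight w α ‖y‖) * ENNReal.ofReal (potential U x y ^ 2)

/-- The class `𝒩_{w,α}` of real, symmetric, rotationally invariant nonlocal potentials with
`C(V) < ∞`, in terms of the profile `U` of `V`. -/
structure MemPotentialClass (w : ℝ → ℝ) (α : ℝ) (U : ℝ → ℝ → ℝ → ℝ) : Prop where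
  aemeasurable : AEMeasurable (fun p : ℝ × ℝ × ℝ => U p.1 p.2.1 p.2.2)
    (volume.restrict (Ioi 0 ×ˢ Ioi 0 ×ˢ Icc (-1) 1))
  symm : ∀ᵐ p : E3 × E3, potential U p.1 p.2 = potential U p.2 p.1
  normSq_lt_top : potentialNormSq w α U < ∞

/-! ### Partial potentials, Green function and Lippmann-Schwinger kernel -/

/-- The Legendre polynomial `P_ℓ`, by Rodrigues' formula. -/
def legendre (ℓ : ℕ) : Polynomial ℝ :=
  Polynomial.C (1 / (2 ^ ℓ * (ℓ.factorial : ℝ))) *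
    Polynomial.derivative^[ℓ] ((Polynomial.X ^ 2 - 1) ^ ℓ)

/-- The partial potential `V_ℓ(R,R') = 2πRR' ∫_{-1}^{1} V(R,R';t) P_ℓ(t) dt`. -/
def partialPotential (U : ℝ → ℝ → ℝ → ℝ) (ℓ : ℕ) (R R' : ℝ) : ℝ :=
  2 * Real.pi * R * R' * ∫ t in (-1 : ℝ)..1, U R R' t * (legendre ℓ).eval t

/-- The free Green function `e^(iku) / (4πu)`, where `u = (R² + R'² - 2RR't)^(1/2)` is the distance
between two points of norms `R`, `R'` and angle `arccos t`. -/
def freeGreen (k : ℂ) (R R' t : ℝ) : ℂ :=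
  Complex.exp (Complex.I * k * (√(R ^ 2 + R' ^ 2 - 2 * R * R' * t) : ℝ)) /
    (4 * Real.pi * (√(R ^ 2 + R' ^ 2 - 2 * R * R' * t) : ℝ))

/-- The angular-momentum Green function, i.e. the Legendre coefficient
`G_ℓ(k;R,R') = -2πRR' ∫_{-1}^{1} e^(iku)/(4πu) P_ℓ(t) dt`. It is entire in `k`, and for `k ≠ 0`
it equals `-i k R R' j_ℓ(k min(R,R')) h_ℓ^(1)(k max(R,R'))`. -/
def green (ℓ : ℕ) (k : ℂ) (R R' : ℝ) : ℂ :=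
  -(2 * Real.pi * R * R') *
    ∫ t in (-1 : ℝ)..1, freeGreen k R R' t * (((legendre ℓ).eval t : ℝ) : ℂ)

/-- Lebesgue measure on the half-line `R > 0`. -/
def halfLine : Measure ℝ := volume.restrict (Ioi 0)

/-- The kernel `L_ℓ(k;R,R') = ∫_0^∞ V_ℓ(R,R'') G_ℓ(k;R'',R') dR''`. -/
def lsKernel (U : ℝ → ℝ → ℝ → ℝ) (ℓ : ℕ) (k : ℂ) (R R' : ℝ) : ℂ :=
  ∫ R'', (partialPotential U ℓ R R'' : ℂ) * green ℓ k R'' R' ∂halfLine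

/-! ### The Hilbert space `X_{w,α}` and the space of Hilbert-Schmidt kernels on it -/

/-- The measure `w(R) e^(2αR) dR` on the half-line: `X_{w,α} = L²(xMeasure w α)`. -/
def xMeasure (w : ℝ → ℝ) (α : ℝ) : Measure ℝ :=
  halfLine.withDensity fun R => ENNReal.ofReal (expWeight w α R)

/-- The measure `(μ(R) / μ(R')) dR dR'` on the quadrant, with `μ(R) = w(R) e^(2αR)`. -/
def hsMeasure (w : ℝ → ℝ) (α : ℝ) : Measure (ℝ × ℝ) :=
  (halfLine.prod halfLine).withDensity
    fun p => ENNReal.ofReal (expWeight w α p.1 / expWeight w α p.2)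

/-- The space of Hilbert-Schmidt kernels on `X_{w,α}`; its norm is the Hilbert-Schmidt norm
`[∫∫ μ(R)/μ(R') |K(R,R')|² dR dR']^(1/2)`. -/
abbrev HSKernel (w : ℝ → ℝ) (α : ℝ) : Type := Lp ℂ 2 (hsMeasure w α)

open Classical in
/-- The element of the space of Hilbert-Schmidt kernels given by a kernel function
(zero if the Hilbert-Schmidt norm is not finite). -/
def toHS (w : ℝ → ℝ) (α : ℝ) (K : ℝ → ℝ → ℂ) : HSKernel w α :=
  if h : MemLp (Function.uncurry K) 2 (hsMeasure w α) then h.toLp else 0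

/-- The integral operator with kernel `K` is a bounded operator on `X_{w,α}`, of norm at most the
Hilbert-Schmidt norm of `K`. -/
def ActsOnX (w : ℝ → ℝ) (α : ℝ) (K : HSKernel w α) : Prop :=
  ∀ x : ℝ → ℂ, MemLp x 2 (xMeasure w α) →
    (∀ᵐ R ∂halfLine, Integrable (fun R' => K (R, R') * x R') halfLine) ∧
    MemLp (fun R => ∫ R', K (R, R') * x R' ∂halfLine) 2 (xMeasure w α) ∧
    eLpNorm (fun R => ∫ R', K (R, R') * x R' ∂halfLine) 2 (xMeasure w α) ≤
      ‖K‖ₑ * eLpNorm x 2 (xMeasure w α)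

/-! ### Smithies' formulae for an arbitrary kernel -/

/-- Composition of kernels. -/
def kernelComp (K K' : ℝ → ℝ → ℂ) (R R' : ℝ) : ℂ :=
  ∫ R'', K R R'' * K' R'' R' ∂halfLine

/-- `kernelPow K n` is the kernel of the operator power `K^(n+1)`. -/
def kernelPow (K : ℝ → ℝ → ℂ) : ℕ → ℝ → ℝ → ℂ
  | 0 => K
  | n + 1 => kernelComp K (kernelPow K n)

/-- `Tr[K K'] = ∫∫ K(R,R') K'(R',R) dR dR'`. -/
def traceProd (K K' : ℝ → ℝ → ℂ) : ℂ :=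
  ∫ p : ℝ × ℝ, K p.1 p.2 * K' p.2 p.1 ∂(halfLine.prod halfLine)

/-- `ρ_n = Tr[K^n] = Tr[K^(n-1) K]` for `n ≥ 2`; the values at `n = 0, 1` are not used. -/
def rho (K : ℝ → ℝ → ℂ) : ℕ → ℂ
  | 0 => 0
  | 1 => 0
  | n + 2 => traceProd (kernelPow K n) K

/-- The `n × n` matrix whose determinant is `Q_n`: zero diagonal, superdiagonal `n-1, n-2, …, 1`,
and `ρ_{i-j+1}` in the places `(i,j)` below the diagonal. -/
def qMatrix (ρ : ℕ → ℂ) (n : ℕ) : Matrix (Fin n) (Fin n) ℂ :=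
  Matrix.of fun i j =>
    if (j : ℕ) = i + 1 then (n : ℂ) - 1 - (i : ℕ)
    else if (j : ℕ) < i then ρ (i - j + 1)
    else 0

/-- `σ_n = (-1)^n / n! · Q_n`; here `σ_0 = 1`. -/
def sigmaCoeff (ρ : ℕ → ℂ) (n : ℕ) : ℂ :=
  (-1) ^ n / (n.factorial : ℂ) * (qMatrix ρ n).det

/-- The bordered matrix defining `Δ_n`, with a formal variable `X` in place of the operator:
the first column is `1, X, …, X^n`, the rest of the first row is `n, 0, …, 0`, and the
remaining block is the matrix of `Q_n`. -/
def deltaMatrix (ρ : ℕ → ℂ) (n : ℕ) : Matrix (Fin (n + 1)) (Fin (n + 1)) (Polynomial ℂ) :=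
  Matrix.of fun i j =>
    Fin.cases (Polynomial.X ^ (i : ℕ))
      (fun j' : Fin n =>
        Fin.cases (if (j' : ℕ) = 0 then Polynomial.C (n : ℂ) else 0)
          (fun i' : Fin n => Polynomial.C (qMatrix ρ n i' j')) i) j

/-- `Δ_n = (-1)^n / n! · det(…)`, as a polynomial in the operator; here `Δ_0 = 1`. -/
def deltaPoly (ρ : ℕ → ℂ) (n : ℕ) : Polynomial ℂ :=
  Polynomial.C ((-1) ^ n / (n.factorial : ℂ)) * (deltaMatrix ρ n).det

/-- The kernel of `N_n = K Δ_n`. The polynomial `Δ_n` has degree at most `n`. -/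
def nCoeff (K : ℝ → ℝ → ℂ) (n : ℕ) (R R' : ℝ) : ℂ :=
  ∑ j ∈ Finset.range (n + 1), (deltaPoly (rho K) n).coeff j * kernelPow K j R R'

/-! ### The functions `σ_ℓ(k;g)` and `N_ℓ(k;g)` -/

/-- The modified Fredholm determinant `σ_ℓ(k;g) = ∑ (σ_ℓ)_n(k) g^n`. -/
def sigma (U : ℝ → ℝ → ℝ → ℝ) (ℓ : ℕ) (k g : ℂ) : ℂ :=
  ∑' n : ℕ, sigmaCoeff (rho (lsKernel U ℓ k)) n * g ^ n

/-- The Hilbert-Schmidt kernel `N_ℓ(k;g) = ∑ (N_ℓ)_n(k) g^n`, a series in the space of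
Hilbert-Schmidt kernels on `X_{w,α}`. -/
def smithiesN (w : ℝ → ℝ) (α : ℝ) (U : ℝ → ℝ → ℝ → ℝ) (ℓ : ℕ) (k g : ℂ) : HSKernel w α :=
  ∑' n : ℕ, g ^ n • toHS w α (nCoeff (lsKernel U ℓ k) n)

/-- The half-plane `Π_α`. -/
def halfPlane (α : ℝ) : Set ℂ := {k | -α < k.im}

/-- The closed half-plane, the closure of `Π_α`. -/
def closedHalfPlane (α : ℝ) : Set ℂ := {k | -α ≤ k.im}

/-- All integrals and series that enter the definitions of `σ_ℓ(k;g)` and `N_ℓ(k;g)` converge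
absolutely, the latter series in Hilbert-Schmidt norm, so that no default value
is ever used. -/
structure SmithiesWellDefined (w : ℝ → ℝ) (α : ℝ) (U : ℝ → ℝ → ℝ → ℝ) (ℓ : ℕ) (k : ℂ) :
    Prop where
  partialPotential : ∀ᵐ p : ℝ × ℝ ∂(halfLine.prod halfLine),
    IntervalIntegrable (fun t => U p.1 p.2 t * (legendre ℓ).eval t) volume (-1) 1
  green : ∀ R R' : ℝ, 0 < R → 0 < R' → IntervalIntegrable
    (fun t => freeGreen k R R' t * (((legendre ℓ).eval t : ℝ) : ℂ)) volume (-1) 1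
  lsKernel : ∀ᵐ p : ℝ × ℝ ∂(halfLine.prod halfLine), Integrable
    (fun R => (NonlocalPotential.partialPotential U ℓ p.1 R : ℂ) *
      NonlocalPotential.green ℓ k R p.2) halfLine
  kernelPow_comp : ∀ n : ℕ, ∀ᵐ p : ℝ × ℝ ∂(halfLine.prod halfLine), Integrable
    (fun R => NonlocalPotential.lsKernel U ℓ k p.1 R *
      kernelPow (NonlocalPotential.lsKernel U ℓ k) n R p.2) halfLine
  kernelPow_memLp : ∀ n : ℕ, MemLp
    (Function.uncurry (kernelPow (NonlocalPotential.lsKernel U ℓ k) n)) 2 (hsMeasure w α)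
  trace : ∀ n : ℕ, Integrable
    (fun p : ℝ × ℝ => kernelPow (NonlocalPotential.lsKernel U ℓ k) n p.1 p.2 *
      NonlocalPotential.lsKernel U ℓ k p.2 p.1) (halfLine.prod halfLine)
  nCoeff_memLp : ∀ n : ℕ, MemLp
    (Function.uncurry (nCoeff (NonlocalPotential.lsKernel U ℓ k) n)) 2 (hsMeasure w α)
  summable_sigma : ∀ g : ℂ, Summable
    fun n : ℕ => ‖sigmaCoeff (rho (NonlocalPotential.lsKernel U ℓ k)) n * g ^ n‖
  summable_smithiesN : ∀ g : ℂ, Summable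
    fun n : ℕ => ‖g ^ n • toHS w α (nCoeff (NonlocalPotential.lsKernel U ℓ k) n)‖

end NonlocalPotential

end

open MeasureTheory Set Filter Topology
open scoped ENNReal ComplexConjugate

noncomputable section

namespace NonlocalPotential

/-! ### Legendre polynomials -/

section Legendre

open Polynomial

/-! Everything is reduced to one abstract statement about Hilbert–Schmidt kernels on the half-line,
applied to a kernel that depends on `k` and `ℓ`.

Conjugation by `√μ` turns Hilbert–Schmidt operators on `X` into plain square integrable kernels on
the quadrant, and it respects composition and traces (`kernelComp_weighted`, `rho_weighted`). The
conjugated Lippmann–Schwinger kernel factors as `√μ V_ℓ √μ` composed with `G_ℓ / (√μ √μ)`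
(`weighted_lsKernel`), and both factors are square integrable. For the first this follows from
spherical coordinates, Cauchy–Schwarz in the angle and `|P_ℓ| ≤ 1`, uniformly in `ℓ`
(`exists_wPotential_bound`). For the second, `|G_ℓ| ≤ e^(α(R+R')) min(R,R')` on the closed
half-plane, and the weight is such that `R / w(R) ≤ (1+R)^(-1-ε)` (`norm_wGreen_le`,
`div_weight_le`).

For a square integrable kernel `K`, expanding Smithies' determinants gives `(n+1) σ_(n+1) = -∑
ρ_(j+2) σ_(n-j-1)` and `N_n = ∑ σ_(n-j) K^(j+1)`. For a matrix `A` the `σ_n` are therefore the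
Taylor coefficients of the entire function `det(1 - gA) e^(g tr A)`, which is at most
`exp(|g|²‖A‖²/2)` with the Frobenius norm, independently of the dimension (`norm_regDet_le`).
Differentiating this determinant in the direction of a second matrix `B` bounds `tr(N_n B)` in the
same way. Cauchy's estimates follow; matrix units of a Hilbert basis approximate `K` by matrices,
and duality turns bounds on `tr(N_n B)` into bounds on `‖N_n‖` (`norm_sigmaCoeff_hsRho_le`,
`norm_hsCoeff_le`). Hence both series converge for every `g`, locally uniformly in `(K, g)`; they
are continuous in `(K, g)` and holomorphic along any bounded holomorphic family of kernels.

It remains to study `k ↦ G_ℓ(k)` in the weighted `L²`. Continuity up to the boundary is dominated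
convergence; holomorphy inside uses the exponential margin `Im k + α > 0`. Off the diagonal `G_ℓ`
tends to zero pointwise: as `ℓ → ∞` uniformly in `k`, because `∫ |P_ℓ| = O(ℓ^(-1/2))`, and for each
fixed `ℓ` like `1/|k|`, by integration by parts. Dominated convergence makes `L_ℓ(k) → 0` in norm as
`max(|k|, ℓ) → ∞`, and the limits follow since `σ = 1` and `N = 0` at the zero kernel. -/

theorem integral_eval_derivative (p : ℝ[X]) (a b : ℝ) :
    ∫ t in a..b, (derivative p).eval t = p.eval b - p.eval a :=
  intervalIntegral.integral_eq_sub_of_hasDerivAt (fun x _ => p.hasDerivAt x)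
    ((derivative p).continuous.intervalIntegrable _ _)

theorem eval_iterate_derivative_sq_sub_one_pow {ℓ j : ℕ} (h : j < ℓ) {x : ℝ} (hx : x ^ 2 = 1) :
    (derivative^[j] ((X ^ 2 - 1 : ℝ[X]) ^ ℓ)).eval x = 0 := by
  obtain ⟨q, hq⟩ : (X ^ 2 - 1 : ℝ[X]) ∣ derivative^[j] ((X ^ 2 - 1 : ℝ[X]) ^ ℓ) :=
    (dvd_pow_self _ (by omega)).trans (pow_sub_dvd_iterate_derivative_pow _ ℓ j)
  simp [hq, hx]

/-- Each induction step is one integration by parts: a derivative moves onto `q`, whose degree drops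
along with `j`, and the boundary terms vanish because `±1` are zeros of the lower derivatives. -/
theorem integral_iterate_derivative_mul_eq_zero (ℓ : ℕ) :
    ∀ j ≤ ℓ, ∀ q : ℝ[X], q.degree < j →
      ∫ t in (-1 : ℝ)..1, (derivative^[j] ((X ^ 2 - 1 : ℝ[X]) ^ ℓ) * q).eval t = 0 := by
  intro j
  induction j with
  | zero =>
    intro _ q hq
    have : q = 0 := by
      rw [← Polynomial.degree_eq_bot]; exact (Nat.WithBot.lt_zero_iff).1 (by simpa using hq)
    simp [this]
  | succ j ih =>
    intro hj q hq
    have h1 := integral_eval_derivative (derivative^[j] ((X ^ 2 - 1 : ℝ[X]) ^ ℓ) * q) (-1) 1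
    have h2 := ih (by omega) (derivative q) (by
      by_cases hq0 : q = 0
      · simp [hq0]
      by_cases hd : q.natDegree = 0
      · rw [Polynomial.eq_C_of_natDegree_eq_zero hd]; simp
      refine (degree_derivative_lt hq0).trans_le ?_
      rw [degree_eq_natDegree hq0] at hq ⊢
      norm_cast at hq ⊢
      omega)
    simp only [eval_mul, eval_iterate_derivative_sq_sub_one_pow (show j < ℓ by omega)
      (show (1 : ℝ) ^ 2 = 1 by norm_num), eval_iterate_derivative_sq_sub_one_pow
      (show j < ℓ by omega) (show (-1 : ℝ) ^ 2 = 1 by norm_num), zero_mul, sub_zero,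
      derivative_mul, eval_add] at h1
    rw [intervalIntegral.integral_add] at h1
    · simp only [eval_mul] at h2 ⊢
      rw [h2, add_zero] at h1
      rw [Function.iterate_succ_apply']
      exact h1
    · exact (Continuous.intervalIntegrable (by fun_prop) _ _)
    · exact (Continuous.intervalIntegrable (by fun_prop) _ _)

/-- In Leibniz' formula only the term with all derivatives on `(X - a)^n` survives at `a`. This
gives the endpoint values of the Legendre polynomials. -/
theorem eval_iterate_derivative_sub_pow_mul (n : ℕ) (a : ℝ) (q : ℝ[X]) :
    (derivative^[n] ((X - C a) ^ n * q)).eval a = n.factorial * q.eval a := by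
  rw [iterate_derivative_mul, eval_finsetSum, Finset.sum_eq_single 0]
  · simp [iterate_derivative_X_sub_pow_self]
  · intro k hk hk0
    have : k ≤ n := by simpa [Nat.lt_succ_iff] using hk
    rw [iterate_derivative_X_sub_pow]
    simp [show n - (n - k) ≠ 0 by omega]
  · simp

theorem legendre_eval_one (ℓ : ℕ) : (legendre ℓ).eval 1 = 1 := by
  have h := eval_iterate_derivative_sub_pow_mul ℓ 1 ((X + 1) ^ ℓ)
  rw [← mul_pow, show (X - C 1) * (X + 1) = (X ^ 2 - 1 : ℝ[X]) by simp; ring] at h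
  rw [legendre, eval_mul, h]
  have : (ℓ.factorial : ℝ) ≠ 0 := by positivity
  simp only [eval_C, eval_pow, eval_add, eval_X, eval_one]
  norm_num
  field_simp

theorem legendre_eval_neg_one_sq (ℓ : ℕ) : (legendre ℓ).eval (-1) ^ 2 = 1 := by
  have h := eval_iterate_derivative_sub_pow_mul ℓ (-1) ((X - 1) ^ ℓ)
  rw [← mul_pow, show (X - C (-1)) * (X - 1) = (X ^ 2 - 1 : ℝ[X]) by simp; ring] at h
  rw [legendre, eval_mul, h]
  have : (ℓ.factorial : ℝ) ≠ 0 := by positivity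
  simp only [eval_C, eval_pow, eval_sub, eval_X, eval_one]
  rw [show (-1 - 1 : ℝ) = (-1) * 2 by norm_num, mul_pow, mul_pow (-1 : ℝ)]
  have h1 : ((-1 : ℝ) ^ ℓ) ^ 2 = 1 := by rw [← pow_mul, mul_comm, pow_mul]; norm_num
  field_simp
  exact h1

theorem iterate_derivative_X_mul' (f : ℝ[X]) (n : ℕ) :
    derivative^[n + 1] (X * f) = X * derivative^[n + 1] f + ((n : ℝ[X]) + 1) * derivative^[n] f := by
  induction n with
  | zero => simp; ring
  | succ n ih =>
    rw [Function.iterate_succ_apply', ih]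
    simp only [derivative_add, derivative_mul, derivative_X, ← Function.iterate_succ_apply' derivative,
      derivative_natCast, derivative_one]
    push_cast; ring

theorem iterate_derivative_sq_sub_one_mul (f : ℝ[X]) (n : ℕ) :
    derivative^[n + 2] ((X ^ 2 - 1) * f) = (X ^ 2 - 1) * derivative^[n + 2] f +
      2 * ((n : ℝ[X]) + 2) * X * derivative^[n + 1] f +
      ((n : ℝ[X]) + 2) * ((n : ℝ[X]) + 1) * derivative^[n] f := by
  induction n with
  | zero => simp [derivative_mul]; ring
  | succ n ih =>
    rw [Function.iterate_succ_apply', ih]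
    simp only [derivative_add, derivative_mul, derivative_X, ← Function.iterate_succ_apply' derivative,
      derivative_natCast, derivative_one, derivative_sub, derivative_X_sq, derivative_ofNat, map_ofNat, mul_zero, zero_mul, add_zero]
    push_cast
    ring

/-- Legendre's differential equation. -/
theorem legendre_ode (ℓ : ℕ) :
    (X ^ 2 - 1) * derivative (derivative (legendre (ℓ + 1))) +
      2 * X * derivative (legendre (ℓ + 1)) =
      ((ℓ : ℝ[X]) + 1) * ((ℓ : ℝ[X]) + 2) * legendre (ℓ + 1) := by
  -- The first-order equation satisfied by `(X² - 1)^(ℓ+1)`; differentiating it `ℓ + 2` times yields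
  -- the claim up to the Rodrigues constant.
  have h0 : (X ^ 2 - 1) * derivative ((X ^ 2 - 1 : ℝ[X]) ^ (ℓ + 1)) =
      (2 * ((ℓ : ℝ[X]) + 1)) * (X * (X ^ 2 - 1) ^ (ℓ + 1)) := by
    rw [derivative_pow_succ]
    simp only [derivative_sub, derivative_X_pow, derivative_one, map_natCast, map_add,
      map_one]
    push_cast
    ring
  have h1 := congrArg (derivative^[ℓ + 2]) h0
  have h2 : derivative^[ℓ + 2] ((2 * ((ℓ : ℝ[X]) + 1)) * (X * (X ^ 2 - 1) ^ (ℓ + 1))) =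
      (2 * ((ℓ : ℝ[X]) + 1)) * derivative^[ℓ + 2] (X * (X ^ 2 - 1) ^ (ℓ + 1)) := by
    have := iterate_derivative_C_mul (2 * (ℓ + 1) : ℝ) (X * (X ^ 2 - 1 : ℝ[X]) ^ (ℓ + 1)) (ℓ + 2)
    simpa only [C_mul, C_add, C_1, C_eq_natCast, map_ofNat] using this
  rw [h2, iterate_derivative_sq_sub_one_mul, iterate_derivative_X_mul'] at h1
  simp only [← Function.iterate_succ_apply] at h1
  simp only [legendre, derivative_C_mul]
  simp only [← Function.iterate_succ_apply' derivative]
  push_cast at h1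
  linear_combination C (1 / (2 ^ (ℓ + 1) * ((ℓ + 1).factorial : ℝ))) * h1

/-- Sonin's argument: by the differential equation, `F = λ P² + (1 - x²) P'²` has derivative `2x
P'²`, so on `[-1, 1]` it is largest at the endpoints, where it equals `λ`. Dropping the second term
gives `P² ≤ 1`. -/
theorem abs_legendre_le_one (ℓ : ℕ) {x : ℝ} (hx : x ∈ Icc (-1 : ℝ) 1) :
    |(legendre ℓ).eval x| ≤ 1 := by
  rcases ℓ with _ | ℓ
  · simp [legendre]
  set P := legendre (ℓ + 1)
  set lam : ℝ := (ℓ + 1) * (ℓ + 2)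
  have hl : 0 < lam := by positivity
  set F : ℝ[X] := C lam * P ^ 2 + (1 - X ^ 2) * derivative P ^ 2 with hF
  have hF' : derivative F = 2 * X * derivative P ^ 2 := by
    have h := legendre_ode ℓ
    have hC : (C lam : ℝ[X]) = ((ℓ : ℝ[X]) + 1) * ((ℓ : ℝ[X]) + 2) := by
      simp only [lam, C_mul, C_add, C_1, C_eq_natCast, map_ofNat]
    rw [hF, hC]
    simp only [derivative_add, derivative_mul, derivative_sq, derivative_sub, derivative_one,
      derivative_natCast, derivative_X, derivative_ofNat]
    simp only [map_ofNat]
    linear_combination (-2 * derivative P) * h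
  have hF1 : ∀ y, y ^ 2 = 1 → P.eval y ^ 2 = 1 → F.eval y = lam := by
    intro y hy hP; simp [hF, hy, hP]
  have hle : F.eval x ≤ lam := by
    have hd : ∀ y, deriv (fun y => F.eval y) y = 2 * y * (derivative P).eval y ^ 2 := by
      intro y; rw [Polynomial.deriv, hF']; simp
    rcases le_total 0 x with h0 | h0
    · rw [← hF1 1 (by norm_num) (by rw [legendre_eval_one]; norm_num)]
      refine monotoneOn_of_deriv_nonneg (convex_Icc 0 1) F.continuous.continuousOn
        F.differentiable.differentiableOn ?_ ⟨h0, hx.2⟩ ⟨zero_le_one, le_rfl⟩ hx.2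
      intro y hy
      rw [interior_Icc] at hy
      rw [hd]; have := hy.1; positivity
    · rw [← hF1 (-1) (by norm_num) (legendre_eval_neg_one_sq _)]
      refine antitoneOn_of_deriv_nonpos (convex_Icc (-1) 0) F.continuous.continuousOn
        F.differentiable.differentiableOn ?_ ⟨le_rfl, by norm_num⟩ ⟨hx.1, h0⟩ hx.1
      intro y hy
      rw [interior_Icc] at hy
      rw [hd]; have := hy.2; nlinarith [sq_nonneg ((derivative P).eval y)]
  have hx2 : 0 ≤ 1 - x ^ 2 := by nlinarith [hx.1, hx.2]
  have : F.eval x = lam * P.eval x ^ 2 + (1 - x ^ 2) * (derivative P).eval x ^ 2 := by simp [hF]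
  have h3 : lam * P.eval x ^ 2 ≤ lam * 1 := by
    nlinarith [mul_nonneg hx2 (sq_nonneg ((derivative P).eval x))]
  exact (sq_le_one_iff_abs_le_one _).1 (le_of_mul_le_mul_left h3 hl)

theorem natDegree_legendre_le (ℓ : ℕ) : (legendre ℓ).natDegree ≤ ℓ := by
  refine (natDegree_C_mul_le _ _).trans ((natDegree_iterate_derivative _ _).trans ?_)
  have : ((X ^ 2 - 1 : ℝ[X]) ^ ℓ).natDegree ≤ ℓ * 2 :=
    natDegree_pow_le_of_le _ (by compute_degree)
  omega

/-- The polynomial `X P' - ℓ P` has degree below `ℓ`, so it is orthogonal to `P`. Integrating `(X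
P²)' = (2ℓ+1) P² + 2 P (X P' - ℓ P)` over `[-1, 1]` then gives the value. -/
theorem integral_legendre_sq (ℓ : ℕ) :
    ∫ t in (-1 : ℝ)..1, (legendre ℓ).eval t ^ 2 = 2 / (2 * ℓ + 1) := by
  set P := legendre ℓ with hP
  have horth : ∀ q : ℝ[X], q.degree < ℓ → ∫ t in (-1 : ℝ)..1, (P * q).eval t = 0 := by
    intro q hq
    have := integral_iterate_derivative_mul_eq_zero ℓ ℓ le_rfl q hq
    rw [hP, legendre, mul_assoc]
    simp only [eval_C_mul]
    rw [intervalIntegral.integral_const_mul, this, mul_zero]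
  have hdeg : (X * derivative P - C (ℓ : ℝ) * P).degree < (ℓ : WithBot ℕ) := by
    rw [Polynomial.degree_lt_iff_coeff_zero]
    intro m hm
    have hPn := natDegree_legendre_le ℓ
    rcases m with _ | m
    · obtain rfl : ℓ = 0 := by simpa using hm
      simp
    · rw [coeff_sub, coeff_X_mul, coeff_derivative, coeff_C_mul]
      rcases hm.eq_or_lt with h | h
      · rw [h]; push_cast; ring
      · rw [coeff_eq_zero_of_natDegree_lt (hPn.trans_lt h)]; simp
  have h1 := horth _ hdeg
  have h2 := integral_eval_derivative (X * P ^ 2) (-1) 1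
  have h3 : ∀ t, (derivative (X * P ^ 2)).eval t =
      (2 * ℓ + 1) * P.eval t ^ 2 + 2 * (P * (X * derivative P - C (ℓ : ℝ) * P)).eval t := by
    intro t
    simp only [derivative_mul, derivative_sq, derivative_X, eval_add, eval_mul, eval_sub, eval_X,
      eval_C, eval_pow, eval_one]
    ring
  simp only [h3] at h2
  rw [intervalIntegral.integral_add (Continuous.intervalIntegrable (by fun_prop) _ _)
    (Continuous.intervalIntegrable (by fun_prop) _ _), intervalIntegral.integral_const_mul,
    intervalIntegral.integral_const_mul, h1] at h2
  have h4 : P.eval 1 ^ 2 = 1 := by rw [legendre_eval_one]; norm_num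
  simp only [eval_mul, eval_X, eval_pow, legendre_eval_neg_one_sq ℓ, hP] at h2
  rw [eq_div_iff (by positivity)]
  rw [← hP, h4] at h2
  linarith

end Legendre

/-! ### Smithies' determinants -/

section Determinants

/-- The matrix of `Q_n` bordered by a first column `c` and a first row `(c 0, n, 0, …, 0)`. -/
def borderedMatrix {S : Type*} [CommRing S] (φ : ℂ →+* S) (ρ : ℕ → ℂ) (c : ℕ → S) (n : ℕ) :
    Matrix (Fin (n + 1)) (Fin (n + 1)) S :=
  Matrix.of fun i j =>
    Fin.cases (c i)
      (fun j' : Fin n =>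
        Fin.cases (if (j' : ℕ) = 0 then φ (n : ℂ) else 0)
          (fun i' : Fin n => φ (qMatrix ρ n i' j')) i) j

/-- The matrix of `Q_(n+1)` is itself bordered, with first column `(0, ρ_2, ρ_3, …)`, so a single
expansion formula serves both `σ_n` and `Δ_n`. -/
theorem qMatrix_succ (ρ : ℕ → ℂ) (n : ℕ) :
    qMatrix ρ (n + 1) =
      borderedMatrix (RingHom.id ℂ) ρ (fun i => if i = 0 then 0 else ρ (i + 1)) n := by
  ext i j
  induction i using Fin.cases <;> induction j using Fin.cases <;>
    simp [qMatrix, borderedMatrix]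
  ring_nf

theorem borderedMatrix_minor {S : Type*} [CommRing S] (φ : ℂ →+* S) (ρ : ℕ → ℂ) (c : ℕ → S)
    (n : ℕ) :
    (borderedMatrix φ ρ c (n + 1)).submatrix Fin.succ (Fin.succAbove 1) =
      borderedMatrix φ ρ (fun i => c (i + 1)) n := by
  ext i j
  induction j using Fin.cases with
  | zero => simp [borderedMatrix]
  | succ j =>
    have h1 : (Fin.succAbove (1 : Fin (n + 2)) j.succ) = j.succ.succ := by
      rw [← Fin.succ_zero_eq_one, Fin.succ_succAbove_succ]; simp
    have : (borderedMatrix φ ρ c (n + 1)).submatrix Fin.succ (Fin.succAbove 1) i j.succ =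
        φ (qMatrix ρ (n + 1) i j.succ) := by
      simp [borderedMatrix, h1]
    rw [this, qMatrix_succ]
    induction i using Fin.cases with
    | zero =>
      simp only [borderedMatrix, Matrix.of_apply, Fin.cases_succ, Fin.cases_zero]
      split_ifs <;> simp
    | succ i => simp [borderedMatrix]

/-- Laplace expansion along the first row, which has only two nonzero entries; the second minor is
again bordered, with the column shifted by one. -/
theorem det_borderedMatrix_succ {S : Type*} [CommRing S] (φ : ℂ →+* S) (ρ : ℕ → ℂ) (c : ℕ → S)
    (n : ℕ) :
    (borderedMatrix φ ρ c (n + 1)).det = c 0 * φ (qMatrix ρ (n + 1)).det -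
      φ (n + 1) * (borderedMatrix φ ρ (fun i => c (i + 1)) n).det := by
  rw [Matrix.det_succ_row_zero, Fin.sum_univ_succ, Fin.sum_univ_succ, Finset.sum_eq_zero]
  · have h0 : (borderedMatrix φ ρ c (n + 1)).submatrix Fin.succ (Fin.succAbove 0) =
        (qMatrix ρ (n + 1)).map φ := by
      ext i j; simp [borderedMatrix]
    rw [Fin.succ_zero_eq_one, borderedMatrix_minor, h0, ← RingHom.mapMatrix_apply,
      ← RingHom.map_det]
    simp [borderedMatrix]
    rw [← Fin.succ_zero_eq_one, Fin.cases_succ]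
    simp; ring
  · intro j _
    simp [borderedMatrix]

theorem factorial_mul_sigmaCoeff (ρ : ℕ → ℂ) (n : ℕ) :
    (qMatrix ρ n).det = (-1) ^ n * n.factorial * sigmaCoeff ρ n := by
  have h : (n.factorial : ℂ) ≠ 0 := by exact_mod_cast n.factorial_ne_zero
  have h1 : ((-1 : ℂ) ^ n) * (-1) ^ n = 1 := by rw [← mul_pow]; simp
  rw [sigmaCoeff, div_eq_mul_inv]
  linear_combination (-(qMatrix ρ n).det) * h1 -
    (qMatrix ρ n).det * ((-1) ^ n * (-1) ^ n) * mul_inv_cancel₀ h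

theorem sigmaCoeff_zero (ρ : ℕ → ℂ) : sigmaCoeff ρ 0 = 1 := by
  simp [sigmaCoeff]

/-- Expansion of a bordered determinant along its first column. -/
theorem det_borderedMatrix {S : Type*} [CommRing S] (φ : ℂ →+* S) (ρ : ℕ → ℂ) (n : ℕ) :
    ∀ c : ℕ → S, (borderedMatrix φ ρ c n).det = φ ((-1) ^ n * n.factorial) *
      ∑ j ∈ Finset.range (n + 1), c j * φ (sigmaCoeff ρ (n - j)) := by
  induction n with
  | zero => intro c; simp [borderedMatrix, sigmaCoeff_zero]
  | succ n ih =>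
    intro c
    rw [det_borderedMatrix_succ, ih, Finset.sum_range_succ' _ (n + 1), factorial_mul_sigmaCoeff,
      Nat.factorial_succ]
    simp only [Nat.add_sub_add_right, Nat.sub_zero, map_mul, pow_succ, Nat.cast_mul, map_neg,
      map_one, Nat.cast_add, Nat.cast_one, map_add]
    ring

/-- Coefficientwise form of `σ'(g) = -(∑ ρ_m g^(m-1)) σ(g)` with `m ≥ 2`. Continuity, holomorphy and
conjugation of `σ_n` are all proved by strong induction on this recursion. -/
theorem sigmaCoeff_succ (ρ : ℕ → ℂ) (n : ℕ) :
    ((n : ℂ) + 1) * sigmaCoeff ρ (n + 1) =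
      -∑ j ∈ Finset.range n, ρ (j + 2) * sigmaCoeff ρ (n - (j + 1)) := by
  have h := factorial_mul_sigmaCoeff ρ (n + 1)
  rw [qMatrix_succ, det_borderedMatrix, Finset.sum_range_succ'] at h
  have h2 : (n.factorial : ℂ) ≠ 0 := by exact_mod_cast n.factorial_ne_zero
  have h3 : ((-1 : ℂ) ^ n) ≠ 0 := pow_ne_zero _ (by norm_num)
  simp only [RingHom.id_apply, Nat.factorial_succ, Nat.cast_mul, pow_succ, Nat.succ_ne_zero,
    if_false, if_true, zero_mul, add_zero, Nat.cast_add, Nat.cast_one] at h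
  apply mul_left_cancel₀ (mul_ne_zero h3 h2)
  linear_combination h

theorem deltaPoly_eq (ρ : ℕ → ℂ) (n : ℕ) :
    deltaPoly ρ n = ∑ j ∈ Finset.range (n + 1),
      Polynomial.C (sigmaCoeff ρ (n - j)) * Polynomial.X ^ j := by
  have h2 : (n.factorial : ℂ) ≠ 0 := by exact_mod_cast n.factorial_ne_zero
  have h1 : ((-1 : ℂ) ^ n) * (-1) ^ n = 1 := by rw [← mul_pow]; simp
  have h : deltaMatrix ρ n = borderedMatrix Polynomial.C ρ (fun i => Polynomial.X ^ i) n := rfl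
  rw [deltaPoly, h, det_borderedMatrix, ← mul_assoc, ← Polynomial.C_mul]
  rw [show (-1) ^ n / (n.factorial : ℂ) * ((-1) ^ n * n.factorial) = 1 by
    rw [div_eq_mul_inv]; linear_combination h1 + ((-1) ^ n * (-1) ^ n) * mul_inv_cancel₀ h2]
  rw [Polynomial.C_1, one_mul]
  exact Finset.sum_congr rfl fun j _ => mul_comm _ _

/-- `N` is the Cauchy product of `σ` with the formal Neumann series `∑ K^(j+1) g^j`; recall that
`kernelPow K j` stands for `K^(j+1)`. -/
theorem nCoeff_eq (K : ℝ → ℝ → ℂ) (n : ℕ) (R R' : ℝ) :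
    nCoeff K n R R' = ∑ j ∈ Finset.range (n + 1),
      sigmaCoeff (rho K) (n - j) * kernelPow K j R R' := by
  refine Finset.sum_congr rfl fun j hj => ?_
  rw [deltaPoly_eq, Polynomial.finsetSum_coeff, Finset.sum_eq_single j]
  · simp
  · intro i _ hi; simp [Polynomial.coeff_X_pow, hi.symm]
  · intro h; exact absurd hj h

/-- The traces of index `0` and `1` never enter the recursion. This reconciles the conventional
zeros of `rho` with the actual traces of `A^0` and `A` for matrices. -/
theorem sigmaCoeff_congr {ρ ρ' : ℕ → ℂ} (h : ∀ n, ρ (n + 2) = ρ' (n + 2)) (n : ℕ) :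
    sigmaCoeff ρ n = sigmaCoeff ρ' n := by
  induction n using Nat.strong_induction_on with
  | _ n ih =>
    rcases n with _ | n
    · simp [sigmaCoeff_zero]
    · have hn : (n : ℂ) + 1 ≠ 0 := by exact_mod_cast n.succ_ne_zero
      apply mul_left_cancel₀ hn
      rw [sigmaCoeff_succ, sigmaCoeff_succ]
      congr 1
      refine Finset.sum_congr rfl fun j hj => ?_
      rw [h, ih _ (by omega)]

end Determinants

/-! ### Regularised determinants of matrices -/

section MatrixBounds

open scoped Matrix.Norms.Frobenius ComplexOrder
open Matrix

variable {ι : Type*} [Fintype ι] [DecidableEq ι]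

theorem frobenius_norm_sq (A : Matrix ι ι ℂ) : ‖A‖ ^ 2 = ∑ i, ∑ j, ‖A i j‖ ^ 2 := by
  rw [Matrix.frobenius_norm_def, ← Real.sqrt_eq_rpow, Real.sq_sqrt (by positivity)]
  simp

theorem re_trace_mul_conjTranspose (A : Matrix ι ι ℂ) :
    (A * Aᴴ).trace.re = ‖A‖ ^ 2 := by
  rw [frobenius_norm_sq, Matrix.trace, Complex.re_sum]
  refine Finset.sum_congr rfl fun i _ => ?_
  rw [Matrix.diag_apply, Matrix.mul_apply, Complex.re_sum]
  refine Finset.sum_congr rfl fun j _ => ?_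
  rw [Matrix.conjTranspose_apply, RCLike.star_def, Complex.mul_conj, Complex.ofReal_re,
    Complex.normSq_eq_norm_sq]

/-- Multiply the inequalities `λ ≤ e^(λ-1)` over the nonnegative eigenvalues. -/
theorem det_re_le_exp_of_posSemidef {M : Matrix ι ι ℂ} (hM : M.PosSemidef) :
    M.det.re ≤ Real.exp (M.trace.re - Fintype.card ι) := by
  have h1 := hM.isHermitian.det_eq_prod_eigenvalues
  have h2 := hM.isHermitian.trace_eq_sum_eigenvalues
  have h3 : M.det = ((∏ i, hM.isHermitian.eigenvalues i : ℝ) : ℂ) := by rw [h1]; simp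
  have h4 : M.trace = ((∑ i, hM.isHermitian.eigenvalues i : ℝ) : ℂ) := by rw [h2]; simp
  rw [h3, h4, Complex.ofReal_re, Complex.ofReal_re]
  have h5 : (∑ i, hM.isHermitian.eigenvalues i) - (Fintype.card ι : ℝ) =
      ∑ i, (hM.isHermitian.eigenvalues i - 1) := by simp
  rw [h5, Real.exp_sum]
  refine Finset.prod_le_prod (fun i _ => hM.eigenvalues_nonneg i) fun i _ => ?_
  have := Real.add_one_le_exp (hM.isHermitian.eigenvalues i - 1)
  linarith

/-- The regularised determinant `det (1 - B) e^(tr B)`. -/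
def regDet (B : Matrix ι ι ℂ) : ℂ := (1 - B).det * Complex.exp B.trace

/-- Carleman's inequality. Apply the preceding bound to `(1 - B)(1 - B)ᴴ`, whose trace has real part
`card ι - 2 Re tr B + ‖B‖²`: the dimension cancels, and the factor `e^(tr B)` removes the trace of
`B`. Only the Frobenius norm remains, which is what survives the passage to infinite dimension. -/
theorem norm_regDet_le (B : Matrix ι ι ℂ) : ‖regDet B‖ ≤ Real.exp (‖B‖ ^ 2 / 2) := by
  have h1 := det_re_le_exp_of_posSemidef (Matrix.posSemidef_self_mul_conjTranspose (1 - B))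
  have h2 : ((1 - B) * (1 - B)ᴴ).det.re = ‖(1 - B).det‖ ^ 2 := by
    rw [det_mul, det_conjTranspose, RCLike.star_def, Complex.mul_conj, Complex.ofReal_re,
      Complex.normSq_eq_norm_sq]
  have h3 : ((1 - B) * (1 - B)ᴴ).trace.re = Fintype.card ι - 2 * B.trace.re + ‖B‖ ^ 2 := by
    rw [← re_trace_mul_conjTranspose, conjTranspose_sub, conjTranspose_one]
    have : (1 - B) * (1 - Bᴴ) = 1 - B - Bᴴ + B * Bᴴ := by noncomm_ring
    rw [this]
    simp only [trace_add, trace_sub, trace_one, trace_conjTranspose, Complex.add_re,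
      Complex.sub_re, RCLike.star_def, Complex.conj_re, Complex.natCast_re]
    ring
  rw [h2, h3] at h1
  rw [regDet, norm_mul, Complex.norm_exp]
  refine (sq_le_sq₀ (by positivity) (Real.exp_pos _).le).1 ?_
  calc (‖(1 - B).det‖ * Real.exp B.trace.re) ^ 2
      = ‖(1 - B).det‖ ^ 2 * Real.exp (2 * B.trace.re) := by
        rw [mul_pow, ← Real.exp_nat_mul]; norm_num
    _ ≤ Real.exp (Fintype.card ι - 2 * B.trace.re + ‖B‖ ^ 2 - Fintype.card ι) *
        Real.exp (2 * B.trace.re) := by gcongr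
    _ = Real.exp (‖B‖ ^ 2 / 2) ^ 2 := by
        rw [← Real.exp_add, ← Real.exp_nat_mul]; congr 1; push_cast; ring

/-- By Cramer's rule, the sum on the right is the derivative of the determinant as a multilinear
function of the rows. -/
theorem trace_adjugate_mul (M C : Matrix ι ι ℂ) :
    (M.adjugate * C).trace = ∑ i, (M.updateRow i (C i)).det := by
  rw [Matrix.trace_mul_comm, Matrix.trace]
  refine Finset.sum_congr rfl fun i _ => ?_
  rw [← cramer_transpose_apply, cramer_eq_adjugate_mulVec, ← adjugate_transpose, diag_apply,
    mul_apply, mulVec, dotProduct]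
  exact Finset.sum_congr rfl fun j _ => mul_comm _ _

/-- Jacobi's formula. -/
theorem hasDerivAt_det_add_smul (M C : Matrix ι ι ℂ) :
    HasDerivAt (fun s : ℂ => (M + s • C).det) (M.adjugate * C).trace 0 := by
  let f : ContinuousMultilinearMap ℂ (fun _ : ι => ι → ℂ) ℂ :=
    ⟨(Matrix.detRowAlternating (n := ι) (R := ℂ)).toMultilinearMap, by
      change Continuous (fun m : Matrix ι ι ℂ => m.det)
      fun_prop⟩
  have h1 : HasDerivAt (fun s : ℂ => (fun i => M i + s • C i)) (fun i => C i) 0 := by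
    rw [hasDerivAt_pi]
    intro i
    simpa using ((hasDerivAt_id (0 : ℂ)).smul_const (C i)).const_add (M i)
  have h2 := (f.hasFDerivAt (fun i => M i + (0 : ℂ) • C i)).comp_hasDerivAt (0 : ℂ) h1
  rw [trace_adjugate_mul]
  refine HasDerivAt.congr_deriv h2 ?_
  rw [ContinuousMultilinearMap.linearDeriv_apply]
  refine Finset.sum_congr rfl fun i _ => ?_
  simp only [zero_smul, add_zero]
  rfl

/-- The product rule leaves a term in `tr C` alone, which would have no meaning for general
Hilbert–Schmidt kernels. It is absorbed by `adj(1 - M) M = adj(1 - M) - det(1 - M)`, so that `C`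
occurs only in the product `M C`. -/
theorem hasDerivAt_regDet_add_smul (M C : Matrix ι ι ℂ) :
    HasDerivAt (fun s : ℂ => regDet (M + s • C))
      (-(Complex.exp M.trace * ((1 - M).adjugate * (M * C)).trace)) 0 := by
  have h1 := hasDerivAt_det_add_smul (1 - M) (-C)
  have h2 : HasDerivAt (fun s : ℂ => Complex.exp (M.trace + s * C.trace))
      (Complex.exp M.trace * C.trace) 0 := by
    simpa using (((hasDerivAt_id (0 : ℂ)).mul_const C.trace).const_add M.trace).cexp
  have h3 := h1.mul h2
  have h4 : (1 - M).adjugate * (M * C) = (1 - M).adjugate * C - (1 - M).det • C := by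
    have := adjugate_mul (1 - M)
    rw [mul_sub, mul_one] at this
    rw [← mul_assoc, eq_sub_of_add_eq' (sub_eq_iff_eq_add.1 this).symm, sub_mul, smul_mul_assoc,
      one_mul]
  refine (h3.congr_deriv ?_).congr_of_eventuallyEq (Eventually.of_forall fun s => ?_)
  · rw [h4]
    simp only [mul_neg, trace_neg, zero_mul, add_zero, zero_smul, trace_sub, trace_smul,
      smul_eq_mul]
    ring
  · simp only [regDet, trace_add, trace_smul, smul_eq_mul, smul_neg]
    congr 2
    abel

/-- The function `tr (e^(g tr A) adj(1 - g A) A B)`. -/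
def smithiesTrace (A B : Matrix ι ι ℂ) (g : ℂ) : ℂ :=
  Complex.exp (g * A.trace) * ((1 - g • A).adjugate * (A * B)).trace

theorem differentiable_regDet_smul_add (A B : Matrix ι ι ℂ) :
    Differentiable ℂ (fun g : ℂ => regDet (A + g • B)) := by
  unfold regDet
  simp only [Matrix.det_apply, Matrix.trace, diag_apply, Matrix.sub_apply, Matrix.add_apply, Matrix.smul_apply,
    smul_eq_mul]
  fun_prop

theorem differentiable_regDet_smul (A : Matrix ι ι ℂ) :
    Differentiable ℂ (fun g : ℂ => regDet (g • A)) := by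
  simpa using differentiable_regDet_smul_add 0 A

theorem differentiable_smithiesTrace (A B : Matrix ι ι ℂ) :
    Differentiable ℂ (smithiesTrace A B) := by
  unfold smithiesTrace
  simp only [trace_adjugate_mul, Matrix.det_apply, updateRow_apply, Matrix.sub_apply, Matrix.smul_apply,
    smul_eq_mul]
  refine Differentiable.mul (by fun_prop) (Differentiable.fun_sum fun i _ =>
    Differentiable.fun_sum fun σ _ => Differentiable.const_smul
      (Differentiable.fun_finsetProd fun j _ => ?_) _)
  split_ifs <;> fun_prop

/-- Up to sign, the left side is the derivative at `s = 0` of the entire function `regDet (gA +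
sB)`; Cauchy's estimate on the unit circle combines with `norm_regDet_le`. -/
theorem norm_smul_smithiesTrace_le (A B : Matrix ι ι ℂ) (g : ℂ) :
    ‖g * smithiesTrace A B g‖ ≤ Real.exp ((‖g‖ * ‖A‖ + ‖B‖) ^ 2 / 2) := by
  have h1 := hasDerivAt_regDet_add_smul (g • A) B
  have h2 : -(Complex.exp (g • A).trace * ((1 - g • A).adjugate * (g • A * B)).trace) =
      -(g * smithiesTrace A B g) := by
    rw [smithiesTrace, smul_mul_assoc, Matrix.mul_smul, trace_smul, trace_smul]
    simp only [smul_eq_mul]; ring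
  rw [h2] at h1
  rw [← norm_neg, ← h1.deriv]
  have h3 := Complex.norm_deriv_le_of_forall_mem_sphere_norm_le (c := (0 : ℂ)) (R := 1)
    (C := Real.exp ((‖g‖ * ‖A‖ + ‖B‖) ^ 2 / 2)) one_pos
    (differentiable_regDet_smul_add (g • A) B).diffContOnCl ?_
  · simpa using h3
  · intro s hs
    have hs1 : ‖s‖ = 1 := by simpa using hs
    refine (norm_regDet_le _).trans (Real.exp_le_exp.2 ?_)
    gcongr
    refine (norm_add_le _ _).trans ?_
    rw [norm_smul, norm_smul, hs1, one_mul]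

theorem deriv_regDet_smul (A : Matrix ι ι ℂ) (g : ℂ) :
    deriv (fun g : ℂ => regDet (g • A)) g = -(g * smithiesTrace A A g) := by
  have h1 := hasDerivAt_regDet_add_smul (g • A) A
  have h2 : -(Complex.exp (g • A).trace * ((1 - g • A).adjugate * (g • A * A)).trace) =
      -(g * smithiesTrace A A g) := by
    rw [smithiesTrace, smul_mul_assoc, Matrix.mul_smul, trace_smul, trace_smul]
    simp only [smul_eq_mul]; ring
  rw [h2] at h1
  have h3 : HasDerivAt (fun z : ℂ => z - g) 1 g := (hasDerivAt_id g).sub_const g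
  have h4 := HasDerivAt.comp g (by simpa using h1) h3
  have h5 : ((fun s : ℂ => regDet (g • A + s • A)) ∘ fun z => z - g) =
      fun z => regDet (z • A) := by
    ext z
    simp [← add_smul]
  rw [h5, mul_one] at h4
  exact h4.deriv

/-- A resolvent identity without inverses: `adj(1 - gA) = det(1 - gA) + g adj(1 - gA) A`. It holds
also where `1 - gA` is singular. -/
theorem smithiesTrace_eq (A B : Matrix ι ι ℂ) (g : ℂ) :
    smithiesTrace A B g =
      regDet (g • A) * (A * B).trace + g * smithiesTrace A (A * B) g := by
  have h : (1 - g • A).adjugate * (A * B) =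
      (1 - g • A).det • (A * B) + g • ((1 - g • A).adjugate * (A * (A * B))) := by
    have := adjugate_mul (1 - g • A)
    rw [mul_sub, mul_one, sub_eq_iff_eq_add] at this
    conv_lhs => rw [this]
    rw [add_mul, smul_mul_assoc, one_mul, Matrix.mul_smul, smul_mul_assoc, mul_assoc]
  rw [smithiesTrace, h, smithiesTrace, regDet, trace_add, trace_smul, trace_smul, trace_smul]
  simp only [smul_eq_mul]
  ring

/-- Taylor coefficients at the origin. -/
def taylorCoeff (f : ℂ → ℂ) (n : ℕ) : ℂ := iteratedDeriv n f 0 / n.factorial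

theorem iteratedDeriv_id_mul (n : ℕ) : ∀ {f : ℂ → ℂ}, Differentiable ℂ f →
    iteratedDeriv (n + 1) (fun z => z * f z) 0 = (n + 1) * iteratedDeriv n f 0 := by
  induction n with
  | zero =>
    intro f hf
    have := (hasDerivAt_id (0 : ℂ)).fun_mul (hf 0).hasDerivAt
    simpa [iteratedDeriv_one] using this.deriv
  | succ n ih =>
    intro f hf
    have hf' : Differentiable ℂ (deriv f) := hf.deriv
    have h : deriv (fun z => z * f z) = fun z => f z + z * deriv f z := by
      ext z
      simpa using ((hasDerivAt_id z).fun_mul (hf z).hasDerivAt).deriv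
    rw [iteratedDeriv_succ', h, iteratedDeriv_fun_add hf.contDiff.contDiffAt
      (Differentiable.contDiff (by fun_prop)).contDiffAt, ih hf', ← iteratedDeriv_succ']
    push_cast; ring

theorem taylorCoeff_id_mul_succ {f : ℂ → ℂ} (hf : Differentiable ℂ f) (n : ℕ) :
    taylorCoeff (fun z => z * f z) (n + 1) = taylorCoeff f n := by
  have h : (n.factorial : ℂ) ≠ 0 := by exact_mod_cast n.factorial_ne_zero
  have h' : (n : ℂ) + 1 ≠ 0 := by exact_mod_cast n.succ_ne_zero
  rw [taylorCoeff, taylorCoeff, iteratedDeriv_id_mul n hf, Nat.factorial_succ]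
  push_cast
  rw [mul_div_mul_left _ _ h']

theorem norm_taylorCoeff_mul_pow_le {f : ℂ → ℂ} (hf : Differentiable ℂ f) {r C : ℝ} (hr : 0 < r)
    (hC : ∀ z, ‖z‖ = r → ‖f z‖ ≤ C) (n : ℕ) : ‖taylorCoeff f n‖ * r ^ n ≤ C := by
  have h := Complex.norm_iteratedDeriv_le_of_forall_mem_sphere_norm_le (c := 0) n hr
    hf.diffContOnCl (fun z hz => hC z (by simpa using hz))
  have h0 : (0 : ℝ) < n.factorial := by exact_mod_cast n.factorial_pos
  rw [taylorCoeff, norm_div, Complex.norm_natCast]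
  rw [le_div_iff₀ (by positivity)] at h
  rw [div_mul_eq_mul_div, div_le_iff₀ h0]
  linarith

/-- Each use of `smithiesTrace_eq` lowers the Taylor index by one and replaces `B` by `A B`, which
explains the induction with `B` universally quantified. -/
theorem taylorCoeff_smithiesTrace (A : Matrix ι ι ℂ) (n : ℕ) : ∀ B : Matrix ι ι ℂ,
    taylorCoeff (smithiesTrace A B) n = ∑ j ∈ Finset.range (n + 1),
      taylorCoeff (fun g => regDet (g • A)) (n - j) * (A ^ (j + 1) * B).trace := by
  have key : ∀ (n : ℕ) (B : Matrix ι ι ℂ), taylorCoeff (smithiesTrace A B) n =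
      taylorCoeff (fun g => regDet (g • A)) n * (A * B).trace +
      taylorCoeff (fun g => g * smithiesTrace A (A * B) g) n := by
    intro n B
    have h : smithiesTrace A B = fun g =>
        (A * B).trace * regDet (g • A) + g * smithiesTrace A (A * B) g := by
      ext g; rw [smithiesTrace_eq]; ring
    have hd := differentiable_regDet_smul A
    have hd' := differentiable_smithiesTrace A (A * B)
    rw [taylorCoeff, h, iteratedDeriv_fun_add (Differentiable.contDiff (by fun_prop)).contDiffAt
      (Differentiable.contDiff (by fun_prop)).contDiffAt, iteratedDeriv_const_mul _
      hd.contDiff.contDiffAt, taylorCoeff, taylorCoeff]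
    ring
  induction n with
  | zero =>
    intro B
    rw [key]
    simp [taylorCoeff]
  | succ n ih =>
    intro B
    rw [key, taylorCoeff_id_mul_succ (differentiable_smithiesTrace _ _), ih,
      Finset.sum_range_succ' _ (n + 1)]
    simp only [Nat.add_sub_add_right, Nat.sub_zero, pow_succ _ (_ + 1), zero_add, pow_one,
      mul_assoc]
    rw [add_comm]

/-- Since `d/dg regDet (gA) = -g smithiesTrace A A g`, the Taylor coefficients of `regDet (gA)` obey
the recursion `sigmaCoeff_succ`. Thus Smithies' formula computes an entire function, and Cauchy's
estimates apply to it. -/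
theorem taylorCoeff_regDet (A : Matrix ι ι ℂ) (n : ℕ) :
    taylorCoeff (fun g => regDet (g • A)) n = sigmaCoeff (fun j => (A ^ j).trace) n := by
  induction n using Nat.strong_induction_on with
  | _ n ih =>
    rcases n with _ | n
    · simp [sigmaCoeff_zero, taylorCoeff, regDet]
    have h0 : (n.factorial : ℂ) ≠ 0 := by exact_mod_cast n.factorial_ne_zero
    have hn : (n : ℂ) + 1 ≠ 0 := by exact_mod_cast n.succ_ne_zero
    apply mul_left_cancel₀ hn
    rw [sigmaCoeff_succ]
    have h1 : ((n : ℂ) + 1) * taylorCoeff (fun g => regDet (g • A)) (n + 1) =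
        -taylorCoeff (fun g => g * smithiesTrace A A g) n := by
      have h2 : deriv (fun g : ℂ => regDet (g • A)) = fun g => -(g * smithiesTrace A A g) := by
        ext g; exact deriv_regDet_smul A g
      rw [taylorCoeff, taylorCoeff, iteratedDeriv_succ', h2, iteratedDeriv_fun_neg,
        Nat.factorial_succ]
      push_cast
      field_simp
    rw [h1]
    rcases n with _ | n
    · simp [taylorCoeff]
    rw [taylorCoeff_id_mul_succ (differentiable_smithiesTrace _ _), taylorCoeff_smithiesTrace]
    congr 1
    refine Finset.sum_congr rfl fun j hj => ?_
    rw [Nat.add_sub_add_right, ih (n - j) (by omega), ← pow_succ, mul_comm]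

theorem norm_sigmaCoeff_trace_le (A : Matrix ι ι ℂ) {r : ℝ} (hr : 0 < r) (n : ℕ) :
    ‖sigmaCoeff (fun j => (A ^ j).trace) n‖ * r ^ n ≤ Real.exp ((r * ‖A‖) ^ 2 / 2) := by
  rw [← taylorCoeff_regDet]
  refine norm_taylorCoeff_mul_pow_le (differentiable_regDet_smul A) hr (fun z hz => ?_) n
  refine (norm_regDet_le _).trans (Real.exp_le_exp.2 ?_)
  rw [norm_smul, hz]

/-- The available bound concerns `g * smithiesTrace A B g`, whose coefficient of index `n + 1` is
the sum in question; hence the power `r ^ (n + 1)`. -/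
theorem norm_sum_sigmaCoeff_trace_le (A B : Matrix ι ι ℂ) {r : ℝ} (hr : 0 < r) (n : ℕ) :
    ‖∑ j ∈ Finset.range (n + 1),
      sigmaCoeff (fun j => (A ^ j).trace) (n - j) * (A ^ (j + 1) * B).trace‖ * r ^ (n + 1) ≤
      Real.exp ((r * ‖A‖ + ‖B‖) ^ 2 / 2) := by
  simp only [← taylorCoeff_regDet]
  rw [← taylorCoeff_smithiesTrace, ← taylorCoeff_id_mul_succ (differentiable_smithiesTrace _ _)]
  have hd := differentiable_smithiesTrace A B
  refine norm_taylorCoeff_mul_pow_le (by fun_prop) hr (fun z hz => ?_) (n + 1)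
  have := norm_smul_smithiesTrace_le A B z
  rwa [hz] at this

end MatrixBounds

/-! ### Square integrable kernels on the half-line -/

section Kernels

open Function

theorem lintegral_mul_sq_le {X : Type*} [MeasurableSpace X] {m : Measure X} {f g : X → ℝ≥0∞}
    (hf : AEMeasurable f m) (hg : AEMeasurable g m) :
    (∫⁻ x, f x * g x ∂m) ^ 2 ≤ (∫⁻ x, f x ^ 2 ∂m) * ∫⁻ x, g x ^ 2 ∂m := by
  have h := ENNReal.lintegral_mul_le_Lp_mul_Lq m Real.HolderConjugate.two_two hf hg
  have h2 := pow_le_pow_left₀ bot_le h 2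
  rw [mul_pow, ← ENNReal.rpow_natCast, ← ENNReal.rpow_natCast, ← ENNReal.rpow_natCast,
    ← ENNReal.rpow_mul, ← ENNReal.rpow_mul] at h2
  norm_num at h2
  exact h2

theorem eLpNorm_two_sq {X E : Type*} [MeasurableSpace X] [NormedAddCommGroup E] {m : Measure X}
    (f : X → E) : eLpNorm f 2 m ^ 2 = ∫⁻ x, ‖f x‖ₑ ^ 2 ∂m := by
  have := eLpNorm_nnreal_pow_eq_lintegral (f := f) (μ := m) (p := 2) (by norm_num)
  norm_num at this
  exact_mod_cast this

theorem memLp_two_iff_lintegral {X E : Type*} [MeasurableSpace X] [NormedAddCommGroup E]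
    {m : Measure X} {f : X → E} (hf : AEStronglyMeasurable f m) :
    MemLp f 2 m ↔ ∫⁻ x, ‖f x‖ₑ ^ 2 ∂m < ∞ := by
  rw [← eLpNorm_two_sq]
  simp [MemLp, hf, ENNReal.pow_lt_top_iff]

instance : SigmaFinite halfLine := by unfold halfLine; infer_instance

/-- Lebesgue measure on the open quadrant. -/
abbrev quadrant : Measure (ℝ × ℝ) := halfLine.prod halfLine

theorem ae_quadrant_of_ae {P : ℝ → ℝ → Prop} {Q₁ Q₂ : ℝ → Prop} (h₁ : ∀ᵐ x ∂halfLine, Q₁ x)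
    (h₂ : ∀ᵐ x ∂halfLine, Q₂ x) (h : ∀ x y, Q₁ x → Q₂ y → P x y) :
    ∀ᵐ p ∂quadrant, P p.1 p.2 := by
  filter_upwards [Measure.quasiMeasurePreserving_fst.ae h₁,
    Measure.quasiMeasurePreserving_snd.ae h₂] with p hp hq using h _ _ hp hq

theorem ae_ae_swap_of_ae {P : ℝ → ℝ → Prop} (h : ∀ᵐ p ∂quadrant, P p.1 p.2) :
    ∀ᵐ y ∂halfLine, ∀ᵐ x ∂halfLine, P x y := by
  have := Measure.measurePreserving_swap (μ := halfLine) (ν := halfLine)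
    |>.quasiMeasurePreserving.ae h
  exact Measure.ae_ae_of_ae_prod this

theorem kernelComp_integrand_congr {f f' g g' : ℝ → ℝ → ℂ}
    (hf : uncurry f =ᵐ[quadrant] uncurry f') (hg : uncurry g =ᵐ[quadrant] uncurry g') :
    ∀ᵐ p ∂quadrant,
      (fun y => f p.1 y * g y p.2) =ᵐ[halfLine] (fun y => f' p.1 y * g' y p.2) := by
  have h1 : ∀ᵐ x ∂halfLine, ∀ᵐ y ∂halfLine, f x y = f' x y := Measure.ae_ae_of_ae_prod hf
  have h2 : ∀ᵐ z ∂halfLine, ∀ᵐ y ∂halfLine, g y z = g' y z := ae_ae_swap_of_ae hg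
  refine ae_quadrant_of_ae
    (P := fun x z => (fun y => f x y * g y z) =ᵐ[halfLine] fun y => f' x y * g' y z) h1 h2 ?_
  intro x z hx hz
  filter_upwards [hx, hz] with y h3 h4
  rw [h3, h4]

theorem kernelComp_congr {f f' g g' : ℝ → ℝ → ℂ}
    (hf : uncurry f =ᵐ[quadrant] uncurry f') (hg : uncurry g =ᵐ[quadrant] uncurry g') :
    uncurry (kernelComp f g) =ᵐ[quadrant] uncurry (kernelComp f' g') := by
  filter_upwards [kernelComp_integrand_congr hf hg] with p hp
  exact integral_congr_ae hp

/-- The basic estimate for the composition of two square integrable kernels. -/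
theorem kernelComp_estimate {f g : ℝ → ℝ → ℂ} (hf : MemLp (uncurry f) 2 quadrant)
    (hg : MemLp (uncurry g) 2 quadrant) :
    (∀ᵐ p ∂quadrant, Integrable (fun y => f p.1 y * g y p.2) halfLine) ∧
      AEStronglyMeasurable (uncurry (kernelComp f g)) quadrant ∧
      eLpNorm (uncurry (kernelComp f g)) 2 quadrant ≤
        eLpNorm (uncurry f) 2 quadrant * eLpNorm (uncurry g) 2 quadrant := by
  -- Strongly measurable representatives make every section measurable, not merely almost every one.
  wlog hs : StronglyMeasurable (uncurry f) ∧ StronglyMeasurable (uncurry g) generalizing f g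
  · have hf1 := hf.1.ae_eq_mk
    have hg1 := hg.1.ae_eq_mk
    set f' : ℝ → ℝ → ℂ := curry (hf.1.mk _)
    set g' : ℝ → ℝ → ℂ := curry (hg.1.mk _)
    obtain ⟨h1, h2, h3⟩ := this (f := f') (g := g') ((memLp_congr_ae hf1).1 hf)
      ((memLp_congr_ae hg1).1 hg)
      ⟨hf.1.stronglyMeasurable_mk, hg.1.stronglyMeasurable_mk⟩
    have hc := kernelComp_congr (f := f) (f' := f') (g := g) (g' := g') hf1 hg1
    refine ⟨?_, h2.congr hc.symm, ?_⟩
    · filter_upwards [h1, kernelComp_integrand_congr (f := f) (f' := f') (g := g) (g' := g')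
        hf1 hg1] with p hp hp'
      exact hp.congr hp'.symm
    · rw [eLpNorm_congr_ae hc, eLpNorm_congr_ae hf1, eLpNorm_congr_ae hg1]
      exact h3
  obtain ⟨hfs, hgs⟩ := hs
  have hfx : ∀ x, StronglyMeasurable (fun y => f x y) := fun x =>
    hfs.comp_measurable measurable_prodMk_left
  have hgz : ∀ z, StronglyMeasurable (fun y => g y z) := fun z =>
    hgs.comp_measurable measurable_prodMk_right
  set a : ℝ → ℝ≥0∞ := fun x => ∫⁻ y, ‖f x y‖ₑ ^ 2 ∂halfLine
  set b : ℝ → ℝ≥0∞ := fun z => ∫⁻ y, ‖g y z‖ₑ ^ 2 ∂halfLine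
  have ha : Measurable a := (hfs.enorm.pow_const 2).lintegral_prod_right'
  have hb : Measurable b := (hgs.enorm.pow_const 2).lintegral_prod_left'
  have hA : ∫⁻ x, a x ∂halfLine = eLpNorm (uncurry f) 2 quadrant ^ 2 := by
    rw [eLpNorm_two_sq, lintegral_prod _ (hfs.enorm.pow_const 2).aemeasurable]
    rfl
  have hB : ∫⁻ x, b x ∂halfLine = eLpNorm (uncurry g) 2 quadrant ^ 2 := by
    rw [eLpNorm_two_sq, lintegral_prod_symm _ (hgs.enorm.pow_const 2).aemeasurable]
    rfl
  have hAB : ∫⁻ p, a p.1 * b p.2 ∂quadrant =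
      (eLpNorm (uncurry f) 2 quadrant * eLpNorm (uncurry g) 2 quadrant) ^ 2 := by
    rw [lintegral_prod_mul ha.aemeasurable hb.aemeasurable, hA, hB, mul_pow]
  have hfin : ∀ᵐ p ∂quadrant, a p.1 * b p.2 < ∞ := by
    refine ae_lt_top (by fun_prop) ?_
    rw [hAB]
    exact (ENNReal.pow_lt_top (ENNReal.mul_lt_top hf.2 hg.2)).ne
  have hcs : ∀ x z, (∫⁻ y, ‖f x y * g y z‖ₑ ∂halfLine) ^ 2 ≤ a x * b z := by
    intro x z
    simp only [enorm_mul]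
    exact lintegral_mul_sq_le (hfx x).enorm.aemeasurable (hgz z).enorm.aemeasurable
  have hmeas : StronglyMeasurable (uncurry (kernelComp f g)) := by
    refine StronglyMeasurable.integral_prod_right'
      (f := fun q : (ℝ × ℝ) × ℝ => f q.1.1 q.2 * g q.2 q.1.2) ?_
    exact (hfs.comp_measurable (g := fun q : (ℝ × ℝ) × ℝ => (q.1.1, q.2)) (by fun_prop)).mul
      (hgs.comp_measurable (g := fun q : (ℝ × ℝ) × ℝ => (q.2, q.1.2)) (by fun_prop))
  refine ⟨?_, hmeas.aestronglyMeasurable, ?_⟩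
  · filter_upwards [hfin] with p hp
    refine ⟨((hfx _).mul (hgz _)).aestronglyMeasurable, ?_⟩
    exact (ENNReal.pow_lt_top_iff.1 ((hcs _ _).trans_lt hp)).resolve_right (by norm_num)
  · refine (ENNReal.pow_le_pow_left_iff two_ne_zero).1 ?_
    rw [eLpNorm_two_sq, ← hAB]
    refine lintegral_mono fun p => (pow_le_pow_left₀ bot_le ?_ 2).trans (hcs p.1 p.2)
    exact enorm_integral_le_lintegral_enorm _

theorem kernelComp_memLp {f g : ℝ → ℝ → ℂ} (hf : MemLp (uncurry f) 2 quadrant)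
    (hg : MemLp (uncurry g) 2 quadrant) : MemLp (uncurry (kernelComp f g)) 2 quadrant := by
  obtain ⟨-, h2, h3⟩ := kernelComp_estimate hf hg
  exact ⟨h2, h3.trans_lt (ENNReal.mul_lt_top hf.2 hg.2)⟩

/-- The Hilbert space of square integrable kernels on the half-line. -/
abbrev L2Kernel : Type := Lp ℂ 2 quadrant

theorem memLp_uncurry_curry (F : L2Kernel) : MemLp (uncurry (curry (F : ℝ × ℝ → ℂ))) 2 quadrant :=
  Lp.memLp F

theorem kernelComp_add_left_ae {f f' g : ℝ → ℝ → ℂ} (hf : MemLp (uncurry f) 2 quadrant)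
    (hf' : MemLp (uncurry f') 2 quadrant) (hg : MemLp (uncurry g) 2 quadrant) :
    uncurry (kernelComp (f + f') g) =ᵐ[quadrant]
      uncurry (kernelComp f g) + uncurry (kernelComp f' g) := by
  filter_upwards [(kernelComp_estimate hf hg).1, (kernelComp_estimate hf' hg).1] with p h1 h2
  simp only [uncurry, kernelComp, Pi.add_apply, add_mul]
  exact integral_add h1 h2

theorem kernelComp_add_right_ae {f g g' : ℝ → ℝ → ℂ} (hf : MemLp (uncurry f) 2 quadrant)
    (hg : MemLp (uncurry g) 2 quadrant) (hg' : MemLp (uncurry g') 2 quadrant) :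
    uncurry (kernelComp f (g + g')) =ᵐ[quadrant]
      uncurry (kernelComp f g) + uncurry (kernelComp f g') := by
  filter_upwards [(kernelComp_estimate hf hg).1, (kernelComp_estimate hf hg').1] with p h1 h2
  simp only [uncurry, kernelComp, Pi.add_apply, mul_add]
  exact integral_add h1 h2

/-- Composition of kernels as a bounded bilinear map. -/
def compL : L2Kernel →L[ℂ] L2Kernel →L[ℂ] L2Kernel :=
  LinearMap.mkContinuous₂
    (LinearMap.mk₂ ℂ
      (fun F G => (kernelComp_memLp (memLp_uncurry_curry F) (memLp_uncurry_curry G)).toLp _)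
      (fun F F' G => by
        rw [← MemLp.toLp_add, MemLp.toLp_eq_toLp_iff]
        refine (kernelComp_congr (f' := curry F + curry F') ?_ ae_eq_rfl).trans
          (kernelComp_add_left_ae (memLp_uncurry_curry F) (memLp_uncurry_curry F')
            (memLp_uncurry_curry G))
        exact Lp.coeFn_add F F')
      (fun c F G => by
        rw [← MemLp.toLp_const_smul, MemLp.toLp_eq_toLp_iff]
        refine (kernelComp_congr (f := curry (c • F : L2Kernel)) (f' := c • curry F)
          (Lp.coeFn_smul c F) ae_eq_rfl).trans
          (ae_of_all _ fun p => ?_)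
        simp only [uncurry, kernelComp, Pi.smul_apply, smul_eq_mul, mul_assoc]
        exact integral_const_mul _ _)
      (fun F G G' => by
        rw [← MemLp.toLp_add, MemLp.toLp_eq_toLp_iff]
        refine (kernelComp_congr (g' := curry G + curry G') ae_eq_rfl ?_).trans
          (kernelComp_add_right_ae (memLp_uncurry_curry F) (memLp_uncurry_curry G)
            (memLp_uncurry_curry G'))
        exact Lp.coeFn_add G G')
      (fun c F G => by
        rw [← MemLp.toLp_const_smul, MemLp.toLp_eq_toLp_iff]
        refine (kernelComp_congr (g := curry (c • G : L2Kernel)) (g' := c • curry G)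
          ae_eq_rfl (Lp.coeFn_smul c G)).trans
          (ae_of_all _ fun p => ?_)
        simp only [uncurry, kernelComp, Pi.smul_apply, smul_eq_mul, mul_left_comm _ c]
        exact integral_const_mul _ _))
    1 (fun F G => by
      rw [LinearMap.mk₂_apply, Lp.norm_toLp, one_mul, Lp.norm_def, Lp.norm_def,
        ← ENNReal.toReal_mul]
      exact ENNReal.toReal_mono
        (ENNReal.mul_ne_top (Lp.eLpNorm_ne_top F) (Lp.eLpNorm_ne_top G))
        (kernelComp_estimate (memLp_uncurry_curry F) (memLp_uncurry_curry G)).2.2)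

theorem compL_toLp {f g : ℝ → ℝ → ℂ} (hf : MemLp (uncurry f) 2 quadrant)
    (hg : MemLp (uncurry g) 2 quadrant) :
    compL (hf.toLp _) (hg.toLp _) = (kernelComp_memLp hf hg).toLp _ := by
  change MemLp.toLp _ (kernelComp_memLp (memLp_uncurry_curry _) (memLp_uncurry_curry _)) = _
  rw [MemLp.toLp_eq_toLp_iff]
  exact kernelComp_congr hf.coeFn_toLp hg.coeFn_toLp

theorem norm_compL_le (F G : L2Kernel) : ‖compL F G‖ ≤ ‖F‖ * ‖G‖ := by
  refine (compL.le_opNorm₂ F G).trans ?_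
  have h : ‖compL‖ ≤ 1 := LinearMap.mkContinuous₂_norm_le _ zero_le_one _
  calc ‖compL‖ * ‖F‖ * ‖G‖ ≤ 1 * ‖F‖ * ‖G‖ := by gcongr
    _ = ‖F‖ * ‖G‖ := by rw [one_mul]

/-- Transposition of kernels. -/
def swapL : L2Kernel →ₗᵢ[ℂ] L2Kernel :=
  Lp.compMeasurePreservingₗᵢ ℂ Prod.swap Measure.measurePreserving_swap

theorem coeFn_swapL (F : L2Kernel) : swapL F =ᵐ[quadrant] fun p => F (p.2, p.1) :=
  Lp.coeFn_compMeasurePreserving F Measure.measurePreserving_swap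

/-- The trace of a product of kernels as a bounded bilinear form. -/
def traceL : L2Kernel →L[ℂ] L2Kernel →L[ℂ] ℂ :=
  ((ContinuousLinearMap.mul ℂ ℂ).lpPairing quadrant 2 2).flip.comp
    swapL.toContinuousLinearMap |>.flip

theorem traceL_apply (F G : L2Kernel) : traceL F G = traceProd (curry F) (curry G) := by
  rw [traceL, ContinuousLinearMap.flip_apply, ContinuousLinearMap.comp_apply,
    ContinuousLinearMap.flip_apply, ContinuousLinearMap.lpPairing_eq_integral, traceProd]
  refine integral_congr_ae ?_
  filter_upwards [coeFn_swapL G] with p hp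
  simp only [LinearIsometry.coe_toContinuousLinearMap, ContinuousLinearMap.mul_apply', Function.curry, hp]

theorem traceProd_integrable {f g : ℝ → ℝ → ℂ} (hf : MemLp (uncurry f) 2 quadrant)
    (hg : MemLp (uncurry g) 2 quadrant) :
    Integrable (fun p : ℝ × ℝ => f p.1 p.2 * g p.2 p.1) quadrant :=
  MemLp.integrable_mul hf (hg.comp_measurePreserving Measure.measurePreserving_swap)

theorem traceProd_congr {f f' g g' : ℝ → ℝ → ℂ}
    (hf : uncurry f =ᵐ[quadrant] uncurry f') (hg : uncurry g =ᵐ[quadrant] uncurry g') :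
    traceProd f g = traceProd f' g' := by
  refine integral_congr_ae ?_
  have hg2 := (Measure.measurePreserving_swap (μ := halfLine) (ν := halfLine)).quasiMeasurePreserving
    |>.ae_eq_comp hg
  filter_upwards [hf, hg2] with p h1 h2
  simp only [uncurry, comp, Prod.swap] at h1 h2
  simp only [h1, h2]

theorem traceL_toLp {f g : ℝ → ℝ → ℂ} (hf : MemLp (uncurry f) 2 quadrant)
    (hg : MemLp (uncurry g) 2 quadrant) :
    traceL (hf.toLp _) (hg.toLp _) = traceProd f g := by
  rw [traceL_apply]
  exact traceProd_congr hf.coeFn_toLp hg.coeFn_toLp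

/-- The Hilbert-Schmidt norm is recovered from the trace pairing. -/
theorem exists_traceL_eq_norm_sq (F : L2Kernel) :
    ∃ G : L2Kernel, ‖G‖ = ‖F‖ ∧ traceL F G = (‖F‖ : ℂ) ^ 2 := by
  -- The kernel of the adjoint: conjugate transpose.
  refine ⟨swapL (star F), ?_, ?_⟩
  · rw [LinearIsometry.norm_map, Lp.norm_def, Lp.norm_def]
    congr 1
    refine eLpNorm_congr_norm_ae ?_
    filter_upwards [Lp.coeFn_star F] with p hp
    rw [hp, Pi.star_apply, norm_star]
  · have h := inner_self_eq_norm_sq_to_K (𝕜 := ℂ) F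
    rw [L2.inner_def] at h
    rw [traceL_apply]
    refine Eq.trans ?_ h
    refine integral_congr_ae ?_
    have h1 := (Measure.measurePreserving_swap (μ := halfLine)
      (ν := halfLine)).quasiMeasurePreserving.ae_eq_comp (coeFn_swapL (star F))
    filter_upwards [h1, Lp.coeFn_star F] with p hp hp2
    simp only [comp, Prod.swap] at hp
    simp only [Function.curry, hp, RCLike.inner_apply, hp2, Pi.star_apply, RCLike.star_def]

end Kernels

/-! ### Matrix units in the space of kernels -/

section MatrixUnits

open Function

/-- The space `L²(0,∞)`. -/
abbrev L2Half : Type := Lp ℂ 2 halfLine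

theorem lintegral_enorm_sq_mul_prod (f g : L2Half) :
    ∫⁻ p, ‖f p.1 * g p.2‖ₑ ^ 2 ∂quadrant = (eLpNorm f 2 halfLine * eLpNorm g 2 halfLine) ^ 2 := by
  simp only [enorm_mul, mul_pow]
  rw [lintegral_prod_mul ((Lp.aestronglyMeasurable f).enorm.pow_const 2)
    ((Lp.aestronglyMeasurable g).enorm.pow_const 2), eLpNorm_two_sq, eLpNorm_two_sq]

theorem memLp_mul_prod (f g : L2Half) : MemLp (uncurry fun x y => f x * g y) 2 quadrant := by
  refine (memLp_two_iff_lintegral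
    ((Lp.aestronglyMeasurable f).comp_fst.mul (Lp.aestronglyMeasurable g).comp_snd)).2 ?_
  refine (lintegral_enorm_sq_mul_prod f g).trans_lt ?_
  exact ENNReal.pow_lt_top (ENNReal.mul_lt_top (Lp.eLpNorm_lt_top f) (Lp.eLpNorm_lt_top g))

theorem mul_prod_congr {f f' g g' : ℝ → ℂ} (hf : f =ᵐ[halfLine] f') (hg : g =ᵐ[halfLine] g') :
    (fun p : ℝ × ℝ => f p.1 * g p.2) =ᵐ[quadrant] fun p => f' p.1 * g' p.2 := by
  refine ae_quadrant_of_ae (P := fun x y => f x * g y = f' x * g' y) hf hg ?_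
  intro x y hx hy
  rw [hx, hy]

/-- The kernel `f(R) g(R')`. -/
def tensL : L2Half →L[ℂ] L2Half →L[ℂ] L2Kernel :=
  LinearMap.mkContinuous₂
    (LinearMap.mk₂ ℂ (fun f g => (memLp_mul_prod f g).toLp _)
      (fun f f' g => by
        rw [← MemLp.toLp_add, MemLp.toLp_eq_toLp_iff]
        refine (mul_prod_congr (Lp.coeFn_add f f') ae_eq_rfl).trans (ae_of_all _ fun p => ?_)
        simp only [uncurry, Pi.add_apply, add_mul])
      (fun c f g => by
        rw [← MemLp.toLp_const_smul, MemLp.toLp_eq_toLp_iff]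
        refine (mul_prod_congr (Lp.coeFn_smul c f) ae_eq_rfl).trans (ae_of_all _ fun p => ?_)
        simp only [uncurry, Pi.smul_apply, smul_eq_mul, mul_assoc])
      (fun f g g' => by
        rw [← MemLp.toLp_add, MemLp.toLp_eq_toLp_iff]
        refine (mul_prod_congr ae_eq_rfl (Lp.coeFn_add g g')).trans (ae_of_all _ fun p => ?_)
        simp only [uncurry, Pi.add_apply, mul_add])
      (fun c f g => by
        rw [← MemLp.toLp_const_smul, MemLp.toLp_eq_toLp_iff]
        refine (mul_prod_congr ae_eq_rfl (Lp.coeFn_smul c g)).trans (ae_of_all _ fun p => ?_)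
        simp only [uncurry, Pi.smul_apply, smul_eq_mul, mul_left_comm]))
    1 (fun f g => by
      rw [LinearMap.mk₂_apply, Lp.norm_toLp, one_mul, Lp.norm_def, Lp.norm_def,
        ← ENNReal.toReal_mul]
      refine ENNReal.toReal_mono
        (ENNReal.mul_ne_top (Lp.eLpNorm_ne_top f) (Lp.eLpNorm_ne_top g)) ?_
      rw [← ENNReal.pow_le_pow_left_iff two_ne_zero, eLpNorm_two_sq]
      exact (lintegral_enorm_sq_mul_prod f g).le)

theorem coeFn_tensL (f g : L2Half) : tensL f g =ᵐ[quadrant] fun p => f p.1 * g p.2 :=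
  (memLp_mul_prod f g).coeFn_toLp

theorem tensL_eq_toLp (f g : L2Half) :
    tensL f g = (memLp_mul_prod f g).toLp (uncurry fun x y => f x * g y) := rfl

theorem inner_tensL (f g f' g' : L2Half) :
    inner ℂ (tensL f g) (tensL f' g') = inner ℂ f f' * inner ℂ g g' := by
  rw [L2.inner_def, L2.inner_def, L2.inner_def, ← integral_prod_mul]
  refine integral_congr_ae ?_
  filter_upwards [coeFn_tensL f g, coeFn_tensL f' g'] with p h1 h2
  simp only [h1, h2, RCLike.inner_apply, map_mul]
  ring

theorem inner_star_left (g f : L2Half) : inner ℂ (star g) f = ∫ x, g x * f x ∂halfLine := by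
  rw [L2.inner_def]
  refine integral_congr_ae ?_
  filter_upwards [Lp.coeFn_star g] with x hx
  simp [hx, RCLike.inner_apply, mul_comm]

theorem compL_tensL (f g f' g' : L2Half) :
    compL (tensL f g) (tensL f' g') = inner ℂ (star g) f' • tensL f g' := by
  rw [tensL_eq_toLp f g, tensL_eq_toLp f' g', tensL_eq_toLp f g', compL_toLp,
    ← MemLp.toLp_const_smul, MemLp.toLp_eq_toLp_iff, inner_star_left]
  refine ae_of_all _ fun p => ?_
  simp only [uncurry, kernelComp, Pi.smul_apply, smul_eq_mul]
  rw [← integral_mul_const]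
  exact integral_congr_ae (ae_of_all _ fun y => by ring)

theorem traceL_tensL (f g f' g' : L2Half) :
    traceL (tensL f g) (tensL f' g') = inner ℂ (star g) f' * inner ℂ (star g') f := by
  rw [tensL_eq_toLp f g, tensL_eq_toLp f' g', traceL_toLp, inner_star_left, inner_star_left,
    mul_comm, ← integral_prod_mul, traceProd]
  exact integral_congr_ae (ae_of_all _ fun p => by ring)

theorem inner_star_star (f g : L2Half) : inner ℂ (star f) (star g) = inner ℂ g f := by
  rw [inner_star_left, L2.inner_def]
  refine integral_congr_ae ?_
  filter_upwards [Lp.coeFn_star g] with x hx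
  simp [hx, RCLike.inner_apply]

/-- Rectangles form a π-system that generates the product σ-algebra, and the sets with vanishing
integral are closed under complements and disjoint countable unions. -/
theorem setIntegral_eq_zero_of_prod {m : Measure (ℝ × ℝ)} {F : ℝ × ℝ → ℂ} (hF : Integrable F m)
    (h : ∀ A B : Set ℝ, MeasurableSet A → MeasurableSet B → ∫ p in A ×ˢ B, F p ∂m = 0)
    {s : Set (ℝ × ℝ)} (hs : MeasurableSet s) : ∫ p in s, F p ∂m = 0 := by
  induction s, hs using MeasurableSpace.induction_on_inter generateFrom_prod.symm
    isPiSystem_prod with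
  | empty => simp
  | basic t ht =>
    obtain ⟨A, hA, B, hB, rfl⟩ := ht
    exact h A B hA hB
  | compl t ht ih =>
    rw [setIntegral_compl ht hF, ih, sub_zero, ← setIntegral_univ, ← univ_prod_univ]
    exact h _ _ .univ .univ
  | iUnion f hd hm ih =>
    rw [integral_iUnion hm hd hF.integrableOn]
    simp [ih]

/-- Tensor products of indicators test `F` on rectangles. The argument is localised to squares of
finite measure, where a square integrable function is integrable. -/
theorem eq_zero_of_inner_tensL_eq_zero {F : L2Kernel}
    (h : ∀ f g : L2Half, inner ℂ F (tensL f g) = 0) : F = 0 := by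
  rw [Lp.eq_zero_iff_ae_eq_zero]
  set I : ℕ → Set ℝ := fun n => Iio (n : ℝ)
  have hI : ∀ n, MeasurableSet (I n) := fun n => measurableSet_Iio
  have hIfin : ∀ n, halfLine (I n) < ∞ := by
    intro n
    rw [halfLine, Measure.restrict_apply (hI n)]
    exact (measure_mono (t := Ioo 0 (n : ℝ)) (fun x hx => ⟨hx.2, hx.1⟩)).trans_lt
      measure_Ioo_lt_top
  have key : ∀ n, F =ᵐ[quadrant.restrict (I n ×ˢ I n)] 0 := by
    intro n
    have hfin : quadrant (I n ×ˢ I n) < ∞ := by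
      rw [Measure.prod_prod]; exact ENNReal.mul_lt_top (hIfin n) (hIfin n)
    have : IsFiniteMeasure (quadrant.restrict (I n ×ˢ I n)) := ⟨by simpa using hfin⟩
    have hint : Integrable F (quadrant.restrict (I n ×ˢ I n)) :=
      ((Lp.memLp F).restrict _).integrable (by norm_num)
    refine hint.ae_eq_zero_of_forall_setIntegral_eq_zero fun s hs _ => ?_
    refine setIntegral_eq_zero_of_prod hint (fun A B hA hB => ?_) hs
    rw [Measure.restrict_restrict (hA.prod hB), prod_inter_prod]
    have hA' : MeasurableSet (A ∩ I n) := hA.inter (hI n)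
    have hB' : MeasurableSet (B ∩ I n) := hB.inter (hI n)
    have hAf : halfLine (A ∩ I n) ≠ ∞ :=
      ((measure_mono inter_subset_right).trans_lt (hIfin n)).ne
    have hBf : halfLine (B ∩ I n) ≠ ∞ :=
      ((measure_mono inter_subset_right).trans_lt (hIfin n)).ne
    have h0 := h (indicatorConstLp 2 hA' hAf (1 : ℂ)) (indicatorConstLp 2 hB' hBf (1 : ℂ))
    rw [← inner_conj_symm, map_eq_zero, L2.inner_def] at h0
    rw [← integral_indicator (hA'.prod hB'), ← h0]
    refine integral_congr_ae ?_
    filter_upwards [coeFn_tensL (indicatorConstLp 2 hA' hAf (1 : ℂ))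
      (indicatorConstLp 2 hB' hBf (1 : ℂ)),
      mul_prod_congr (indicatorConstLp_coeFn (p := 2) (hs := hA') (hμs := hAf) (c := (1 : ℂ)))
        (indicatorConstLp_coeFn (p := 2) (hs := hB') (hμs := hBf) (c := (1 : ℂ)))] with p h1 h2
    rw [h1, h2, RCLike.inner_apply]
    by_cases hpA : p.1 ∈ A ∩ I n <;> by_cases hpB : p.2 ∈ B ∩ I n <;>
      simp [indicator, hpA, hpB, mem_prod]
  have hU : (⋃ n, I n ×ˢ I n) = univ := by
    rw [eq_univ_iff_forall]
    rintro ⟨x, y⟩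
    obtain ⟨n, hn⟩ := exists_nat_gt (max x y)
    exact mem_iUnion.2 ⟨n, (le_max_left _ _).trans_lt hn, (le_max_right _ _).trans_lt hn⟩
  have := (ae_restrict_iUnion_iff (fun n => I n ×ˢ I n) _).2 key
  rwa [hU, Measure.restrict_univ] at this

/-- A Hilbert basis of the space of kernels that consists of matrix units. -/
theorem exists_matrixUnits : ∃ (ι : Type) (b : HilbertBasis (ι × ι) ℂ L2Kernel),
    (∀ i j k l, (j = k → compL (b (i, j)) (b (k, l)) = b (i, l)) ∧
      (j ≠ k → compL (b (i, j)) (b (k, l)) = 0)) ∧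
    (∀ i j k l, (j = k ∧ i = l → traceL (b (i, j)) (b (k, l)) = 1) ∧
      (¬ (j = k ∧ i = l) → traceL (b (i, j)) (b (k, l)) = 0)) := by
  classical
  obtain ⟨w, e, -⟩ := exists_hilbertBasis ℂ L2Half
  have he := e.orthonormal
  have hortho := orthonormal_iff_ite.1 he
  -- Kernels compose and are traced without conjugation, so the conjugate in the second factor is
  -- what turns orthonormality of `e` into the multiplication table of matrix units.
  have hE : Orthonormal ℂ (fun p : w × w => tensL (e p.1) (star (e p.2))) := by
    rw [orthonormal_iff_ite]
    rintro ⟨i, j⟩ ⟨k, l⟩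
    rw [inner_tensL, inner_star_star, hortho, hortho]
    by_cases h1 : i = k <;> by_cases h2 : j = l <;> simp [h1, h2, eq_comm]
  have hspan : (Submodule.span ℂ (range fun p : w × w => tensL (e p.1) (star (e p.2))))ᗮ = ⊥ := by
    rw [eq_bot_iff]
    intro F hF
    have hF0 : ∀ i j, inner ℂ F (tensL (e i) (star (e j))) = 0 := fun i j =>
      (Submodule.mem_orthogonal' _ _).1 hF _ (Submodule.subset_span ⟨(i, j), rfl⟩)
    -- Density is used one variable at a time: first `e i` is replaced by an arbitrary `f`, then
    -- `star (e j)` by an arbitrary `g`.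
    have h1 : ∀ f j, inner ℂ F (tensL f (star (e j))) = 0 := by
      intro f j
      have hd : Dense (Submodule.span ℂ (range e) : Set L2Half) :=
        Submodule.dense_iff_topologicalClosure_eq_top.2 e.dense_span
      have : (innerSL ℂ F).comp (tensL.flip (star (e j))) = 0 := by
        refine ContinuousLinearMap.ext_on hd ?_
        rintro _ ⟨i, rfl⟩
        simpa using hF0 i j
      simpa using DFunLike.congr_fun this f
    refine eq_zero_of_inner_tensL_eq_zero fun f g => ?_
    have hd : Dense (Submodule.span ℂ (range fun j => star (e j)) : Set L2Half) := by
      rw [Submodule.dense_iff_topologicalClosure_eq_top, Submodule.topologicalClosure_eq_top_iff,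
        eq_bot_iff]
      intro u hu
      have hu0 : ∀ j, inner ℂ (e j) (star u) = 0 := by
        intro j
        have := (Submodule.mem_orthogonal' _ _).1 hu _ (Submodule.subset_span ⟨j, rfl⟩)
        rwa [← inner_star_star, star_star]
      have : star u = 0 := by
        have hs := e.hasSum_repr (star u)
        simp only [HilbertBasis.repr_apply_apply, hu0, zero_smul] at hs
        exact hs.unique hasSum_zero
      have h0 : ‖u‖ ^ 2 = 0 := by
        have h2 := inner_star_star u u
        rw [this, inner_zero_left] at h2
        simpa using h2.symm
      simpa using h0
    have : (innerSL ℂ F).comp (tensL f) = 0 := by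
      refine ContinuousLinearMap.ext_on hd ?_
      rintro _ ⟨j, rfl⟩
      simpa using h1 f j
    simpa using DFunLike.congr_fun this g
  refine ⟨w, HilbertBasis.mkOfOrthogonalEqBot hE hspan, ?_, ?_⟩
  · intro i j k l
    simp only [HilbertBasis.coe_mkOfOrthogonalEqBot, compL_tensL, star_star, hortho]
    constructor
    · rintro rfl; simp
    · intro h; simp [h]
  · intro i j k l
    simp only [HilbertBasis.coe_mkOfOrthogonalEqBot, traceL_tensL, star_star, hortho]
    constructor
    · rintro ⟨rfl, rfl⟩; simp
    · intro h
      by_cases h1 : j = k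
      · have h2 : l ≠ i := fun h2 => h ⟨h1, h2.symm⟩
        simp [h2]
      · simp [h1]

end MatrixUnits

/-! ### Bounds for Smithies' coefficients of square integrable kernels -/

section HilbertSchmidtBounds

open Function
open scoped Matrix.Norms.Frobenius

/-- `hsPow K n` is the power `K^(n+1)`. -/
def hsPow (K : L2Kernel) : ℕ → L2Kernel
  | 0 => K
  | n + 1 => compL K (hsPow K n)

/-- The traces of the powers of a square integrable kernel. -/
def hsRho (K : L2Kernel) : ℕ → ℂ
  | 0 => 0
  | 1 => 0
  | n + 2 => traceL (hsPow K n) K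

/-- The coefficient `N_n` as a square integrable kernel. -/
def hsCoeff (K : L2Kernel) (n : ℕ) : L2Kernel :=
  ∑ j ∈ Finset.range (n + 1), sigmaCoeff (hsRho K) (n - j) • hsPow K j

theorem kernelPow_memLp {f : ℝ → ℝ → ℂ} (hf : MemLp (uncurry f) 2 quadrant) (n : ℕ) :
    MemLp (uncurry (kernelPow f n)) 2 quadrant := by
  induction n with
  | zero => exact hf
  | succ n ih => exact kernelComp_memLp hf ih

theorem hsPow_toLp {f : ℝ → ℝ → ℂ} (hf : MemLp (uncurry f) 2 quadrant) (n : ℕ) :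
    hsPow (hf.toLp _) n = (kernelPow_memLp hf n).toLp _ := by
  induction n with
  | zero => rfl
  | succ n ih => rw [hsPow, ih, compL_toLp]; rfl

theorem hsRho_toLp {f : ℝ → ℝ → ℂ} (hf : MemLp (uncurry f) 2 quadrant) :
    hsRho (hf.toLp _) = rho f := by
  ext n
  rcases n with _ | _ | n
  · rfl
  · rfl
  · rw [hsRho, hsPow_toLp, traceL_toLp]; rfl

theorem nCoeff_memLp {f : ℝ → ℝ → ℂ} (hf : MemLp (uncurry f) 2 quadrant) (n : ℕ) :
    MemLp (uncurry (nCoeff f n)) 2 quadrant := by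
  have : uncurry (nCoeff f n) = fun p => ∑ j ∈ Finset.range (n + 1),
      sigmaCoeff (rho f) (n - j) • uncurry (kernelPow f j) p := by
    ext p; exact nCoeff_eq f n p.1 p.2
  rw [this]
  exact memLp_finsetSum _ fun j _ => (kernelPow_memLp hf j).const_smul (sigmaCoeff (rho f) (n - j))

theorem hsCoeff_toLp {f : ℝ → ℝ → ℂ} (hf : MemLp (uncurry f) 2 quadrant) (n : ℕ) :
    hsCoeff (hf.toLp _) n = (nCoeff_memLp hf n).toLp _ := by
  rw [Lp.ext_iff]
  refine EventuallyEq.trans ?_ (nCoeff_memLp hf n).coeFn_toLp.symm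
  rw [hsCoeff, hsRho_toLp]
  refine (Lp.coeFn_finsetSum _ _).trans ?_
  have h : ∀ j ∈ Finset.range (n + 1), ∀ᵐ p ∂quadrant,
      (sigmaCoeff (rho f) (n - j) • hsPow (hf.toLp _) j : L2Kernel) p =
        sigmaCoeff (rho f) (n - j) * kernelPow f j p.1 p.2 := by
    intro j _
    rw [hsPow_toLp]
    filter_upwards [Lp.coeFn_smul (sigmaCoeff (rho f) (n - j))
      ((kernelPow_memLp hf j).toLp (uncurry (kernelPow f j))),
      (kernelPow_memLp hf j).coeFn_toLp] with p h1 h2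
    rw [h1, Pi.smul_apply, h2]; rfl
  filter_upwards [(Finset.eventually_all _).2 h] with p hp
  rw [Finset.sum_apply, Finset.sum_congr rfl hp]
  exact (nCoeff_eq f n p.1 p.2).symm

theorem continuous_hsPow (n : ℕ) : Continuous fun K => hsPow K n := by
  induction n with
  | zero => exact continuous_id
  | succ n ih => exact compL.continuous.clm_apply ih

theorem continuous_hsRho (n : ℕ) : Continuous fun K => hsRho K n := by
  rcases n with _ | _ | n
  · exact continuous_const
  · exact continuous_const
  · exact (traceL.continuous.comp (continuous_hsPow n)).clm_apply continuous_id

theorem continuous_sigmaCoeff_hsRho (n : ℕ) : Continuous fun K => sigmaCoeff (hsRho K) n := by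
  induction n using Nat.strong_induction_on with
  | _ n ih =>
    rcases n with _ | n
    · simp only [sigmaCoeff_zero]; exact continuous_const
    have hn : (n : ℂ) + 1 ≠ 0 := by exact_mod_cast n.succ_ne_zero
    have h : (fun K => sigmaCoeff (hsRho K) (n + 1)) = fun K => ((n : ℂ) + 1)⁻¹ *
        -∑ j ∈ Finset.range n, hsRho K (j + 2) * sigmaCoeff (hsRho K) (n - (j + 1)) := by
      ext K; rw [← sigmaCoeff_succ, inv_mul_cancel_left₀ hn]
    rw [h]
    exact continuous_const.mul (continuous_finsetSum _ fun j _ =>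
      (continuous_hsRho _).mul (ih _ (by omega))).neg

theorem continuous_hsCoeff (n : ℕ) : Continuous fun K => hsCoeff K n :=
  continuous_finsetSum _ fun j _ => (continuous_sigmaCoeff_hsRho _).smul (continuous_hsPow j)

variable {ι : Type} (b : HilbertBasis (ι × ι) ℂ L2Kernel)

/-- The kernel with a given matrix with respect to a family of matrix units. -/
def embed (s : Finset ι) (A : Matrix s s ℂ) : L2Kernel := ∑ i : s, ∑ j : s, A i j • b (i, j)

/-- The kernels of finite rank that approximate a given kernel. -/
def truncMatrix (K : L2Kernel) (s : Finset ι) : Matrix s s ℂ :=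
  Matrix.of fun i j => b.repr K (i, j)

theorem tendsto_embed_truncMatrix (K : L2Kernel) :
    Tendsto (fun s : Finset ι => embed b s (truncMatrix b K s)) atTop (𝓝 K) := by
  -- The squares `s × s` are cofinal among the finite sets of index pairs, so the unconditionally
  -- convergent expansion may be summed along them.
  have h : Tendsto (fun s : Finset ι => s ×ˢ s) atTop atTop :=
    tendsto_finsetProd_atTop.comp tendsto_atTop_diagonal
  refine ((b.hasSum_repr K).comp h).congr fun s => ?_
  simp only [comp, Finset.sum_product, embed, truncMatrix, Matrix.of_apply]
  rw [← Finset.sum_coe_sort s]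
  refine Finset.sum_congr rfl fun i _ => ?_
  rw [← Finset.sum_coe_sort s]

/-- The matrix units are orthonormal, so Parseval identifies the Frobenius norm with the
Hilbert–Schmidt norm. -/
theorem norm_embed [DecidableEq ι] (s : Finset ι) (A : Matrix s s ℂ) : ‖embed b s A‖ = ‖A‖ := by
  have h1 : embed b s A = ∑ p : s × s, A p.1 p.2 • b (p.1, p.2) := by
    rw [Fintype.sum_prod_type]; rfl
  have hv : Orthonormal ℂ fun p : s × s => b ((p.1 : ι), (p.2 : ι)) :=
    b.orthonormal.comp (fun p : s × s => ((p.1 : ι), (p.2 : ι))) (by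
      rintro ⟨i, j⟩ ⟨k, l⟩ h
      simp only [Prod.mk.injEq, Subtype.coe_inj] at h
      exact Prod.ext h.1 h.2)
  have h2 : ‖embed b s A‖ ^ 2 = ‖A‖ ^ 2 := by
    have := inner_self_eq_norm_sq_to_K (𝕜 := ℂ) (embed b s A)
    rw [h1, hv.inner_sum, ← h1, Fintype.sum_prod_type] at this
    have h3 : (((‖embed b s A‖ ^ 2 : ℝ)) : ℂ) = ((‖A‖ ^ 2 : ℝ) : ℂ) := by
      rw [frobenius_norm_sq]
      push_cast
      refine Eq.trans this.symm ?_
      refine Finset.sum_congr rfl fun i _ => Finset.sum_congr rfl fun j _ => ?_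
      rw [mul_comm, Complex.mul_conj, Complex.normSq_eq_norm_sq]
      push_cast; rfl
    exact_mod_cast h3
  exact (sq_eq_sq₀ (norm_nonneg _) (norm_nonneg _)).1 h2

variable {b}

theorem bilinear_embed {G : Type*} [NormedAddCommGroup G] [NormedSpace ℂ G]
    (T : L2Kernel →L[ℂ] L2Kernel →L[ℂ] G) (s : Finset ι) (A B : Matrix s s ℂ) :
    T (embed b s A) (embed b s B) = ∑ i : s, ∑ j : s, A i j •
      ∑ k : s, ∑ l : s, B k l • T (b ((i : ι), (j : ι))) (b ((k : ι), (l : ι))) := by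
  have h1 : ∀ y, T (embed b s A) y = ∑ i : s, ∑ j : s, A i j • T (b ((i : ι), (j : ι))) y := by
    intro y
    simp only [embed, map_sum, map_smul, _root_.sum_apply, _root_.smul_apply]
  have h2 : ∀ x, T x (embed b s B) = ∑ k : s, ∑ l : s, B k l • T x (b ((k : ι), (l : ι))) := by
    intro x
    simp only [embed, map_sum, map_smul]
  rw [h1]
  simp only [h2]

theorem compL_embed (hcomp : ∀ i j k l, (j = k → compL (b (i, j)) (b (k, l)) = b (i, l)) ∧
      (j ≠ k → compL (b (i, j)) (b (k, l)) = 0)) (s : Finset ι) (A B : Matrix s s ℂ) :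
    compL (embed b s A) (embed b s B) = embed b s (A * B) := by
  have h : ∀ i j : s, ∑ k : s, ∑ l : s, B k l • compL (b ((i : ι), (j : ι))) (b ((k : ι), (l : ι))) =
      ∑ l : s, B j l • b ((i : ι), (l : ι)) := by
    intro i j
    rw [Finset.sum_eq_single j]
    · exact Finset.sum_congr rfl fun l _ => by rw [(hcomp _ _ _ _).1 rfl]
    · intro k _ hk
      refine Finset.sum_eq_zero fun l _ => ?_
      rw [(hcomp _ _ _ _).2 (fun h => hk (Subtype.ext h.symm)), smul_zero]
    · simp
  rw [bilinear_embed]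
  simp only [h, embed, Matrix.mul_apply, Finset.sum_smul, Finset.smul_sum, smul_smul]
  exact Finset.sum_congr rfl fun i _ => Finset.sum_comm

theorem traceL_embed (htr : ∀ i j k l, (j = k ∧ i = l → traceL (b (i, j)) (b (k, l)) = 1) ∧
      (¬ (j = k ∧ i = l) → traceL (b (i, j)) (b (k, l)) = 0)) (s : Finset ι)
    (A B : Matrix s s ℂ) : traceL (embed b s A) (embed b s B) = (A * B).trace := by
  have h : ∀ i j : s, ∑ k : s, ∑ l : s,
      B k l • traceL (b ((i : ι), (j : ι))) (b ((k : ι), (l : ι))) = B j i := by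
    intro i j
    rw [Finset.sum_eq_single j, Finset.sum_eq_single i]
    · rw [(htr _ _ _ _).1 ⟨rfl, rfl⟩, smul_eq_mul, mul_one]
    · intro l _ hl
      rw [(htr _ _ _ _).2 (fun h => hl (Subtype.ext h.2.symm)), smul_zero]
    · simp
    · intro k _ hk
      refine Finset.sum_eq_zero fun l _ => ?_
      rw [(htr _ _ _ _).2 (fun h => hk (Subtype.ext h.1.symm)), smul_zero]
    · simp
  rw [bilinear_embed]
  simp only [h]
  simp only [Matrix.trace, Matrix.diag_apply, Matrix.mul_apply, smul_eq_mul]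

theorem hsPow_embed [DecidableEq ι]
    (hcomp : ∀ i j k l, (j = k → compL (b (i, j)) (b (k, l)) = b (i, l)) ∧
      (j ≠ k → compL (b (i, j)) (b (k, l)) = 0)) (s : Finset ι) (A : Matrix s s ℂ) (n : ℕ) :
    hsPow (embed b s A) n = embed b s (A ^ (n + 1)) := by
  induction n with
  | zero => simp [hsPow]
  | succ n ih => rw [hsPow, ih, compL_embed hcomp, pow_succ' _ (n + 1)]

theorem sigmaCoeff_hsRho_embed [DecidableEq ι]
    (hcomp : ∀ i j k l, (j = k → compL (b (i, j)) (b (k, l)) = b (i, l)) ∧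
      (j ≠ k → compL (b (i, j)) (b (k, l)) = 0))
    (htr : ∀ i j k l, (j = k ∧ i = l → traceL (b (i, j)) (b (k, l)) = 1) ∧
      (¬ (j = k ∧ i = l) → traceL (b (i, j)) (b (k, l)) = 0))
    (s : Finset ι) (A : Matrix s s ℂ) (n : ℕ) :
    sigmaCoeff (hsRho (embed b s A)) n = sigmaCoeff (fun j => (A ^ j).trace) n :=
  sigmaCoeff_congr (fun n => by
    rw [hsRho, hsPow_embed hcomp, traceL_embed htr, ← pow_succ]) n

theorem traceL_hsCoeff_embed [DecidableEq ι]
    (hcomp : ∀ i j k l, (j = k → compL (b (i, j)) (b (k, l)) = b (i, l)) ∧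
      (j ≠ k → compL (b (i, j)) (b (k, l)) = 0))
    (htr : ∀ i j k l, (j = k ∧ i = l → traceL (b (i, j)) (b (k, l)) = 1) ∧
      (¬ (j = k ∧ i = l) → traceL (b (i, j)) (b (k, l)) = 0))
    (s : Finset ι) (A B : Matrix s s ℂ) (n : ℕ) :
    traceL (hsCoeff (embed b s A) n) (embed b s B) = ∑ j ∈ Finset.range (n + 1),
      sigmaCoeff (fun j => (A ^ j).trace) (n - j) * (A ^ (j + 1) * B).trace := by
  rw [hsCoeff, map_sum, _root_.sum_apply]
  refine Finset.sum_congr rfl fun j _ => ?_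
  rw [map_smul, _root_.smul_apply, sigmaCoeff_hsRho_embed hcomp htr, hsPow_embed hcomp,
    traceL_embed htr, smul_eq_mul]

/-- The matrix estimate does not see the dimension, and both sides are continuous in the kernel;
pass to the limit along the truncations of `K`. -/
theorem norm_sigmaCoeff_hsRho_le (K : L2Kernel) {r : ℝ} (hr : 0 < r) (n : ℕ) :
    ‖sigmaCoeff (hsRho K) n‖ * r ^ n ≤ Real.exp ((r * ‖K‖) ^ 2 / 2) := by
  classical
  obtain ⟨ι, b, hcomp, htr⟩ := exists_matrixUnits
  have ht := tendsto_embed_truncMatrix b K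
  have h1 : Tendsto (fun s => ‖sigmaCoeff (hsRho (embed b s (truncMatrix b K s))) n‖ * r ^ n) atTop
      (𝓝 (‖sigmaCoeff (hsRho K) n‖ * r ^ n)) :=
    (((continuous_sigmaCoeff_hsRho n).tendsto K).comp ht).norm.mul_const _
  have h2 : Tendsto (fun s => Real.exp ((r * ‖embed b s (truncMatrix b K s)‖) ^ 2 / 2)) atTop
      (𝓝 (Real.exp ((r * ‖K‖) ^ 2 / 2))) :=
    (Real.continuous_exp.tendsto _).comp ((((ht.norm).const_mul r).pow 2).div_const 2)
  refine le_of_tendsto_of_tendsto' h1 h2 fun s => ?_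
  rw [sigmaCoeff_hsRho_embed hcomp htr, norm_embed]
  exact norm_sigmaCoeff_trace_le _ hr n

theorem continuous_traceL_hsCoeff (n : ℕ) :
    Continuous fun q : L2Kernel × L2Kernel => traceL (hsCoeff q.1 n) q.2 :=
  (traceL.continuous.comp ((continuous_hsCoeff n).comp continuous_fst)).clm_apply continuous_snd

theorem norm_traceL_hsCoeff_embed_le [DecidableEq ι]
    (hcomp : ∀ i j k l, (j = k → compL (b (i, j)) (b (k, l)) = b (i, l)) ∧
      (j ≠ k → compL (b (i, j)) (b (k, l)) = 0))
    (htr : ∀ i j k l, (j = k ∧ i = l → traceL (b (i, j)) (b (k, l)) = 1) ∧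
      (¬ (j = k ∧ i = l) → traceL (b (i, j)) (b (k, l)) = 0))
    (s : Finset ι) (A B : Matrix s s ℂ) {r : ℝ} (hr : 0 < r) (n : ℕ) :
    ‖traceL (hsCoeff (embed b s A) n) (embed b s B)‖ * r ^ (n + 1) ≤
      Real.exp ((r * ‖embed b s A‖ + ‖embed b s B‖) ^ 2 / 2) := by
  rw [traceL_hsCoeff_embed hcomp htr, norm_embed, norm_embed]
  exact norm_sum_sigmaCoeff_trace_le _ _ hr n

theorem isClosed_norm_traceL_hsCoeff_le (r : ℝ) (n : ℕ) :
    IsClosed {q : L2Kernel × L2Kernel | ‖traceL (hsCoeff q.1 n) q.2‖ * r ^ (n + 1) ≤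
      Real.exp ((r * ‖q.1‖ + ‖q.2‖) ^ 2 / 2)} := by
  refine isClosed_le ((continuous_traceL_hsCoeff n).norm.mul continuous_const) ?_
  fun_prop

theorem mem_norm_traceL_hsCoeff_le (K B : L2Kernel) {r : ℝ} (hr : 0 < r) (n : ℕ) :
    (K, B) ∈ {q : L2Kernel × L2Kernel | ‖traceL (hsCoeff q.1 n) q.2‖ * r ^ (n + 1) ≤
      Real.exp ((r * ‖q.1‖ + ‖q.2‖) ^ 2 / 2)} := by
  classical
  obtain ⟨ι, b, hcomp, htr⟩ := exists_matrixUnits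
  have ht := (tendsto_embed_truncMatrix b K).prodMk_nhds (tendsto_embed_truncMatrix b B)
  exact (isClosed_norm_traceL_hsCoeff_le r n).mem_of_tendsto ht (Eventually.of_forall fun s =>
    norm_traceL_hsCoeff_embed_le hcomp htr s _ _ hr n)

theorem norm_traceL_hsCoeff_le (K B : L2Kernel) {r : ℝ} (hr : 0 < r) (n : ℕ) :
    ‖traceL (hsCoeff K n) B‖ * r ^ (n + 1) ≤ Real.exp ((r * ‖K‖ + ‖B‖) ^ 2 / 2) :=
  mem_norm_traceL_hsCoeff_le K B hr n

/-- Duality: pair with the normalised kernel `G` that recovers the norm of `hsCoeff K n`. Its norm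
is `1`, which is the `1` in the exponent. -/
theorem norm_hsCoeff_le (K : L2Kernel) {r : ℝ} (hr : 0 < r) (n : ℕ) :
    ‖hsCoeff K n‖ * r ^ (n + 1) ≤ Real.exp ((r * ‖K‖ + 1) ^ 2 / 2) := by
  obtain ⟨G, hG, hG'⟩ := exists_traceL_eq_norm_sq (hsCoeff K n)
  rcases eq_or_ne (hsCoeff K n) 0 with h0 | h0
  · rw [h0, norm_zero, zero_mul]; exact (Real.exp_pos _).le
  have hn : ‖hsCoeff K n‖ ≠ 0 := norm_ne_zero_iff.2 h0
  have h := norm_traceL_hsCoeff_le K (((‖hsCoeff K n‖⁻¹ : ℝ) : ℂ) • G) hr n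
  have h1 : ‖((‖hsCoeff K n‖⁻¹ : ℝ) : ℂ) • G‖ = 1 := by
    rw [norm_smul, hG, Complex.norm_real, norm_inv, norm_norm, inv_mul_cancel₀ hn]
  have h2 : ‖traceL (hsCoeff K n) (((‖hsCoeff K n‖⁻¹ : ℝ) : ℂ) • G)‖ = ‖hsCoeff K n‖ := by
    rw [map_smul, hG', norm_smul, Complex.norm_real, norm_inv, norm_norm, norm_pow,
      Complex.norm_real, norm_norm]
    field_simp
  rwa [h1, h2] at h

end HilbertSchmidtBounds

/-! ### The angular-momentum Green function -/

section Green

open Function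

/-- The distance between points of norms `R`, `R'` and angle `arccos t`. -/
def chord (R R' t : ℝ) : ℝ := √(R ^ 2 + R' ^ 2 - 2 * R * R' * t)

theorem chord_nonneg (R R' t : ℝ) : 0 ≤ chord R R' t := Real.sqrt_nonneg _

theorem continuous_chord (R R' : ℝ) : Continuous (chord R R') := by
  unfold chord; fun_prop

theorem chord_le {R R' t : ℝ} (hR : 0 < R) (hR' : 0 < R') (ht : t ∈ Icc (-1 : ℝ) 1) :
    chord R R' t ≤ R + R' := by
  refine Real.sqrt_le_iff.2 ⟨by positivity, ?_⟩
  nlinarith [mul_pos hR hR', ht.1, mul_nonneg (mul_pos hR hR').le (by linarith [ht.1] : 0 ≤ 1 + t)]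

theorem sq_sub_sq_le {R R' t : ℝ} (hR : 0 < R) (hR' : 0 < R') (ht : t ∈ Icc (-1 : ℝ) 1) :
    (R - R') ^ 2 ≤ R ^ 2 + R' ^ 2 - 2 * R * R' * t := by
  nlinarith [mul_nonneg (mul_pos hR hR').le (by linarith [ht.2] : 0 ≤ 1 - t)]

theorem abs_sub_le_chord {R R' t : ℝ} (hR : 0 < R) (hR' : 0 < R') (ht : t ∈ Icc (-1 : ℝ) 1) :
    |R - R'| ≤ chord R R' t :=
  Real.abs_le_sqrt (sq_sub_sq_le hR hR' ht)

theorem hasDerivAt_chord {R R' t : ℝ} (h : 0 < R ^ 2 + R' ^ 2 - 2 * R * R' * t) :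
    HasDerivAt (chord R R') (-(R * R') / chord R R' t) t := by
  have h1 : HasDerivAt (fun t => R ^ 2 + R' ^ 2 - 2 * R * R' * t) (-(2 * R * R')) t := by
    simpa using ((hasDerivAt_id t).const_mul (2 * R * R')).const_sub (R ^ 2 + R' ^ 2)
  refine (h1.sqrt h.ne').congr_deriv ?_
  have : chord R R' t ≠ 0 := (Real.sqrt_pos.2 h).ne'
  rw [chord] at this ⊢
  field_simp

/-- `-u / (RR')` is a primitive of `1/u`, with endpoint values given by `u = |R - R'|` and `u = R +
R'`. For `R = R'` the integrand is singular at `t = 1`; integrability comes from its being the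
nonnegative derivative of a continuous function. -/
theorem inv_chord_integral {R R' : ℝ} (hR : 0 < R) (hR' : 0 < R') :
    IntervalIntegrable (fun t => (chord R R' t)⁻¹) volume (-1) 1 ∧
      ∫ t in (-1 : ℝ)..1, (chord R R' t)⁻¹ = 2 * min R R' / (R * R') := by
  have hRR : R * R' ≠ 0 := (mul_pos hR hR').ne'
  have hc : ContinuousOn (fun t => -(chord R R' t) / (R * R')) (Icc (-1) 1) :=
    ((continuous_chord R R').neg.div_const _).continuousOn
  have hd : ∀ t ∈ Ioo (-1 : ℝ) 1,
      HasDerivAt (fun t => -(chord R R' t) / (R * R')) ((chord R R' t)⁻¹) t := by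
    intro t ht
    have hpos : 0 < R ^ 2 + R' ^ 2 - 2 * R * R' * t := by
      nlinarith [mul_pos (mul_pos hR hR') (by linarith [ht.2] : 0 < 1 - t), sq_nonneg (R - R')]
    refine ((hasDerivAt_chord hpos).neg.div_const _).congr_deriv ?_
    field_simp
  have hi : IntervalIntegrable (fun t => (chord R R' t)⁻¹) volume (-1) 1 := by
    rw [intervalIntegrable_iff_integrableOn_Ioc_of_le (by norm_num)]
    exact intervalIntegral.integrableOn_deriv_of_nonneg hc hd
      fun t _ => inv_nonneg.2 (chord_nonneg _ _ _)
  refine ⟨hi, ?_⟩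
  rw [intervalIntegral.integral_eq_sub_of_hasDerivAt_of_le (by norm_num) hc hd hi]
  have h1 : chord R R' 1 = |R - R'| := by
    rw [chord, ← Real.sqrt_sq_eq_abs]; congr 1; ring
  have h2 : chord R R' (-1) = R + R' := by
    rw [chord, show R ^ 2 + R' ^ 2 - 2 * R * R' * -1 = (R + R') ^ 2 by ring,
      Real.sqrt_sq (by positivity)]
  rw [h1, h2]
  rcases le_total R R' with h | h
  · rw [min_eq_left h, abs_of_nonpos (by linarith)]; ring
  · rw [min_eq_right h, abs_of_nonneg (by linarith)]; ring

/-- The Legendre coefficient of `φ(u) / (4πu)`, normalised as the Green function. -/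
def greenOf (ℓ : ℕ) (φ : ℝ → ℂ) (R R' : ℝ) : ℂ :=
  -(2 * Real.pi * R * R') * ∫ t in (-1 : ℝ)..1,
    φ (chord R R' t) / (4 * Real.pi * chord R R' t) * (((legendre ℓ).eval t : ℝ) : ℂ)

theorem green_eq_greenOf (ℓ : ℕ) (k : ℂ) :
    green ℓ k = greenOf ℓ (fun u => Complex.exp (Complex.I * k * u)) := rfl

theorem continuous_legendre_ofReal (ℓ : ℕ) :
    Continuous fun t : ℝ => (((legendre ℓ).eval t : ℝ) : ℂ) :=
  Complex.continuous_ofReal.comp (legendre ℓ).continuous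

theorem greenOf_integrand_norm_le {ℓ : ℕ} {φ : ℝ → ℂ} {R R' C t : ℝ} (hR : 0 < R) (hR' : 0 < R')
    (hC : ∀ u ∈ Icc 0 (R + R'), ‖φ u‖ ≤ C) (ht : t ∈ Icc (-1 : ℝ) 1) :
    ‖φ (chord R R' t) / (4 * Real.pi * chord R R' t) * (((legendre ℓ).eval t : ℝ) : ℂ)‖ ≤
      C / (4 * Real.pi) * (|(legendre ℓ).eval t| * (chord R R' t)⁻¹) := by
  have h1 := hC _ ⟨chord_nonneg R R' t, chord_le hR hR' ht⟩
  have h0 := chord_nonneg R R' t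
  have hpi := Real.pi_pos
  rw [norm_mul, norm_div, norm_mul, norm_mul, Complex.norm_real, Complex.norm_real,
    Complex.norm_real, Real.norm_eq_abs, Real.norm_eq_abs, Real.norm_eq_abs, abs_of_nonneg h0,
    abs_of_pos hpi]
  norm_num
  rw [div_eq_mul_inv, mul_inv, div_eq_mul_inv]
  calc ‖φ (chord R R' t)‖ * ((4 * Real.pi)⁻¹ * (chord R R' t)⁻¹) * |(legendre ℓ).eval t|
      ≤ C * ((4 * Real.pi)⁻¹ * (chord R R' t)⁻¹) * |(legendre ℓ).eval t| := by gcongr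
    _ = _ := by ring

theorem greenOf_intervalIntegrable (ℓ : ℕ) {φ : ℝ → ℂ} (hφ : Continuous φ) {R R' : ℝ} (hR : 0 < R)
    (hR' : 0 < R') : IntervalIntegrable (fun t => φ (chord R R' t) / (4 * Real.pi * chord R R' t) *
      (((legendre ℓ).eval t : ℝ) : ℂ)) volume (-1) 1 := by
  obtain ⟨C, hC⟩ := (isCompact_Icc (a := 0) (b := R + R')).exists_bound_of_continuousOn
    hφ.continuousOn
  have hC0 : 0 ≤ C := (norm_nonneg _).trans (hC 0 ⟨le_rfl, by positivity⟩)
  refine ((inv_chord_integral hR hR').1.const_mul (C / (4 * Real.pi))).mono_fun ?_ ?_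
  · have h1 := continuous_chord R R'
    refine (Measurable.mul ?_ (continuous_legendre_ofReal ℓ).measurable).aestronglyMeasurable
    exact ((hφ.comp h1).measurable).div
      ((Complex.measurable_ofReal.comp h1.measurable).const_mul _)
  · refine (ae_restrict_iff' measurableSet_uIoc).2 (ae_of_all _ fun t ht => ?_)
    rw [uIoc_of_le (by norm_num)] at ht
    have ht' : t ∈ Icc (-1 : ℝ) 1 := Ioc_subset_Icc_self ht
    refine (greenOf_integrand_norm_le hR hR' hC ht').trans ?_
    have h0 := chord_nonneg R R' t
    have := Real.pi_pos
    beta_reduce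
    rw [Real.norm_of_nonneg (by positivity)]
    gcongr
    calc |(legendre ℓ).eval t| * (chord R R' t)⁻¹ ≤ 1 * (chord R R' t)⁻¹ := by
          gcongr; exact abs_legendre_le_one ℓ ht'
      _ = _ := one_mul _

/-- The majorant `f` is left free: `1/u` yields the bound uniform in `ℓ`, while `|P_ℓ| / |R - R'|`
yields decay in `ℓ`. -/
theorem norm_greenOf_le_integral (ℓ : ℕ) {φ : ℝ → ℂ} {R R' C : ℝ} (hR : 0 < R)
    (hR' : 0 < R') (hC : ∀ u ∈ Icc 0 (R + R'), ‖φ u‖ ≤ C) {f : ℝ → ℝ}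
    (hf : IntervalIntegrable f volume (-1) 1)
    (hle : ∀ t ∈ Icc (-1 : ℝ) 1, |(legendre ℓ).eval t| * (chord R R' t)⁻¹ ≤ f t) :
    ‖greenOf ℓ φ R R'‖ ≤ C * (R * R' / 2) * ∫ t in (-1 : ℝ)..1, f t := by
  have hC0 : 0 ≤ C := (norm_nonneg _).trans (hC 0 ⟨le_rfl, by positivity⟩)
  have hpi := Real.pi_pos
  have h1 : ‖∫ t in (-1 : ℝ)..1, φ (chord R R' t) / (4 * Real.pi * chord R R' t) *
      (((legendre ℓ).eval t : ℝ) : ℂ)‖ ≤ ∫ t in (-1 : ℝ)..1, C / (4 * Real.pi) * f t := by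
    refine intervalIntegral.norm_integral_le_of_norm_le (by norm_num)
      (ae_of_all _ fun t ht => ?_) (hf.const_mul _)
    have ht' : t ∈ Icc (-1 : ℝ) 1 := Ioc_subset_Icc_self ht
    refine (greenOf_integrand_norm_le hR hR' hC ht').trans ?_
    gcongr
    exact hle t ht'
  rw [greenOf, norm_mul, norm_neg, norm_mul, norm_mul, norm_mul, Complex.norm_real,
    Complex.norm_real, Complex.norm_real, Real.norm_of_nonneg hpi.le, Real.norm_of_nonneg hR.le,
    Real.norm_of_nonneg hR'.le, Complex.norm_ofNat]
  refine (mul_le_mul_of_nonneg_left h1 (by positivity)).trans (le_of_eq ?_)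
  rw [intervalIntegral.integral_const_mul]
  field_simp
  ring

theorem norm_greenOf_le (ℓ : ℕ) {φ : ℝ → ℂ} {R R' C : ℝ} (hR : 0 < R)
    (hR' : 0 < R') (hC : ∀ u ∈ Icc 0 (R + R'), ‖φ u‖ ≤ C) :
    ‖greenOf ℓ φ R R'‖ ≤ C * min R R' := by
  obtain ⟨h1, h2⟩ := inv_chord_integral hR hR'
  refine (norm_greenOf_le_integral ℓ hR hR' hC h1 fun t ht => ?_).trans (le_of_eq ?_)
  · have h0 := chord_nonneg R R' t
    calc |(legendre ℓ).eval t| * (chord R R' t)⁻¹ ≤ 1 * (chord R R' t)⁻¹ := by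
          gcongr; exact abs_legendre_le_one ℓ ht
      _ = _ := one_mul _
  · rw [h2]; field_simp

theorem greenOf_sub (ℓ : ℕ) {φ ψ : ℝ → ℂ} (hφ : Continuous φ) (hψ : Continuous ψ) {R R' : ℝ}
    (hR : 0 < R) (hR' : 0 < R') :
    greenOf ℓ (fun u => φ u - ψ u) R R' = greenOf ℓ φ R R' - greenOf ℓ ψ R R' := by
  rw [greenOf, greenOf, greenOf, ← mul_sub, ← intervalIntegral.integral_sub
    (greenOf_intervalIntegrable ℓ hφ hR hR') (greenOf_intervalIntegrable ℓ hψ hR hR')]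
  congr 1
  refine intervalIntegral.integral_congr fun t _ => ?_
  ring

theorem greenOf_const_mul (ℓ : ℕ) (c : ℂ) (φ : ℝ → ℂ) (R R' : ℝ) :
    greenOf ℓ (fun u => c * φ u) R R' = c * greenOf ℓ φ R R' := by
  rw [greenOf, greenOf, mul_left_comm c, ← intervalIntegral.integral_const_mul c]
  congr 1
  refine intervalIntegral.integral_congr fun t _ => ?_
  ring

theorem stronglyMeasurable_greenOf (ℓ : ℕ) {φ : ℝ → ℂ} (hφ : Continuous φ) :
    StronglyMeasurable (uncurry (greenOf ℓ φ)) := by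
  have hch : Measurable fun q : (ℝ × ℝ) × ℝ => chord q.1.1 q.1.2 q.2 := by
    unfold chord; fun_prop
  have h : StronglyMeasurable fun q : (ℝ × ℝ) × ℝ =>
      φ (chord q.1.1 q.1.2 q.2) / (4 * Real.pi * chord q.1.1 q.1.2 q.2) *
      (((legendre ℓ).eval q.2 : ℝ) : ℂ) := by
    refine Measurable.stronglyMeasurable ?_
    refine Measurable.mul ?_ ((continuous_legendre_ofReal ℓ).measurable.comp measurable_snd)
    exact (hφ.measurable.comp hch).div ((Complex.measurable_ofReal.comp hch).const_mul _)
  have h2 : StronglyMeasurable fun p : ℝ × ℝ => ∫ t in Ioc (-1 : ℝ) 1,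
      φ (chord p.1 p.2 t) / (4 * Real.pi * chord p.1 p.2 t) *
      (((legendre ℓ).eval t : ℝ) : ℂ) := h.integral_prod_right'
  have h3 : uncurry (greenOf ℓ φ) = fun p : ℝ × ℝ => -(2 * Real.pi * p.1 * p.2 : ℂ) *
      ∫ t in Ioc (-1 : ℝ) 1, φ (chord p.1 p.2 t) / (4 * Real.pi * chord p.1 p.2 t) *
      (((legendre ℓ).eval t : ℝ) : ℂ) := by
    ext p
    rw [uncurry, greenOf, intervalIntegral.integral_of_le (by norm_num)]
  rw [h3]
  exact StronglyMeasurable.mul (by fun_prop) h2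

theorem norm_exp_I_mul (k : ℂ) (u : ℝ) :
    ‖Complex.exp (Complex.I * k * u)‖ = Real.exp (-k.im * u) := by
  rw [Complex.norm_exp]
  simp

theorem norm_exp_I_mul_le {α : ℝ} {k : ℂ} (hk : k ∈ closedHalfPlane α) {u v : ℝ} (hu : 0 ≤ u)
    (huv : u ≤ v) (hα : 0 < α) : ‖Complex.exp (Complex.I * k * u)‖ ≤ Real.exp (α * v) := by
  rw [norm_exp_I_mul]
  have hk' : -α ≤ k.im := hk
  refine Real.exp_le_exp.2 ?_
  nlinarith

theorem continuous_exp_I_mul (k : ℂ) :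
    Continuous fun u : ℝ => Complex.exp (Complex.I * k * u) := by fun_prop

/-- Cauchy–Schwarz with the known value of `∫ P_ℓ²`, written as the pointwise inequality `|P| ≤
1/(2s) + s P²/2` for `s = √(2ℓ+1)`, the choice of `s` that balances the two integrals. -/
theorem integral_abs_legendre_le (ℓ : ℕ) :
    ∫ t in (-1 : ℝ)..1, |(legendre ℓ).eval t| ≤ 2 / √(2 * ℓ + 1) := by
  have hs : 0 < √(2 * (ℓ : ℝ) + 1) := Real.sqrt_pos.2 (by positivity)
  have hs2 : √(2 * (ℓ : ℝ) + 1) ^ 2 = 2 * ℓ + 1 := Real.sq_sqrt (by positivity)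
  set s := √(2 * (ℓ : ℝ) + 1)
  have h1 : ∀ t ∈ Icc (-1 : ℝ) 1, |(legendre ℓ).eval t| ≤
      1 / (2 * s) + s / 2 * (legendre ℓ).eval t ^ 2 := by
    intro t _
    rw [← sq_abs ((legendre ℓ).eval t)]
    have h : 0 ≤ (1 / s) * (1 - s * |(legendre ℓ).eval t|) ^ 2 / 2 := by positivity
    have h' : (1 / s) * (1 - s * |(legendre ℓ).eval t|) ^ 2 / 2 =
      1 / (2 * s) + s / 2 * |(legendre ℓ).eval t| ^ 2 - |(legendre ℓ).eval t| := by
      field_simp; ring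
    linarith
  have hcont := (legendre ℓ).continuous
  refine (intervalIntegral.integral_mono_on (by norm_num) (Continuous.intervalIntegrable
    (by fun_prop) _ _) (Continuous.intervalIntegrable (by fun_prop) _ _) h1).trans ?_
  rw [intervalIntegral.integral_add (Continuous.intervalIntegrable (by fun_prop) _ _)
    (Continuous.intervalIntegrable (by fun_prop) _ _), intervalIntegral.integral_const_mul,
    integral_legendre_sq, ← hs2, intervalIntegral.integral_const, smul_eq_mul]
  refine le_of_eq ?_
  field_simp
  norm_num

theorem norm_green_le_of_ne {α : ℝ} (hα : 0 < α) (ℓ : ℕ) {k : ℂ} (hk : k ∈ closedHalfPlane α)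
    {R R' : ℝ} (hR : 0 < R) (hR' : 0 < R') (hne : R ≠ R') :
    ‖green ℓ k R R'‖ ≤
      Real.exp (α * (R + R')) * (R * R' / 2) * (|R - R'|⁻¹ * (2 / √(2 * ℓ + 1))) := by
  have hpos : 0 < |R - R'| := abs_pos.2 (sub_ne_zero.2 hne)
  have hcont := (legendre ℓ).continuous
  rw [green_eq_greenOf]
  refine (norm_greenOf_le_integral ℓ hR hR'
    (fun u hu => norm_exp_I_mul_le hk hu.1 hu.2 hα)
    (f := fun t => |R - R'|⁻¹ * |(legendre ℓ).eval t|)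
    (Continuous.intervalIntegrable (by fun_prop) _ _) fun t ht => ?_).trans ?_
  · rw [mul_comm]
    gcongr
    exact abs_sub_le_chord hR hR' ht
  · rw [intervalIntegral.integral_const_mul]
    gcongr
    exact integral_abs_legendre_le ℓ

/-- Since `du/dt = -RR'/u`, the integrand `e^(iku)/u` is, up to the factor `-ikRR'`, the derivative
of `e^(iku)`. One integration by parts against `P_ℓ` gains `1/|k|`; the constant depends on `ℓ`
through `P_ℓ'`. -/
theorem norm_green_le_of_ne' {α : ℝ} (hα : 0 < α) (ℓ : ℕ) : ∃ B : ℝ, 0 ≤ B ∧ ∀ {k : ℂ},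
    k ∈ closedHalfPlane α → k ≠ 0 → ∀ {R R' : ℝ}, 0 < R → 0 < R' → R ≠ R' →
    ‖green ℓ k R R'‖ ≤ Real.exp (α * (R + R')) * B / ‖k‖ := by
  set P := legendre ℓ
  obtain ⟨D, hD⟩ := (isCompact_Icc (a := (-1 : ℝ)) (b := 1)).exists_bound_of_continuousOn
    (Polynomial.derivative P).continuous.continuousOn
  have hD0 : 0 ≤ D := (norm_nonneg _).trans (hD 0 (by norm_num))
  -- Two boundary terms contribute `2`, the interval of length `2` contributes `2 D`, and the sum is
  -- divided by the `2` in `2ik`.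
  refine ⟨1 + D, by positivity, ?_⟩
  intro k hk hk0 R R' hR hR' hne
  have hpi := Real.pi_pos
  have hRR : (R : ℂ) * R' ≠ 0 := by
    exact_mod_cast (mul_pos hR hR').ne'
  have hpos : ∀ t ∈ Icc (-1 : ℝ) 1, 0 < R ^ 2 + R' ^ 2 - 2 * R * R' * t := fun t ht =>
    lt_of_lt_of_le (by have := sub_ne_zero.2 hne; positivity) (sq_sub_sq_le hR hR' ht)
  set e : ℝ → ℂ := fun t => Complex.exp (Complex.I * k * chord R R' t)
  have he : Continuous e := by
    have := continuous_chord R R'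
    fun_prop
  have he_norm : ∀ t ∈ Icc (-1 : ℝ) 1, ‖e t‖ ≤ Real.exp (α * (R + R')) := fun t ht =>
    norm_exp_I_mul_le hk (chord_nonneg _ _ _) (chord_le hR hR' ht) hα
  have hed : ∀ t ∈ Icc (-1 : ℝ) 1,
      HasDerivAt e (e t * (Complex.I * k * (-(R * R') / chord R R' t : ℝ))) t := fun t ht =>
    ((hasDerivAt_chord (hpos t ht)).ofReal_comp.const_mul (Complex.I * k)).cexp
  have hPd : ∀ t : ℝ, HasDerivAt (fun t : ℝ => ((P.eval t : ℝ) : ℂ))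
      (((Polynomial.derivative P).eval t : ℝ) : ℂ) t := fun t => (P.hasDerivAt t).ofReal_comp
  have hcP' : Continuous fun t : ℝ => (((Polynomial.derivative P).eval t : ℝ) : ℂ) :=
    Complex.continuous_ofReal.comp (Polynomial.derivative P).continuous
  have hcP := continuous_legendre_ofReal ℓ
  have hci : ContinuousOn (fun t => (((chord R R' t) : ℂ))⁻¹) (Icc (-1) 1) := by
    refine ContinuousOn.inv₀ (Complex.continuous_ofReal.comp
      (continuous_chord R R')).continuousOn fun t ht => ?_
    exact_mod_cast (Real.sqrt_pos.2 (hpos t ht)).ne'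
  have hint1 : IntervalIntegrable (fun t => e t * (Complex.I * k * (-(R * R') / chord R R' t : ℝ)) *
      ((P.eval t : ℝ) : ℂ)) volume (-1) 1 := by
    refine ContinuousOn.intervalIntegrable ?_
    rw [uIcc_of_le (by norm_num)]
    push_cast
    simp only [div_eq_mul_inv]
    exact (he.continuousOn.mul (continuousOn_const.mul (continuousOn_const.mul hci))).mul
      hcP.continuousOn
  have hint2 : IntervalIntegrable (fun t => e t * (((Polynomial.derivative P).eval t : ℝ) : ℂ))
      volume (-1) 1 := (he.mul hcP').intervalIntegrable _ _
  have hibp := intervalIntegral.integral_eq_sub_of_hasDerivAt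
    (f := fun t => e t * ((P.eval t : ℝ) : ℂ)) (a := (-1 : ℝ)) (b := 1)
    (fun t ht => (hed t (by rwa [uIcc_of_le (by norm_num)] at ht)).mul (hPd t))
    (hint1.add hint2)
  rw [intervalIntegral.integral_add hint1 hint2] at hibp
  have hg : green ℓ k R R' * (2 * Complex.I * k) = ∫ t in (-1 : ℝ)..1,
      e t * (Complex.I * k * (-(R * R') / chord R R' t : ℝ)) * ((P.eval t : ℝ) : ℂ) := by
    rw [green_eq_greenOf, greenOf, mul_assoc, mul_comm (∫ t in (-1 : ℝ)..1, _), ← mul_assoc,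
      ← intervalIntegral.integral_const_mul]
    refine intervalIntegral.integral_congr fun t ht => ?_
    rw [uIcc_of_le (by norm_num)] at ht
    have h1 : (chord R R' t : ℂ) ≠ 0 := by exact_mod_cast (Real.sqrt_pos.2 (hpos t ht)).ne'
    have h2 : (Real.pi : ℂ) ≠ 0 := by exact_mod_cast hpi.ne'
    simp only [e]
    push_cast
    field_simp
    ring
  have h3 : ‖green ℓ k R R' * (2 * Complex.I * k)‖ ≤ Real.exp (α * (R + R')) * (2 * (1 + D)) := by
    rw [hg, eq_sub_of_add_eq hibp]
    have hPle : ∀ t ∈ Icc (-1 : ℝ) 1, ‖e t * ((P.eval t : ℝ) : ℂ)‖ ≤ Real.exp (α * (R + R')) := by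
      intro t ht
      rw [norm_mul, Complex.norm_real]
      calc _ ≤ Real.exp (α * (R + R')) * 1 := by
            gcongr
            · exact he_norm t ht
            · exact abs_legendre_le_one ℓ ht
        _ = _ := mul_one _
    have hI : ‖∫ t in (-1 : ℝ)..1, e t * (((Polynomial.derivative P).eval t : ℝ) : ℂ)‖ ≤
        Real.exp (α * (R + R')) * D * |1 - (-1)| := by
      refine intervalIntegral.norm_integral_le_of_norm_le_const fun t ht => ?_
      rw [uIoc_of_le (by norm_num)] at ht
      have ht' : t ∈ Icc (-1 : ℝ) 1 := Ioc_subset_Icc_self ht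
      rw [norm_mul, Complex.norm_real]
      gcongr
      · exact he_norm t ht'
      · exact hD t ht'
    have ha := hPle 1 (by norm_num)
    have hb := hPle (-1) (by norm_num)
    refine (norm_sub_le _ _).trans ((add_le_add (norm_sub_le _ _) hI).trans ?_)
    norm_num
    norm_num at ha hb
    linarith
  rw [norm_mul, norm_mul, norm_mul, Complex.norm_I, Complex.norm_ofNat] at h3
  rw [le_div_iff₀ (norm_pos_iff.2 hk0)]
  linarith

end Green

/-! ### The weighted Green function as a square integrable kernel -/

section WeightedGreen

open Function

open Classical in
/-- The element of `L2Kernel` given by a kernel (zero if the kernel is not square integrable). -/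
def toL2 (f : ℝ → ℝ → ℂ) : L2Kernel :=
  if h : MemLp (uncurry f) 2 quadrant then h.toLp _ else 0

theorem toL2_eq {f : ℝ → ℝ → ℂ} (hf : MemLp (uncurry f) 2 quadrant) : toL2 f = hf.toLp _ :=
  dif_pos hf

theorem toL2_congr {f g : ℝ → ℝ → ℂ} (h : uncurry f =ᵐ[quadrant] uncurry g) :
    toL2 f = toL2 g := by
  by_cases hf : MemLp (uncurry f) 2 quadrant
  · rw [toL2_eq hf, toL2_eq (hf.ae_eq h), MemLp.toLp_eq_toLp_iff]
    exact h
  · rw [toL2, toL2, dif_neg hf, dif_neg fun hg => hf (hg.ae_eq h.symm)]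

theorem toL2_sub {f g : ℝ → ℝ → ℂ} (hf : MemLp (uncurry f) 2 quadrant)
    (hg : MemLp (uncurry g) 2 quadrant) :
    toL2 (fun x y => f x y - g x y) = toL2 f - toL2 g := by
  rw [toL2_eq hf, toL2_eq hg, ← MemLp.toLp_sub]
  exact toL2_eq (f := fun x y => f x y - g x y) (hf.sub hg)

theorem toL2_const_mul {f : ℝ → ℝ → ℂ} (c : ℂ) (hf : MemLp (uncurry f) 2 quadrant) :
    toL2 (fun x y => c * f x y) = c • toL2 f := by
  rw [toL2_eq hf, ← MemLp.toLp_const_smul]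
  exact toL2_eq (f := fun x y => c * f x y) (hf.const_smul c)

theorem norm_toL2_le {f : ℝ → ℝ → ℂ} {b : ℝ × ℝ → ℝ} (hb : MemLp b 2 quadrant)
    (h : ∀ᵐ p ∂quadrant, ‖f p.1 p.2‖ ≤ b p) : ‖toL2 f‖ ≤ (eLpNorm b 2 quadrant).toReal := by
  by_cases hf : MemLp (uncurry f) 2 quadrant
  · rw [toL2_eq hf, Lp.norm_toLp]
    refine ENNReal.toReal_mono hb.2.ne (eLpNorm_mono_ae ?_)
    filter_upwards [h] with p hp
    exact hp.trans (le_abs_self _)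
  · rw [toL2, dif_neg hf, norm_zero]
    exact ENNReal.toReal_nonneg

/-- Dominated convergence for the squared norms, which is why the filter must be countably
generated. If `F i` is not square integrable, `toL2` returns zero and the estimate is trivial. -/
theorem tendsto_toL2_zero {ι : Type*} {l : Filter ι} [l.IsCountablyGenerated]
    {F : ι → ℝ → ℝ → ℂ} {b : ℝ × ℝ → ℝ} (hb : MemLp b 2 quadrant)
    (hF : ∀ i, AEStronglyMeasurable (uncurry (F i)) quadrant)
    (hle : ∀ᶠ i in l, ∀ᵐ p ∂quadrant, ‖F i p.1 p.2‖ ≤ b p)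
    (hlim : ∀ᵐ p ∂quadrant, Tendsto (fun i => F i p.1 p.2) l (𝓝 0)) :
    Tendsto (fun i => toL2 (F i)) l (𝓝 0) := by
  have h1 : Tendsto (fun i => ∫⁻ p, ‖uncurry (F i) p‖ₑ ^ 2 ∂quadrant) l
      (𝓝 (∫⁻ _, 0 ∂quadrant)) := by
    refine tendsto_lintegral_filter_of_dominated_convergence' (fun p => ‖b p‖ₑ ^ 2) ?_ ?_ ?_ ?_
    · exact Eventually.of_forall fun i => (hF i).enorm.pow_const 2
    · filter_upwards [hle] with i hi
      filter_upwards [hi] with p hp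
      gcongr
      rw [← ofReal_norm, ← ofReal_norm]
      exact ENNReal.ofReal_le_ofReal (hp.trans (le_abs_self _))
    · exact ((memLp_two_iff_lintegral hb.1).1 hb).ne
    · filter_upwards [hlim] with p hp
      have := ((ENNReal.continuous_pow 2).comp continuous_enorm).tendsto (0 : ℂ) |>.comp hp
      simpa [enorm_zero, comp_def, uncurry] using this
  rw [lintegral_zero] at h1
  rw [tendsto_zero_iff_norm_tendsto_zero]
  have h2 : Tendsto (fun i => √((∫⁻ p, ‖uncurry (F i) p‖ₑ ^ 2 ∂quadrant).toReal)) l (𝓝 0) := by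
    have := (ENNReal.tendsto_toReal ENNReal.zero_ne_top).comp h1
    simpa [comp_def] using (Real.continuous_sqrt.tendsto _).comp this
  refine squeeze_zero' (Eventually.of_forall fun i => norm_nonneg _) ?_ h2
  refine Eventually.of_forall fun i => ?_
  by_cases hf : MemLp (uncurry (F i)) 2 quadrant
  · rw [toL2_eq hf, Lp.norm_toLp, ← eLpNorm_two_sq, ENNReal.toReal_pow,
      Real.sqrt_sq ENNReal.toReal_nonneg]
  · rw [toL2, dif_neg hf, norm_zero]
    exact Real.sqrt_nonneg _

theorem weight_pos (ε : ℝ) {R : ℝ} (hR : 0 < R) : 0 < weight ε R :=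
  mul_pos (Real.rpow_pos_of_pos hR _) (Real.rpow_pos_of_pos (by linarith) _)

theorem expWeight_pos (ε α : ℝ) {R : ℝ} (hR : 0 < R) : 0 < expWeight (weight ε) α R :=
  mul_pos (weight_pos ε hR) (Real.exp_pos _)

theorem measurable_weight (ε : ℝ) : Measurable (weight ε) := by
  unfold weight; fun_prop

theorem measurable_expWeight (ε α : ℝ) : Measurable (expWeight (weight ε) α) :=
  (measurable_weight ε).mul (by fun_prop)

theorem sqrt_expWeight (ε α : ℝ) {R : ℝ} (hR : 0 < R) :
    √(expWeight (weight ε) α R) = √(weight ε R) * Real.exp (α * R) := by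
  rw [expWeight, Real.sqrt_mul (weight_pos ε hR).le, show 2 * α * R = α * R + α * R by ring,
    Real.exp_add, Real.sqrt_mul_self (Real.exp_pos _).le]

/-- The function `(R / w(R))^(1/2)`, whose square is integrable. -/
def radialBound (ε R : ℝ) : ℝ := √(R / weight ε R)

theorem measurable_radialBound (ε : ℝ) : Measurable (radialBound ε) :=
  (measurable_id.div (measurable_weight ε)).sqrt

theorem ae_halfLine_pos : ∀ᵐ R ∂halfLine, 0 < R :=
  (ae_restrict_iff' measurableSet_Ioi).2 (ae_of_all _ fun _ h => h)

theorem ae_quadrant_pos : ∀ᵐ p ∂quadrant, 0 < p.1 ∧ 0 < p.2 :=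
  ae_quadrant_of_ae (P := fun x y => 0 < x ∧ 0 < y) ae_halfLine_pos ae_halfLine_pos
    fun _ _ h h' => ⟨h, h'⟩

/-- Exactly, `R / w(R) = R^ε (1+R)^(-1-2ε)`: the weight is tuned so that this is integrable both at
the origin and at infinity. -/
theorem div_weight_le {ε : ℝ} (hε : 0 < ε) {R : ℝ} (hR : 0 < R) :
    R / weight ε R ≤ (R + 1) ^ (-1 - ε) := by
  rw [div_le_iff₀ (weight_pos ε hR), weight, add_comm 1 R, mul_comm, mul_assoc,
    ← Real.rpow_add (by linarith), show 1 + 2 * ε + (-1 - ε) = ε by ring]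
  calc R = R ^ (1 - ε) * R ^ ε := by
        rw [← Real.rpow_add hR, sub_add_cancel, Real.rpow_one]
    _ ≤ R ^ (1 - ε) * (R + 1) ^ ε := by
        gcongr
        linarith

theorem memLp_radialBound {ε : ℝ} (hε : 0 < ε) : MemLp (radialBound ε) 2 halfLine := by
  have hi : Integrable (fun R : ℝ => (R + 1) ^ (-1 - ε)) halfLine :=
    integrableOn_add_rpow_Ioi_of_lt (by linarith) (by norm_num)
  rw [memLp_two_iff_integrable_sq (measurable_radialBound ε).aestronglyMeasurable]
  refine hi.mono' ((measurable_radialBound ε).pow_const 2).aestronglyMeasurable ?_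
  filter_upwards [ae_halfLine_pos] with R hR
  rw [Real.norm_of_nonneg (by positivity), radialBound,
    Real.sq_sqrt (div_nonneg hR.le (weight_pos ε hR).le)]
  exact div_weight_le hε hR

/-- The square integrable function that dominates the weighted Green functions. -/
def greenBound (ε : ℝ) (p : ℝ × ℝ) : ℝ := radialBound ε p.1 * radialBound ε p.2

theorem memLp_greenBound {ε : ℝ} (hε : 0 < ε) : MemLp (greenBound ε) 2 quadrant := by
  have hm := (measurable_radialBound ε).aestronglyMeasurable (μ := halfLine)
  refine (memLp_two_iff_lintegral (hm.comp_fst.mul hm.comp_snd)).2 ?_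
  simp only [enorm_mul, mul_pow, Pi.mul_apply]
  rw [lintegral_prod_mul (hm.enorm.pow_const 2) (hm.enorm.pow_const 2)]
  have := (memLp_two_iff_lintegral hm).1 (memLp_radialBound hε)
  exact ENNReal.mul_lt_top this this

/-- The kernel `greenOf ℓ φ`, divided by the square roots of the weights. -/
def wGreen (ε α : ℝ) (ℓ : ℕ) (φ : ℝ → ℂ) (R R' : ℝ) : ℂ :=
  greenOf ℓ φ R R' /
    ((√(expWeight (weight ε) α R) * √(expWeight (weight ε) α R') : ℝ) : ℂ)

/-- The factor `e^(α(R+R'))` cancels against the exponential parts of the two `√μ`, and `min R R' ≤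
√R √R'` makes the rest a product of functions of one radius. -/
theorem norm_wGreen_le (ε : ℝ) {α : ℝ} (hα : 0 < α) (ℓ : ℕ) {φ : ℝ → ℂ} {M : ℝ} (hM : 0 ≤ M)
    (hφ : ∀ u, 0 ≤ u → ‖φ u‖ ≤ M * Real.exp (α * u)) {R R' : ℝ} (hR : 0 < R) (hR' : 0 < R') :
    ‖wGreen ε α ℓ φ R R'‖ ≤ M * greenBound ε (R, R') := by
  have h1 := norm_greenOf_le ℓ (φ := φ) (C := M * Real.exp (α * (R + R'))) hR hR' fun u hu =>
    (hφ u hu.1).trans (by gcongr; exact hu.2)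
  have hw := weight_pos ε hR
  have hw' := weight_pos ε hR'
  have hmin : min R R' ≤ √R * √R' := by
    rw [← Real.sqrt_mul hR.le]
    refine Real.le_sqrt_of_sq_le ?_
    rw [sq]
    exact mul_le_mul (min_le_left _ _) (min_le_right _ _) (le_min hR.le hR'.le) hR.le
  have hs := Real.sqrt_pos.2 hw
  have hs' := Real.sqrt_pos.2 hw'
  rw [wGreen, norm_div, Complex.norm_real, sqrt_expWeight ε α hR, sqrt_expWeight ε α hR',
    Real.norm_of_nonneg (by positivity), div_le_iff₀ (by positivity), greenBound, radialBound,
    radialBound, Real.sqrt_div hR.le, Real.sqrt_div hR'.le]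
  refine h1.trans ?_
  rw [mul_add, Real.exp_add]
  calc _ ≤ M * (Real.exp (α * R) * Real.exp (α * R')) * (√R * √R') := by gcongr
    _ = _ := by dsimp only; field_simp

theorem aestronglyMeasurable_wGreen (ε α : ℝ) (ℓ : ℕ) {φ : ℝ → ℂ} (hφ : Continuous φ) :
    AEStronglyMeasurable (uncurry (wGreen ε α ℓ φ)) quadrant := by
  have h1 := (stronglyMeasurable_greenOf ℓ hφ).measurable
  have h2 := (measurable_expWeight ε α).sqrt
  exact (h1.div (Complex.measurable_ofReal.comp
    ((h2.comp measurable_fst).mul (h2.comp measurable_snd)))).aestronglyMeasurable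

theorem ae_norm_wGreen_le (ε : ℝ) {α : ℝ} (hα : 0 < α) (ℓ : ℕ) {φ : ℝ → ℂ} {M : ℝ} (hM : 0 ≤ M)
    (hφ : ∀ u, 0 ≤ u → ‖φ u‖ ≤ M * Real.exp (α * u)) :
    ∀ᵐ p ∂quadrant, ‖wGreen ε α ℓ φ p.1 p.2‖ ≤ (M • greenBound ε) p := by
  filter_upwards [ae_quadrant_pos] with p hp
  exact norm_wGreen_le ε hα ℓ hM hφ hp.1 hp.2

theorem memLp_wGreen {ε α : ℝ} (hε : 0 < ε) (hα : 0 < α) (ℓ : ℕ) {φ : ℝ → ℂ}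
    (hc : Continuous φ) {M : ℝ} (hM : 0 ≤ M)
    (hφ : ∀ u, 0 ≤ u → ‖φ u‖ ≤ M * Real.exp (α * u)) :
    MemLp (uncurry (wGreen ε α ℓ φ)) 2 quadrant :=
  ((memLp_greenBound hε).const_smul M).of_le (aestronglyMeasurable_wGreen ε α ℓ hc)
    ((ae_norm_wGreen_le ε hα ℓ hM hφ).mono fun _ hp => hp.trans (le_abs_self _))

theorem norm_toL2_wGreen_le {ε α : ℝ} (hε : 0 < ε) (hα : 0 < α) (ℓ : ℕ) {φ : ℝ → ℂ}
    {M : ℝ} (hM : 0 ≤ M) (hφ : ∀ u, 0 ≤ u → ‖φ u‖ ≤ M * Real.exp (α * u)) :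
    ‖toL2 (wGreen ε α ℓ φ)‖ ≤ M * (eLpNorm (greenBound ε) 2 quadrant).toReal := by
  refine (norm_toL2_le ((memLp_greenBound hε).const_smul M)
    (ae_norm_wGreen_le ε hα ℓ hM hφ)).trans (le_of_eq ?_)
  rw [eLpNorm_const_smul, ENNReal.toReal_mul, toReal_enorm, Real.norm_of_nonneg hM]

theorem wGreen_sub (ε α : ℝ) (ℓ : ℕ) {φ ψ : ℝ → ℂ} (hφ : Continuous φ) (hψ : Continuous ψ)
    {R R' : ℝ} (hR : 0 < R) (hR' : 0 < R') :
    wGreen ε α ℓ (fun u => φ u - ψ u) R R' = wGreen ε α ℓ φ R R' - wGreen ε α ℓ ψ R R' := by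
  rw [wGreen, greenOf_sub ℓ hφ hψ hR hR', sub_div]; rfl

theorem toL2_wGreen_sub {ε α : ℝ} (ℓ : ℕ) {φ ψ : ℝ → ℂ}
    (hφ : Continuous φ) (hψ : Continuous ψ) (hφ' : MemLp (uncurry (wGreen ε α ℓ φ)) 2 quadrant)
    (hψ' : MemLp (uncurry (wGreen ε α ℓ ψ)) 2 quadrant) :
    toL2 (wGreen ε α ℓ (fun u => φ u - ψ u)) =
      toL2 (wGreen ε α ℓ φ) - toL2 (wGreen ε α ℓ ψ) := by
  rw [← toL2_sub hφ' hψ']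
  refine toL2_congr ?_
  filter_upwards [ae_quadrant_pos] with p hp
  exact wGreen_sub ε α ℓ hφ hψ hp.1 hp.2

theorem toL2_wGreen_const_mul {ε α : ℝ} (ℓ : ℕ) (c : ℂ) {φ : ℝ → ℂ}
    (hφ' : MemLp (uncurry (wGreen ε α ℓ φ)) 2 quadrant) :
    toL2 (wGreen ε α ℓ (fun u => c * φ u)) = c • toL2 (wGreen ε α ℓ φ) := by
  rw [← toL2_const_mul c hφ']
  congr 1
  ext R R'
  rw [wGreen, greenOf_const_mul, mul_div_assoc]; rfl

/-- The exponential `u ↦ e^(iku)`. -/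
def planeExp (k : ℂ) (u : ℝ) : ℂ := Complex.exp (Complex.I * k * u)

theorem continuous_planeExp (k : ℂ) : Continuous (planeExp k) := continuous_exp_I_mul k

theorem norm_planeExp (k : ℂ) (u : ℝ) : ‖planeExp k u‖ = Real.exp (-k.im * u) := norm_exp_I_mul k u

theorem norm_planeExp_le {α : ℝ} (hα : 0 < α) {k : ℂ} (hk : k ∈ closedHalfPlane α) {u : ℝ}
    (hu : 0 ≤ u) : ‖planeExp k u‖ ≤ 1 * Real.exp (α * u) :=
  (norm_exp_I_mul_le hk hu le_rfl hα).trans_eq (one_mul _).symm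

/-- The weighted angular-momentum Green function. -/
def greenL2 (ε α : ℝ) (ℓ : ℕ) (k : ℂ) : L2Kernel := toL2 (wGreen ε α ℓ (planeExp k))

theorem memLp_wGreen_planeExp {ε α : ℝ} (hε : 0 < ε) (hα : 0 < α) (ℓ : ℕ) {k : ℂ}
    (hk : k ∈ closedHalfPlane α) : MemLp (uncurry (wGreen ε α ℓ (planeExp k))) 2 quadrant :=
  memLp_wGreen hε hα ℓ (continuous_planeExp k) zero_le_one fun _ hu => norm_planeExp_le hα hk hu

theorem norm_greenL2_le {ε α : ℝ} (hε : 0 < ε) (hα : 0 < α) (ℓ : ℕ) {k : ℂ}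
    (hk : k ∈ closedHalfPlane α) :
    ‖greenL2 ε α ℓ k‖ ≤ (eLpNorm (greenBound ε) 2 quadrant).toReal :=
  (norm_toL2_wGreen_le hε hα ℓ zero_le_one fun _ hu => norm_planeExp_le hα hk hu).trans_eq
    (one_mul _)

theorem norm_exp_sub_one_sub_id_le_mul_exp (z : ℂ) :
    ‖Complex.exp z - 1 - z‖ ≤ 2 * ‖z‖ ^ 2 * Real.exp ‖z‖ := by
  have h1 : 1 ≤ Real.exp ‖z‖ := Real.one_le_exp (norm_nonneg _)
  rcases le_total ‖z‖ 1 with h | h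
  · refine (Complex.norm_exp_sub_one_sub_id_le h).trans ?_
    nlinarith [sq_nonneg ‖z‖]
  · have h2 := Real.add_one_le_exp ‖z‖
    have h3 := Complex.norm_exp_le_exp_norm z
    have h4 : ‖Complex.exp z - 1 - z‖ ≤ ‖Complex.exp z‖ + 1 + ‖z‖ := by
      refine (norm_sub_le _ _).trans (add_le_add_left ((norm_sub_le _ _).trans ?_) _)
      rw [norm_one]
    have h5 : 1 ≤ ‖z‖ ^ 2 := one_le_pow₀ h
    nlinarith

theorem planeExp_add (k h : ℂ) (u : ℝ) :
    planeExp (k + h) u = planeExp k u * Complex.exp (Complex.I * h * u) := by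
  rw [planeExp, planeExp, ← Complex.exp_add]; ring_nf

/-- On the boundary line no exponential margin is left, so this estimate is local in `u ≤ v`. It
supplies the pointwise limit, while domination comes from elsewhere. -/
theorem norm_planeExp_sub_le {α : ℝ} (hα : 0 < α) {k h : ℂ} (hk : k ∈ closedHalfPlane α) {u v : ℝ}
    (hu : 0 ≤ u) (huv : u ≤ v) : ‖planeExp (k + h) u - planeExp k u‖ ≤
      Real.exp (α * v) * (2 * (‖h‖ * v) ^ 2 * Real.exp (‖h‖ * v) + ‖h‖ * v) := by
  have hz : ‖Complex.I * h * u‖ = ‖h‖ * u := by simp [abs_of_nonneg hu]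
  have h1 := norm_exp_sub_one_sub_id_le_mul_exp (Complex.I * h * u)
  have h2 : ‖Complex.exp (Complex.I * h * u) - 1‖ ≤
      2 * (‖h‖ * v) ^ 2 * Real.exp (‖h‖ * v) + ‖h‖ * v := by
    have := norm_add_le (Complex.exp (Complex.I * h * u) - 1 - Complex.I * h * u)
      (Complex.I * h * u)
    rw [sub_add_cancel] at this
    rw [hz] at h1 this
    refine this.trans (add_le_add (h1.trans ?_) (by gcongr))
    gcongr
  rw [planeExp_add, ← mul_sub_one, norm_mul]
  gcongr
  exact norm_exp_I_mul_le hk hu huv hα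

/-- Write `δ = Im k + α`. One half of the margin, `e^(δu/2)`, absorbs `u²` at the cost of `8/δ²`;
the other half absorbs `e^(|h|u)`. -/
theorem norm_planeExp_sub_sub_le {α : ℝ} {k h : ℂ} {u : ℝ} (hu : 0 ≤ u) (hδ : 0 < k.im + α)
    (hh : ‖h‖ ≤ (k.im + α) / 2) :
    ‖planeExp (k + h) u - planeExp k u - h * (Complex.I * u * planeExp k u)‖ ≤
      (16 / (k.im + α) ^ 2 * ‖h‖ ^ 2) * Real.exp (α * u) := by
  set δ := k.im + α
  have hz : ‖Complex.I * h * u‖ = ‖h‖ * u := by simp [abs_of_nonneg hu]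
  have h1 := norm_exp_sub_one_sub_id_le_mul_exp (Complex.I * h * u)
  rw [hz] at h1
  have h2 : planeExp (k + h) u - planeExp k u - h * (Complex.I * u * planeExp k u) =
      planeExp k u * (Complex.exp (Complex.I * h * u) - 1 - Complex.I * h * u) := by
    rw [planeExp_add]; ring
  rw [h2, norm_mul, norm_planeExp]
  have h3 : u ^ 2 ≤ 8 / δ ^ 2 * Real.exp (δ / 2 * u) := by
    have := Real.quadratic_le_exp_of_nonneg (x := δ / 2 * u) (by positivity)
    have h4 : (δ / 2 * u) ^ 2 / 2 ≤ Real.exp (δ / 2 * u) := by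
      have : 0 ≤ δ / 2 * u := by positivity
      linarith
    rw [div_mul_eq_mul_div, le_div_iff₀ (by positivity)]
    linarith
  have h5 : Real.exp (‖h‖ * u) ≤ Real.exp (δ / 2 * u) := by gcongr
  calc Real.exp (-k.im * u) * ‖Complex.exp (Complex.I * h * u) - 1 - Complex.I * h * u‖
      ≤ Real.exp (-k.im * u) * (2 * (‖h‖ * u) ^ 2 * Real.exp (‖h‖ * u)) := by gcongr
    _ = 2 * ‖h‖ ^ 2 * Real.exp (-k.im * u) * (u ^ 2 * Real.exp (‖h‖ * u)) := by ring
    _ ≤ 2 * ‖h‖ ^ 2 * Real.exp (-k.im * u) *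
        (8 / δ ^ 2 * Real.exp (δ / 2 * u) * Real.exp (δ / 2 * u)) := by gcongr
    _ = (16 / δ ^ 2 * ‖h‖ ^ 2) *
        (Real.exp (-k.im * u) * Real.exp (δ / 2 * u) * Real.exp (δ / 2 * u)) := by ring
    _ = _ := by
      rw [← Real.exp_add, ← Real.exp_add]
      congr 2
      simp only [δ]; ring

theorem continuousOn_greenL2 {ε α : ℝ} (hε : 0 < ε) (hα : 0 < α) (ℓ : ℕ) :
    ContinuousOn (greenL2 ε α ℓ) (closedHalfPlane α) := by
  intro k hk
  rw [ContinuousWithinAt, tendsto_iff_norm_sub_tendsto_zero]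
  have h : Tendsto (fun q => toL2 (wGreen ε α ℓ fun u => planeExp q u - planeExp k u))
      (𝓝[closedHalfPlane α] k) (𝓝 0) := by
    refine tendsto_toL2_zero ((memLp_greenBound hε).const_smul (2 : ℝ)) (fun q =>
      aestronglyMeasurable_wGreen ε α ℓ ((continuous_planeExp q).sub (continuous_planeExp k)))
      ?_ ?_
    · filter_upwards [self_mem_nhdsWithin] with q hq
      refine ae_norm_wGreen_le ε hα ℓ zero_le_two fun u hu => (norm_sub_le _ _).trans ?_
      have h1 := norm_planeExp_le hα hk hu
      have h2 := norm_planeExp_le hα hq hu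
      linarith
    · filter_upwards [ae_quadrant_pos] with p hp
      simp only [wGreen]
      rw [← zero_div ((√(expWeight (weight ε) α p.1) * √(expWeight (weight ε) α p.2) : ℝ) : ℂ)]
      refine Tendsto.div_const (tendsto_nhdsWithin_of_tendsto_nhds ?_) _
      have h1 : ∀ q : ℂ, ‖greenOf ℓ (fun u => planeExp q u - planeExp k u) p.1 p.2‖ ≤
          Real.exp (α * (p.1 + p.2)) * (2 * (‖q - k‖ * (p.1 + p.2)) ^ 2 *
            Real.exp (‖q - k‖ * (p.1 + p.2)) + ‖q - k‖ * (p.1 + p.2)) * min p.1 p.2 := by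
        intro q
        refine norm_greenOf_le ℓ hp.1 hp.2 fun u hu => ?_
        have := norm_planeExp_sub_le hα (h := q - k) hk hu.1 hu.2
        rwa [add_sub_cancel] at this
      refine squeeze_zero_norm h1 ?_
      refine (Continuous.tendsto' (by fun_prop) k 0 ?_)
      simp
  refine (tendsto_zero_iff_norm_tendsto_zero.1 h).congr' ?_
  filter_upwards [self_mem_nhdsWithin] with q hq
  rw [toL2_wGreen_sub ℓ (continuous_planeExp q) (continuous_planeExp k)
    (memLp_wGreen_planeExp hε hα ℓ hq) (memLp_wGreen_planeExp hε hα ℓ hk)]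
  rfl

theorem halfPlane_subset (α : ℝ) : halfPlane α ⊆ closedHalfPlane α :=
  fun k (hk : -α < k.im) => hk.le

theorem isOpen_halfPlane (α : ℝ) : IsOpen (halfPlane α) :=
  isOpen_lt continuous_const Complex.continuous_im

theorem differentiableOn_greenL2 {ε α : ℝ} (hε : 0 < ε) (hα : 0 < α) (ℓ : ℕ) :
    DifferentiableOn ℂ (greenL2 ε α ℓ) (halfPlane α) := by
  intro k hk
  have hδ : 0 < k.im + α := by have : -α < k.im := hk; linarith
  set ψ : ℝ → ℂ := fun u => Complex.I * u * planeExp k u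
  have hψc : Continuous ψ := by have := continuous_planeExp k; fun_prop
  have hψ : MemLp (uncurry (wGreen ε α ℓ ψ)) 2 quadrant := by
    -- The constant comes from `δ u ≤ e^(δu)` with `δ = Im k + α`.
    refine memLp_wGreen hε hα ℓ hψc (M := 1 / (k.im + α)) (by positivity) fun u hu => ?_
    have h1 : ‖ψ u‖ = u * Real.exp (-k.im * u) := by
      simp only [ψ, norm_mul, norm_planeExp]; simp [abs_of_nonneg hu]
    have h2 := Real.add_one_le_exp ((k.im + α) * u)
    rw [h1, div_mul_eq_mul_div, one_mul, le_div_iff₀ hδ]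
    calc u * Real.exp (-k.im * u) * (k.im + α)
        = Real.exp (-k.im * u) * ((k.im + α) * u) := by ring
      _ ≤ Real.exp (-k.im * u) * Real.exp ((k.im + α) * u) := by gcongr; linarith
      _ = _ := by rw [← Real.exp_add]; ring_nf
  refine HasDerivAt.differentiableAt (f' := toL2 (wGreen ε α ℓ ψ)) ?_ |>.differentiableWithinAt
  rw [hasDerivAt_iff_isLittleO_nhds_zero]
  set B := (eLpNorm (greenBound ε) 2 quadrant).toReal
  refine Asymptotics.IsBigO.trans_isLittleO (g := fun h : ℂ => ‖h‖ ^ 2) ?_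
    (Asymptotics.isLittleO_norm_pow_id one_lt_two)
  refine Asymptotics.IsBigO.of_bound (16 / (k.im + α) ^ 2 * B) ?_
  filter_upwards [Metric.closedBall_mem_nhds (0 : ℂ) (half_pos hδ)] with h hh
  rw [mem_closedBall_zero_iff] at hh
  have hkh : k + h ∈ closedHalfPlane α := by
    have := (abs_le.1 ((Complex.abs_im_le_norm h).trans hh)).1
    change -α ≤ (k + h).im
    rw [Complex.add_im]
    linarith
  have hk' := halfPlane_subset α hk
  have he : greenL2 ε α ℓ (k + h) - greenL2 ε α ℓ k - h • toL2 (wGreen ε α ℓ ψ) =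
      toL2 (wGreen ε α ℓ fun u => planeExp (k + h) u - planeExp k u - h * ψ u) := by
    have m1 := memLp_wGreen_planeExp hε hα ℓ hkh
    have m2 := memLp_wGreen_planeExp hε hα ℓ hk'
    have c1 := continuous_planeExp (k + h)
    have c2 := continuous_planeExp k
    have m3 : MemLp (uncurry (wGreen ε α ℓ fun u => planeExp (k + h) u - planeExp k u)) 2
        quadrant := by
      refine (m1.sub m2).ae_eq ?_
      filter_upwards [ae_quadrant_pos] with p hp
      exact (wGreen_sub ε α ℓ c1 c2 hp.1 hp.2).symm
    have m4 : MemLp (uncurry (wGreen ε α ℓ fun u => h * ψ u)) 2 quadrant := by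
      refine (hψ.const_smul h).ae_eq (ae_of_all _ fun p => ?_)
      simp only [Pi.smul_apply, uncurry, wGreen, smul_eq_mul, greenOf_const_mul, mul_div_assoc]
    rw [toL2_wGreen_sub ℓ (φ := fun u => planeExp (k + h) u - planeExp k u) (c1.sub c2)
      (hψc.const_mul h) m3 m4, toL2_wGreen_sub ℓ c1 c2 m1 m2,
      toL2_wGreen_const_mul ℓ h hψ]
    rfl
  rw [he, norm_pow, norm_norm]
  refine (norm_toL2_wGreen_le hε hα ℓ (by positivity) fun u hu =>
    norm_planeExp_sub_sub_le hu hδ hh).trans (le_of_eq ?_)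
  ring

/-- The filter of the pairs `(ℓ, k)` with `k` in the closed half-plane and
`max (|k|, ℓ) → ∞`. -/
def highFilter (α : ℝ) : Filter (ℕ × ℂ) :=
  comap (fun q : ℕ × ℂ => max ‖q.2‖ (q.1 : ℝ)) atTop ⊓ 𝓟 {q | q.2 ∈ closedHalfPlane α}

instance (α : ℝ) : (highFilter α).IsCountablyGenerated := by
  unfold highFilter; infer_instance

theorem eventually_highFilter {α : ℝ} {P : ℕ × ℂ → Prop} :
    (∀ᶠ q in highFilter α, P q) ↔
      ∃ r : ℝ, ∀ ℓ : ℕ, ∀ k ∈ closedHalfPlane α, r ≤ max ‖k‖ (ℓ : ℝ) → P (ℓ, k) := by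
  rw [highFilter, eventually_inf_principal, ((atTop_basis (α := ℝ)).comap _).eventually_iff]
  simp only [true_and, mem_preimage, mem_Ici, mem_ofPred_eq, Prod.forall]
  exact exists_congr fun r => ⟨fun h ℓ k hk hr => h ℓ k hr hk, fun h ℓ k hr hk => h ℓ k hk hr⟩

/-- Large `ℓ` is handled uniformly in `k` by `norm_green_le_of_ne`. Only finitely many `ℓ` remain,
and for them `max(|k|, ℓ) ≥ r` forces `|k|` to be large, so the `ℓ`-dependent constants of
`norm_green_le_of_ne'` can be summed. -/
theorem tendsto_green_highFilter {α : ℝ} (hα : 0 < α) {R R' : ℝ} (hR : 0 < R) (hR' : 0 < R')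
    (hne : R ≠ R') : Tendsto (fun q : ℕ × ℂ => green q.1 q.2 R R') (highFilter α) (𝓝 0) := by
  rw [Metric.tendsto_nhds]
  intro η hη
  rw [eventually_highFilter]
  have h1 : Tendsto (fun ℓ : ℕ => Real.exp (α * (R + R')) * (R * R' / 2) *
      (|R - R'|⁻¹ * (2 / √(2 * ℓ + 1)))) atTop (𝓝 0) := by
    have : Tendsto (fun ℓ : ℕ => 2 / √(2 * (ℓ : ℝ) + 1)) atTop (𝓝 0) := by
      refine Tendsto.div_atTop tendsto_const_nhds (Real.tendsto_sqrt_atTop.comp ?_)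
      exact tendsto_atTop_add_const_right _ _
        (tendsto_natCast_atTop_atTop.const_mul_atTop two_pos)
    simpa using (this.const_mul (|R - R'|⁻¹)).const_mul (Real.exp (α * (R + R')) * (R * R' / 2))
  obtain ⟨n, hn⟩ := eventually_atTop.1 (h1.eventually_lt_const hη)
  choose B hB0 hB using fun ℓ => norm_green_le_of_ne' hα ℓ
  set C := Real.exp (α * (R + R')) * ∑ ℓ ∈ Finset.range n, B ℓ
  have hC : 0 ≤ C := mul_nonneg (Real.exp_pos _).le (Finset.sum_nonneg fun ℓ _ => hB0 ℓ)
  -- The entry `n` excludes that a small `ℓ` alone reaches the threshold; `C / η + 1` makes `C / ‖k‖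
  -- < η` strict.
  refine ⟨max n (C / η + 1), fun ℓ k hk hr => ?_⟩
  rw [dist_zero_right]
  rcases le_or_gt n ℓ with hℓ | hℓ
  · exact (norm_green_le_of_ne hα ℓ hk hR hR' hne).trans_lt (hn ℓ hℓ)
  · have hℓ' : (ℓ : ℝ) < n := by exact_mod_cast hℓ
    have hk1 : max (n : ℝ) (C / η + 1) ≤ ‖k‖ := by
      rcases le_max_iff.1 hr with h | h
      · exact h
      · exact absurd ((le_max_left _ _).trans h) (not_le.2 hℓ')
    have hk2 : C / η + 1 ≤ ‖k‖ := (le_max_right _ _).trans hk1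
    have hk3 : C / η < ‖k‖ := by linarith
    have hk0 : 0 < ‖k‖ := (div_nonneg hC hη.le).trans_lt hk3
    refine (hB ℓ hk (norm_pos_iff.1 hk0) hR hR' hne).trans_lt ?_
    rw [div_lt_iff₀ hk0]
    rw [div_lt_iff₀ hη] at hk3
    refine lt_of_le_of_lt ?_ (hk3.trans_eq (mul_comm _ _))
    simp only [C]
    gcongr
    exact Finset.single_le_sum (fun i _ => hB0 i) (Finset.mem_range.2 hℓ)

theorem ae_quadrant_ne : ∀ᵐ p ∂quadrant, p.1 ≠ p.2 := by
  have hs : MeasurableSet {p : ℝ × ℝ | p.1 ≠ p.2} :=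
    (measurableSet_eq_fun measurable_fst measurable_snd).compl
  refine (Measure.ae_prod_iff_ae_ae hs).2 (ae_of_all _ fun x => ?_)
  have : ∀ᵐ y ∂(volume : Measure ℝ), y ≠ x := Measure.ae_ne _ x
  exact (ae_restrict_of_ae this).mono fun y hy => hy.symm

theorem tendsto_greenL2_highFilter {ε α : ℝ} (hε : 0 < ε) (hα : 0 < α) :
    Tendsto (fun q : ℕ × ℂ => greenL2 ε α q.1 q.2) (highFilter α) (𝓝 0) := by
  refine tendsto_toL2_zero ((memLp_greenBound hε).const_smul (1 : ℝ)) (fun q =>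
    aestronglyMeasurable_wGreen ε α q.1 (continuous_planeExp q.2)) ?_ ?_
  · have : ∀ᶠ q in highFilter α, q.2 ∈ closedHalfPlane α :=
      mem_inf_of_right (mem_principal_self _)
    filter_upwards [this] with q hq
    exact ae_norm_wGreen_le ε hα q.1 zero_le_one fun u hu => norm_planeExp_le hα hq hu
  · filter_upwards [ae_quadrant_pos, ae_quadrant_ne] with p hp hne
    simp only [wGreen]
    rw [← zero_div ((√(expWeight (weight ε) α p.1) * √(expWeight (weight ε) α p.2) : ℝ) : ℂ)]
    exact (tendsto_green_highFilter hα hp.1 hp.2 hne).div_const _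

end WeightedGreen

/-! ### Integration in spherical coordinates -/

section Spherical

open Function

theorem lintegral_euclidean_three {F : ℝ × ℝ × ℝ → ℝ≥0∞} (hF : Measurable F) :
    ∫⁻ z : E3, F (z 0, z 1, z 2) = ∫⁻ a, ∫⁻ q : ℝ × ℝ, F (a, q) := by
  have h : MeasurePreserving (fun z : E3 => (z 0, z 1, z 2)) volume volume :=
    ((MeasurePreserving.id volume).prod (volume_preserving_finTwoArrow ℝ)).comp
      ((volume_preserving_piFinSuccAbove (fun _ : Fin 3 => ℝ) 0).comp
        (PiLp.volume_preserving_ofLp (Fin 3)))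
  rw [h.lintegral_comp hF, Measure.volume_eq_prod, lintegral_prod _ hF.aemeasurable]

theorem lintegral_polar {F : ℝ × ℝ → ℝ≥0∞} (hF : Measurable F) :
    ∫⁻ q, F q = ∫⁻ r in Ioi 0, ∫⁻ θ in Ioo (-Real.pi) Real.pi,
      ENNReal.ofReal r * F (r * Real.cos θ, r * Real.sin θ) := by
  rw [← lintegral_comp_polarCoord_symm, polarCoord_target, Measure.volume_eq_prod,
    ← Measure.prod_restrict, lintegral_prod]
  · rfl
  · have : Measurable fun p : ℝ × ℝ => (p.1 * Real.cos p.2, p.1 * Real.sin p.2) := by fun_prop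
    exact (measurable_fst.ennreal_ofReal.mul (hF.comp this)).aemeasurable

theorem polar_radius {r : ℝ} (hr : 0 < r) (θ : ℝ) :
    √((r * Real.cos θ) ^ 2 + (r * Real.sin θ) ^ 2) = r := by
  rw [show (r * Real.cos θ) ^ 2 + (r * Real.sin θ) ^ 2 =
    r ^ 2 * (Real.cos θ ^ 2 + Real.sin θ ^ 2) by ring, Real.cos_sq_add_sin_sq, mul_one,
    Real.sqrt_sq hr.le]

/-- Negative angles contribute nothing because `ENNReal.ofReal` truncates the negative sine; on `(0,
π)` this is the substitution `t = cos θ`. -/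
theorem lintegral_cos_subst (h : ℝ → ℝ≥0∞) :
    ∫⁻ θ in Ioo (-Real.pi) Real.pi, ENNReal.ofReal (Real.sin θ) * h (Real.cos θ) =
      ∫⁻ t in Ioo (-1 : ℝ) 1, h t := by
  have hpi := Real.pi_pos
  have himg : Real.cos '' Ioo 0 Real.pi = Ioo (-1) 1 := by
    ext t
    constructor
    · rintro ⟨θ, hθ, rfl⟩
      have hs := Real.sin_pos_of_mem_Ioo hθ
      have := Real.sin_sq_add_cos_sq θ
      constructor <;> nlinarith
    · intro ht
      refine ⟨Real.arccos t, ⟨Real.arccos_pos.2 ht.2, ?_⟩, Real.cos_arccos ht.1.le ht.2.le⟩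
      exact lt_of_le_of_ne (Real.arccos_le_pi t) fun h => absurd (Real.arccos_eq_pi.1 h)
        (not_le.2 ht.1)
  have hunion : Ioo (-Real.pi) Real.pi = Ioc (-Real.pi) 0 ∪ Ioo 0 Real.pi :=
    (Ioc_union_Ioo_eq_Ioo (by linarith) hpi).symm
  rw [hunion, lintegral_union measurableSet_Ioo
    (Set.disjoint_left.2 fun x hx hx' => absurd hx.2 (not_le.2 hx'.1)),
    setLIntegral_eq_zero measurableSet_Ioc, zero_add, ← himg,
    lintegral_image_eq_lintegral_abs_deriv_mul measurableSet_Ioo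
      (fun θ _ => (Real.hasDerivAt_cos θ).hasDerivWithinAt)
      (Real.injOn_cos.mono Ioo_subset_Icc_self)]
  · refine setLIntegral_congr_fun measurableSet_Ioo fun θ hθ => ?_
    rw [abs_neg, abs_of_pos (Real.sin_pos_of_mem_Ioo hθ)]
  · intro θ hθ
    have : Real.sin θ ≤ 0 := Real.sin_nonpos_of_nonpos_of_neg_pi_le hθ.2 hθ.1.le
    simp [ENNReal.ofReal_of_nonpos this]

/-- Polar coordinates twice: first in the plane orthogonal to the axis, then in the half-plane of
axial coordinate and distance `ρ` from the axis. The factor `ENNReal.ofReal ρ` vanishes for `ρ < 0`,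
so `ρ` may run over the whole line. -/
theorem lintegral_axial {f : ℝ → ℝ → ℝ≥0∞} (hf : Measurable (uncurry f)) :
    ∫⁻ z : E3, f ‖z‖ (z 0 / ‖z‖) =
      ENNReal.ofReal (2 * Real.pi) * ∫⁻ r in Ioi 0, ENNReal.ofReal (r ^ 2) *
        ∫⁻ t in Ioo (-1 : ℝ) 1, f r t := by
  set g : ℝ × ℝ → ℝ≥0∞ := fun p => f (√(p.1 ^ 2 + p.2 ^ 2)) (p.1 / √(p.1 ^ 2 + p.2 ^ 2))
  have hg : Measurable g := by
    have : Measurable fun p : ℝ × ℝ =>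
      (√(p.1 ^ 2 + p.2 ^ 2), p.1 / √(p.1 ^ 2 + p.2 ^ 2)) := by fun_prop
    exact hf.comp this
  have h1 : ∀ z : E3, f ‖z‖ (z 0 / ‖z‖) = g (z 0, √(z 1 ^ 2 + z 2 ^ 2)) := by
    intro z
    have : ‖z‖ = √(z 0 ^ 2 + √(z 1 ^ 2 + z 2 ^ 2) ^ 2) := by
      rw [EuclideanSpace.norm_eq, Real.sq_sqrt (by positivity), Fin.sum_univ_three]
      simp only [Real.norm_eq_abs, sq_abs, add_assoc]
    simp only [g, this]
  have h2 : ∀ a : ℝ, ∫⁻ q : ℝ × ℝ, g (a, √(q.1 ^ 2 + q.2 ^ 2)) =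
      ENNReal.ofReal (2 * Real.pi) * ∫⁻ ρ, ENNReal.ofReal ρ * g (a, ρ) := by
    intro a
    have hm : Measurable fun ρ : ℝ => ENNReal.ofReal ρ * g (a, ρ) :=
      ENNReal.measurable_ofReal.mul (hg.comp measurable_prodMk_left)
    have hs : ∫⁻ ρ in Ioi 0, ENNReal.ofReal ρ * g (a, ρ) = ∫⁻ ρ, ENNReal.ofReal ρ * g (a, ρ) := by
      refine setLIntegral_eq_of_support_subset fun ρ hρ => ?_
      by_contra h
      exact hρ (by simp [ENNReal.ofReal_of_nonpos (not_lt.1 (h : ¬ 0 < ρ))])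
    rw [lintegral_polar (F := fun q => g (a, √(q.1 ^ 2 + q.2 ^ 2)))
        (hg.comp (by fun_prop : Measurable fun q : ℝ × ℝ => (a, √(q.1 ^ 2 + q.2 ^ 2)))),
      ← hs, ← lintegral_const_mul _ hm]
    refine setLIntegral_congr_fun measurableSet_Ioi fun r hr => ?_
    simp only [polar_radius hr]
    rw [setLIntegral_const, Real.volume_Ioo, mul_comm]
    congr 2
    ring
  simp only [h1]
  rw [lintegral_euclidean_three (F := fun p => g (p.1, √(p.2.1 ^ 2 + p.2.2 ^ 2)))
    (hg.comp (by fun_prop : Measurable fun p : ℝ × ℝ × ℝ => (p.1, √(p.2.1 ^ 2 + p.2.2 ^ 2))))]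
  simp only [h2]
  have hm2 : Measurable fun p : ℝ × ℝ => ENNReal.ofReal p.2 * g p :=
    measurable_snd.ennreal_ofReal.mul hg
  rw [lintegral_const_mul _ hm2.lintegral_prod_right', ← lintegral_prod _ hm2.aemeasurable,
    ← Measure.volume_eq_prod, lintegral_polar hm2]
  congr 1
  refine setLIntegral_congr_fun measurableSet_Ioi fun r (hr : 0 < r) => ?_
  dsimp only
  rw [← lintegral_cos_subst, ← lintegral_const_mul]
  · refine lintegral_congr fun θ => ?_
    simp only [g]
    rw [polar_radius hr, ENNReal.ofReal_mul hr.le, mul_div_cancel_left₀ _ hr.ne', sq,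
      ENNReal.ofReal_mul hr.le]
    ring
  · have : Measurable (f r) := hf.comp measurable_prodMk_left
    exact (Real.measurable_sin.ennreal_ofReal).mul (this.comp Real.measurable_cos)

/-- A reflection that carries `x` to the axis preserves Lebesgue measure, norms and inner products.
-/
theorem lintegral_spherical {f : ℝ → ℝ → ℝ≥0∞} (hf : Measurable (uncurry f)) {x : E3}
    (hx : x ≠ 0) : ∫⁻ y : E3, f ‖y‖ (inner ℝ x y / (‖x‖ * ‖y‖)) =
      ENNReal.ofReal (2 * Real.pi) * ∫⁻ r in Ioi 0, ENNReal.ofReal (r ^ 2) *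
        ∫⁻ t in Ioo (-1 : ℝ) 1, f r t := by
  set e : E3 := EuclideanSpace.single 0 1
  have he : ‖x‖ = ‖‖x‖ • e‖ := by simp [e, norm_smul]
  set T := (ℝ ∙ (x - ‖x‖ • e))ᗮ.reflection
  have hT : T x = ‖x‖ • e := Submodule.reflection_sub he
  have hm : Measurable fun z : E3 => f ‖z‖ (z 0 / ‖z‖) := by
    have : Measurable fun z : E3 => (‖z‖, z 0 / ‖z‖) := by fun_prop
    exact hf.comp this
  rw [← lintegral_axial hf, ← T.measurePreserving.lintegral_comp hm]
  refine lintegral_congr fun y => ?_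
  have h1 : inner ℝ x y = ‖x‖ * T y 0 := by
    rw [← T.inner_map_map x y, hT, real_inner_smul_left]
    simp [e, EuclideanSpace.inner_single_left]
  rw [h1, mul_div_mul_left _ _ (norm_ne_zero_iff.2 hx), T.norm_map]

theorem lintegral_radial {h : ℝ → ℝ≥0∞} (hh : Measurable h) :
    ∫⁻ x : E3, h ‖x‖ = ENNReal.ofReal (4 * Real.pi) *
      ∫⁻ r in Ioi 0, ENNReal.ofReal (r ^ 2) * h r := by
  rw [lintegral_axial (f := fun r _ => h r) (hh.comp measurable_fst)]
  simp only [setLIntegral_const, Real.volume_Ioo, sub_neg_eq_add, one_add_one_eq_two]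
  have h1 : ∫⁻ r in Ioi 0, ENNReal.ofReal (r ^ 2) * (h r * ENNReal.ofReal 2) =
      (∫⁻ r in Ioi 0, ENNReal.ofReal (r ^ 2) * h r) * ENNReal.ofReal 2 := by
    rw [← lintegral_mul_const _ (by fun_prop)]
    exact lintegral_congr fun r => (mul_assoc _ _ _).symm
  rw [h1, show 4 * Real.pi = 2 * Real.pi * 2 by ring, ENNReal.ofReal_mul (p := 2 * Real.pi) (by positivity)]
  ring

end Spherical

/-! ### The weighted partial potentials -/

section Potential

open Function

/-- Zeroing a measurable representative on a measurable null set makes the comparison of squares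
hold everywhere. Finiteness of the potential norm then passes to the representative by mere
monotonicity of `∫⁻`, without transporting null sets to `E3 × E3`. -/
theorem AEMeasurable.exists_measurable_sq_le {X : Type*} [MeasurableSpace X] {m : Measure X}
    {f : X → ℝ} (hf : AEMeasurable f m) :
    ∃ g : X → ℝ, Measurable g ∧ (∀ x, g x ^ 2 ≤ f x ^ 2) ∧ f =ᵐ[m] g := by
  set N := toMeasurable m {x | f x ≠ hf.mk f x}
  have hN : m N = 0 := by
    rw [measure_toMeasurable]
    exact ae_iff.1 hf.ae_eq_mk
  have hsub : ∀ x, x ∉ N → f x = hf.mk f x := fun x hx => by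
    by_contra h
    exact hx (subset_toMeasurable _ _ h)
  refine ⟨Nᶜ.indicator (hf.mk f),
    hf.measurable_mk.indicator (measurableSet_toMeasurable _ _).compl, fun x => ?_, ?_⟩
  · by_cases hx : x ∈ N
    · rw [indicator_of_notMem (by simpa using hx)]
      simpa using sq_nonneg (f x)
    · rw [indicator_of_mem hx, hsub x hx]
  · filter_upwards [measure_eq_zero_iff_ae_notMem.1 hN] with x hx
    rw [indicator_of_mem hx, hsub x hx]

/-- Lebesgue measure on `[-1, 1]`. -/
abbrev angleMeasure : Measure ℝ := volume.restrict (Ioc (-1) 1)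

theorem ae_ae_angle_of_ae {Q : ℝ → ℝ → ℝ → Prop}
    (h : ∀ᵐ p : ℝ × ℝ × ℝ ∂(volume.restrict (Ioi 0 ×ˢ Ioi 0 ×ˢ Icc (-1) 1)), Q p.1 p.2.1 p.2.2) :
    ∀ᵐ p ∂quadrant, ∀ᵐ t ∂angleMeasure, Q p.1 p.2 t := by
  have h1 : (volume : Measure (ℝ × ℝ × ℝ)).restrict (Ioi 0 ×ˢ Ioi 0 ×ˢ Icc (-1) 1) =
      halfLine.prod (halfLine.prod angleMeasure) := by
    rw [Measure.volume_eq_prod, ← Measure.prod_restrict, Measure.volume_eq_prod,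
      ← Measure.prod_restrict, angleMeasure, Measure.restrict_congr_set Ioc_ae_eq_Icc]
    rfl
  rw [h1] at h
  exact Measure.ae_ae_of_ae_prod ((measurePreserving_prodAssoc _ _ _).quasiMeasurePreserving.ae h)

/-- The weighted square integral of the profile over the angle, as a function of the radii. -/
def profileDensity (μ : ℝ → ℝ) (U : ℝ → ℝ → ℝ → ℝ) (p : ℝ × ℝ) : ℝ≥0∞ :=
  ENNReal.ofReal (p.1 ^ 2 * μ p.1) * (ENNReal.ofReal (p.2 ^ 2 * μ p.2) *
    ∫⁻ t, ‖U p.1 p.2 t‖ₑ ^ 2 ∂angleMeasure)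

theorem enorm_sq_eq_ofReal (x : ℝ) : ‖x‖ₑ ^ 2 = ENNReal.ofReal (x ^ 2) := by
  rw [← ofReal_norm, ← ENNReal.ofReal_pow (norm_nonneg _), Real.norm_eq_abs, sq_abs]

theorem measurable_angle_lintegral {U : ℝ → ℝ → ℝ → ℝ}
    (hU : Measurable fun p : ℝ × ℝ × ℝ => U p.1 p.2.1 p.2.2) :
    Measurable fun p : ℝ × ℝ => ∫⁻ t, ‖U p.1 p.2 t‖ₑ ^ 2 ∂angleMeasure := by
  have : Measurable fun q : (ℝ × ℝ) × ℝ => ‖U q.1.1 q.1.2 q.2‖ₑ ^ 2 :=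
    ((hU.comp (by fun_prop : Measurable fun q : (ℝ × ℝ) × ℝ => (q.1.1, q.1.2, q.2))).enorm).pow_const
      2
  exact this.lintegral_prod_right'

theorem measurable_profileDensity {μ : ℝ → ℝ} (hμ : Measurable μ) {U : ℝ → ℝ → ℝ → ℝ}
    (hU : Measurable fun p : ℝ × ℝ × ℝ => U p.1 p.2.1 p.2.2) :
    Measurable (profileDensity μ U) := by
  have := measurable_angle_lintegral hU
  unfold profileDensity
  fun_prop

theorem potentialNormSq_eq {w : ℝ → ℝ} {α : ℝ} (hw : Measurable (expWeight w α))
    {U : ℝ → ℝ → ℝ → ℝ} (hU : Measurable fun p : ℝ × ℝ × ℝ => U p.1 p.2.1 p.2.2) :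
    potentialNormSq w α U = ENNReal.ofReal (4 * Real.pi) * (ENNReal.ofReal (2 * Real.pi) *
      ∫⁻ p, profileDensity (expWeight w α) U p ∂quadrant) := by
  set μ := expWeight w α
  set H : ℝ → ℝ≥0∞ := fun r => ENNReal.ofReal (2 * Real.pi) *
    ∫⁻ s in Ioi 0, ENNReal.ofReal (s ^ 2 * μ s) * ∫⁻ t, ‖U r s t‖ₑ ^ 2 ∂angleMeasure
  have hJ := measurable_angle_lintegral hU
  have hA : Measurable fun p : ℝ × ℝ =>
      ENNReal.ofReal (p.2 ^ 2 * μ p.2) * ∫⁻ t, ‖U p.1 p.2 t‖ₑ ^ 2 ∂angleMeasure := by fun_prop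
  have hA' : Measurable fun r => ∫⁻ s in Ioi 0,
      ENNReal.ofReal (s ^ 2 * μ s) * ∫⁻ t, ‖U r s t‖ₑ ^ 2 ∂angleMeasure :=
    hA.lintegral_prod_right' (ν := volume.restrict (Ioi 0))
  have hH : Measurable H := hA'.const_mul _
  have h1 : ∀ x : E3, x ≠ 0 → ∫⁻ y : E3, ENNReal.ofReal (μ ‖y‖) *
      ENNReal.ofReal (potential U x y ^ 2) = H ‖x‖ := by
    intro x hx
    have hm : Measurable (uncurry fun s t => ENNReal.ofReal (μ s) * ENNReal.ofReal (U ‖x‖ s t ^ 2)) :=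
      (hw.comp measurable_fst).ennreal_ofReal.mul
        (((hU.comp (by fun_prop : Measurable fun q : ℝ × ℝ => (‖x‖, q.1, q.2))).pow_const
          2).ennreal_ofReal)
    refine (lintegral_spherical hm hx).trans ?_
    simp only [H]
    congr 1
    refine lintegral_congr fun s => ?_
    have hms : Measurable fun t => ENNReal.ofReal (U ‖x‖ s t ^ 2) :=
      ((hU.comp (by fun_prop : Measurable fun t : ℝ => (‖x‖, s, t))).pow_const 2).ennreal_ofReal
    rw [lintegral_const_mul _ hms, ENNReal.ofReal_mul (sq_nonneg s), mul_assoc,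
      Measure.restrict_congr_set Ioo_ae_eq_Ioc]
    simp only [enorm_sq_eq_ofReal]
  have h2 : potentialNormSq w α U = ∫⁻ x : E3, ENNReal.ofReal (μ ‖x‖) * H ‖x‖ := by
    refine lintegral_congr_ae ?_
    filter_upwards [Measure.ae_ne volume (0 : E3)] with x hx
    rw [← h1 x hx]
  rw [h2, lintegral_radial (h := fun r => ENNReal.ofReal (μ r) * H r)
    (hw.ennreal_ofReal.mul hH), lintegral_prod _ (measurable_profileDensity hw hU).aemeasurable]
  congr 1
  rw [← lintegral_const_mul]
  · have hr : ∀ r, Measurable fun s : ℝ =>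
        ENNReal.ofReal (s ^ 2 * μ s) * ∫⁻ t, ‖U r s t‖ₑ ^ 2 ∂angleMeasure := fun r =>
      hA.comp (measurable_prodMk_left (x := r))
    refine lintegral_congr fun r => ?_
    simp only [H, profileDensity]
    rw [lintegral_const_mul _ (hr r), ENNReal.ofReal_mul (sq_nonneg r)]
    simp only [halfLine]
    ring
  · exact (measurable_profileDensity hw hU).lintegral_prod_right'

theorem exists_measurable_profile {ε α : ℝ} {U : ℝ → ℝ → ℝ → ℝ}
    (hU : MemPotentialClass (weight ε) α U) :
    ∃ U' : ℝ → ℝ → ℝ → ℝ, (Measurable fun p : ℝ × ℝ × ℝ => U' p.1 p.2.1 p.2.2) ∧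
      (∀ᵐ p ∂quadrant, ∀ᵐ t ∂angleMeasure, U p.1 p.2 t = U' p.1 p.2 t) ∧
      ∫⁻ p, profileDensity (expWeight (weight ε) α) U' p ∂quadrant < ∞ := by
  obtain ⟨g, hg, hle, heq⟩ := AEMeasurable.exists_measurable_sq_le hU.aemeasurable
  set U' : ℝ → ℝ → ℝ → ℝ := fun r s t => g (r, s, t)
  have hU' : Measurable fun p : ℝ × ℝ × ℝ => U' p.1 p.2.1 p.2.2 := hg
  refine ⟨U', hU', ae_ae_angle_of_ae (Q := fun r s t => U r s t = U' r s t) heq, ?_⟩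
  have h1 : potentialNormSq (weight ε) α U' < ∞ := by
    refine lt_of_le_of_lt (lintegral_mono fun x => ?_) hU.normSq_lt_top
    refine mul_le_mul_right (lintegral_mono fun y => mul_le_mul_right ?_ _) _
    exact ENNReal.ofReal_le_ofReal (hle _)
  rw [potentialNormSq_eq (measurable_expWeight ε α) hU'] at h1
  have hpi := Real.pi_pos
  have h2 : ENNReal.ofReal (4 * Real.pi) ≠ 0 := by simp [hpi]
  have h3 : ENNReal.ofReal (2 * Real.pi) ≠ 0 := by simp [hpi]
  exact ENNReal.lt_top_of_mul_ne_top_right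
    (ENNReal.lt_top_of_mul_ne_top_right h1.ne h2).ne h3

/-- The partial potential, multiplied by the square roots of the weights. -/
def wPotential (ε α : ℝ) (U : ℝ → ℝ → ℝ → ℝ) (ℓ : ℕ) (R R' : ℝ) : ℂ :=
  ((√(expWeight (weight ε) α R) * √(expWeight (weight ε) α R') * partialPotential U ℓ R R' : ℝ) : ℂ)

theorem enorm_legendre_sq_lintegral_le (ℓ : ℕ) :
    ∫⁻ t, ‖(legendre ℓ).eval t‖ₑ ^ 2 ∂angleMeasure ≤ 2 := by
  calc ∫⁻ t, ‖(legendre ℓ).eval t‖ₑ ^ 2 ∂angleMeasure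
      ≤ ∫⁻ _ in Ioc (-1 : ℝ) 1, 1 := by
        refine setLIntegral_mono measurable_const fun t ht => ?_
        rw [enorm_sq_eq_ofReal]
        have h := abs_legendre_le_one ℓ (Ioc_subset_Icc_self ht)
        refine ENNReal.ofReal_le_one.2 ?_
        rw [← sq_abs]
        exact pow_le_one₀ (abs_nonneg _) h
    _ = 2 := by
        rw [setLIntegral_one, Real.volume_Ioc]; norm_num

/-- Cauchy–Schwarz in the angle; since `∫ P_ℓ² ≤ 2`, the resulting majorant does not depend on `ℓ`.
-/
theorem enorm_wPotential_sq_le {ε α : ℝ} {U : ℝ → ℝ → ℝ → ℝ}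
    (hU : Measurable fun p : ℝ × ℝ × ℝ => U p.1 p.2.1 p.2.2) (ℓ : ℕ) {R R' : ℝ} (hR : 0 < R)
    (hR' : 0 < R') : ‖wPotential ε α U ℓ R R'‖ₑ ^ 2 ≤
      ENNReal.ofReal (4 * Real.pi ^ 2) * 2 *
        profileDensity (expWeight (weight ε) α) U (R, R') := by
  have hm : Measurable (U R R') :=
    hU.comp (by fun_prop : Measurable fun t : ℝ => (R, R', t))
  have hp := expWeight_pos ε α hR
  have hp' := expWeight_pos ε α hR'
  set μ := expWeight (weight ε) α
  have h1 : ‖∫ t in (-1 : ℝ)..1, U R R' t * (legendre ℓ).eval t‖ₑ ^ 2 ≤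
      (∫⁻ t, ‖U R R' t‖ₑ ^ 2 ∂angleMeasure) * 2 := by
    rw [intervalIntegral.integral_of_le (by norm_num)]
    have h2 := enorm_integral_le_lintegral_enorm (μ := angleMeasure)
      fun t => U R R' t * (legendre ℓ).eval t
    simp only [enorm_mul] at h2
    calc _ ≤ (∫⁻ t, ‖U R R' t‖ₑ * ‖(legendre ℓ).eval t‖ₑ ∂angleMeasure) ^ 2 := by gcongr
      _ ≤ _ := lintegral_mul_sq_le hm.enorm.aemeasurable
          (legendre ℓ).continuous.enorm.measurable.aemeasurable
      _ ≤ _ := by gcongr; exact enorm_legendre_sq_lintegral_le ℓ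
  have h3 : ‖wPotential ε α U ℓ R R'‖ₑ ^ 2 = ENNReal.ofReal (4 * Real.pi ^ 2) *
      (ENNReal.ofReal (R ^ 2 * μ R) * ENNReal.ofReal (R' ^ 2 * μ R')) *
      ‖∫ t in (-1 : ℝ)..1, U R R' t * (legendre ℓ).eval t‖ₑ ^ 2 := by
    rw [wPotential, ← ofReal_norm, Complex.norm_real, ofReal_norm, partialPotential, ← mul_assoc,
      enorm_mul, mul_pow, enorm_sq_eq_ofReal]
    congr 1
    rw [← ENNReal.ofReal_mul (by positivity), ← ENNReal.ofReal_mul (by positivity)]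
    congr 1
    rw [mul_pow, mul_pow, Real.sq_sqrt hp.le, Real.sq_sqrt hp'.le]
    ring
  rw [h3, profileDensity]
  refine (mul_le_mul_right h1 _).trans (le_of_eq ?_)
  ring

theorem partialPotential_congr {U U' : ℝ → ℝ → ℝ → ℝ} {p : ℝ × ℝ}
    (h : ∀ᵐ t ∂angleMeasure, U p.1 p.2 t = U' p.1 p.2 t) (ℓ : ℕ) :
    partialPotential U ℓ p.1 p.2 = partialPotential U' ℓ p.1 p.2 := by
  rw [partialPotential, partialPotential, intervalIntegral.integral_of_le (by norm_num),
    intervalIntegral.integral_of_le (by norm_num)]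
  congr 1
  refine integral_congr_ae ?_
  filter_upwards [h] with t ht
  rw [ht]

theorem measurable_wPotential {ε α : ℝ} {U : ℝ → ℝ → ℝ → ℝ}
    (hU : Measurable fun p : ℝ × ℝ × ℝ => U p.1 p.2.1 p.2.2) (ℓ : ℕ) :
    Measurable (uncurry (wPotential ε α U ℓ)) := by
  have h1 : StronglyMeasurable fun q : (ℝ × ℝ) × ℝ => U q.1.1 q.1.2 q.2 * (legendre ℓ).eval q.2 :=
    ((hU.comp (by fun_prop : Measurable fun q : (ℝ × ℝ) × ℝ => (q.1.1, q.1.2, q.2))).mul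
      ((legendre ℓ).continuous.measurable.comp measurable_snd)).stronglyMeasurable
  have h2 : Measurable fun p : ℝ × ℝ => ∫ t in (-1 : ℝ)..1, U p.1 p.2 t * (legendre ℓ).eval t := by
    simp only [intervalIntegral.integral_of_le (show (-1 : ℝ) ≤ 1 by norm_num)]
    exact (h1.integral_prod_right' (ν := angleMeasure)).measurable
  have h3 := measurable_expWeight ε α
  unfold wPotential partialPotential
  refine Complex.measurable_ofReal.comp ?_
  fun_prop

theorem exists_wPotential_bound {ε α : ℝ} {U : ℝ → ℝ → ℝ → ℝ}
    (hU : MemPotentialClass (weight ε) α U) :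
    (∀ ℓ, MemLp (uncurry (wPotential ε α U ℓ)) 2 quadrant) ∧
    (∃ C : ℝ, 0 ≤ C ∧ ∀ ℓ, ‖toL2 (wPotential ε α U ℓ)‖ ≤ C) ∧
    ∀ ℓ, ∀ᵐ p ∂quadrant,
      IntervalIntegrable (fun t => U p.1 p.2 t * (legendre ℓ).eval t) volume (-1) 1 := by
  obtain ⟨U', hm, heq, hfin⟩ := exists_measurable_profile hU
  have hae : ∀ ℓ, uncurry (wPotential ε α U' ℓ) =ᵐ[quadrant] uncurry (wPotential ε α U ℓ) := by
    intro ℓ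
    filter_upwards [heq] with p hp
    simp only [uncurry, wPotential, partialPotential_congr hp ℓ]
  set D := ENNReal.ofReal (4 * Real.pi ^ 2) * 2 *
    ∫⁻ p, profileDensity (expWeight (weight ε) α) U' p ∂quadrant
  have hD : D < ∞ := ENNReal.mul_lt_top (ENNReal.mul_lt_top ENNReal.ofReal_lt_top
    ENNReal.ofNat_lt_top) hfin
  have hle : ∀ ℓ, ∫⁻ p, ‖uncurry (wPotential ε α U' ℓ) p‖ₑ ^ 2 ∂quadrant ≤ D := by
    intro ℓ
    simp only [D]
    rw [← lintegral_const_mul _ (measurable_profileDensity (measurable_expWeight ε α) hm)]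
    refine lintegral_mono_ae ?_
    filter_upwards [ae_quadrant_pos] with p hp
    exact enorm_wPotential_sq_le hm ℓ hp.1 hp.2
  have hmem' : ∀ ℓ, MemLp (uncurry (wPotential ε α U' ℓ)) 2 quadrant := fun ℓ =>
    (memLp_two_iff_lintegral (measurable_wPotential hm ℓ).aestronglyMeasurable).2
      ((hle ℓ).trans_lt hD)
  refine ⟨fun ℓ => (hmem' ℓ).ae_eq (hae ℓ), ⟨√D.toReal, Real.sqrt_nonneg _, fun ℓ => ?_⟩,
    fun ℓ => ?_⟩
  · rw [← toL2_congr (hae ℓ), toL2_eq (hmem' ℓ), Lp.norm_toLp]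
    refine Real.le_sqrt_of_sq_le ?_
    rw [← ENNReal.toReal_pow, eLpNorm_two_sq]
    exact ENNReal.toReal_mono hD.ne (hle ℓ)
  · filter_upwards [heq, ae_quadrant_pos,
      ae_lt_top (measurable_profileDensity (measurable_expWeight ε α) hm) hfin.ne] with p h1 h2 h3
    have hmp : Measurable (U' p.1 p.2) := hm.comp (by fun_prop : Measurable fun t => (p.1, p.2, t))
    have hJ : ∫⁻ t, ‖U' p.1 p.2 t‖ₑ ^ 2 ∂angleMeasure < ∞ := by
      have hne : ∀ {r : ℝ}, 0 < r → ENNReal.ofReal (r ^ 2 * expWeight (weight ε) α r) ≠ 0 := by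
        intro r hr
        have := expWeight_pos ε α hr
        simp only [ne_eq, ENNReal.ofReal_eq_zero, not_le]
        positivity
      exact ENNReal.lt_top_of_mul_ne_top_right
        (ENNReal.lt_top_of_mul_ne_top_right h3.ne (hne h2.1)).ne (hne h2.2)
    have hL : MemLp (U' p.1 p.2) 2 angleMeasure :=
      (memLp_two_iff_lintegral hmp.aestronglyMeasurable).2 hJ
    have hP : MemLp (fun t => (legendre ℓ).eval t) 2 angleMeasure :=
      (memLp_two_iff_lintegral (legendre ℓ).continuous.aestronglyMeasurable).2
        ((enorm_legendre_sq_lintegral_le ℓ).trans_lt ENNReal.ofNat_lt_top)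
    rw [intervalIntegrable_iff_integrableOn_Ioc_of_le (by norm_num)]
    refine (hL.integrable_mul hP).congr ?_
    filter_upwards [h1] with t ht
    simp only [Pi.mul_apply, ht]

end Potential

/-! ### Power series with parameter-dependent coefficients -/

section Series

/-- A coefficient bound at radius `2M` yields the factor `2^(-n)` on the disc of radius `M`; all
convergence statements for the series use this. -/
theorem norm_pow_smul_le {E : Type*} [NormedAddCommGroup E] [NormedSpace ℂ E] {x : E} {g : ℂ}
    {M C : ℝ} (hg : ‖g‖ ≤ M) {n : ℕ} (hx : ‖x‖ * (2 * M) ^ n ≤ C) :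
    ‖g ^ n • x‖ ≤ C * (1 / 2) ^ n := by
  rw [norm_smul, norm_pow]
  calc ‖g‖ ^ n * ‖x‖ ≤ M ^ n * ‖x‖ := by gcongr
    _ = ‖x‖ * (2 * M) ^ n * (1 / 2) ^ n := by
      rw [mul_assoc, ← mul_pow, show 2 * M * (1 / 2) = M by ring, mul_comm]
    _ ≤ _ := by gcongr

theorem summable_const_mul_geometric_two (C : ℝ) : Summable fun n : ℕ => C * (1 / 2 : ℝ) ^ n :=
  summable_geometric_two.mul_left C

theorem continuous_tsum_pow_smul {X E : Type*} [TopologicalSpace X] [NormedAddCommGroup E]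
    [NormedSpace ℂ E] [CompleteSpace E] {a : ℕ → X → E} (ha : ∀ n, Continuous (a n))
    (hb : ∀ x₀, ∃ t ∈ 𝓝 x₀, ∀ r : ℝ, 0 < r → ∃ C, ∀ x ∈ t, ∀ n, ‖a n x‖ * r ^ n ≤ C) :
    Continuous fun p : X × ℂ => ∑' n, p.2 ^ n • a n p.1 := by
  rw [continuous_iff_continuousAt]
  rintro ⟨x₀, g₀⟩
  obtain ⟨t, ht, hb⟩ := hb x₀
  have hM : 0 < ‖g₀‖ + 1 := by positivity
  obtain ⟨C, hC⟩ := hb (2 * (‖g₀‖ + 1)) (by positivity)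
  have hc : ContinuousOn (fun p : X × ℂ => ∑' n, p.2 ^ n • a n p.1)
      (t ×ˢ Metric.ball 0 (‖g₀‖ + 1)) := by
    refine continuousOn_tsum (fun n => ?_) (summable_const_mul_geometric_two C) ?_
    · have := ha n
      fun_prop
    · rintro n ⟨x, g⟩ ⟨hx, hg⟩
      rw [mem_ball_zero_iff] at hg
      exact norm_pow_smul_le hg.le (hC x hx n)
  refine hc.continuousAt (prod_mem_nhds ht (Metric.isOpen_ball.mem_nhds ?_))
  rw [mem_ball_zero_iff]
  exact lt_add_one _

/-- Termwise Fréchet differentiation in both variables jointly; Cauchy's estimate on small discs in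
`k` bounds the derivatives of the coefficients. -/
theorem differentiableOn_tsum_pow_smul {E : Type*} [NormedAddCommGroup E]
    [NormedSpace ℂ E] [CompleteSpace E] {V : Set ℂ} (hV : IsOpen V) {a : ℕ → ℂ → E}
    (ha : ∀ n, DifferentiableOn ℂ (a n) V)
    (hb : ∀ r : ℝ, 0 < r → ∃ C, ∀ k ∈ V, ∀ n, ‖a n k‖ * r ^ n ≤ C) :
    DifferentiableOn ℂ (fun p : ℂ × ℂ => ∑' n, p.2 ^ n • a n p.1) (V ×ˢ univ) := by
  rintro ⟨k₀, g₀⟩ ⟨hk₀, -⟩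
  obtain ⟨ρ₀, hρ₀, hsub⟩ := Metric.isOpen_iff.1 hV k₀ hk₀
  -- Closed discs of radius `ρ` about points of the `ρ`-ball then stay inside the `ρ₀`-ball.
  set ρ := ρ₀ / 3
  have hρ : 0 < ρ := by positivity
  -- `M ≥ 1` allows `M ^ (n - 1) ≤ M ^ n`, including `n = 0` with truncated subtraction.
  set M := ‖g₀‖ + 1
  have hM1 : 1 ≤ M := by simp [M]
  have hM : 0 < M := by positivity
  obtain ⟨C, hC⟩ := hb (2 * M) (by positivity)
  have hin : ∀ k ∈ Metric.ball k₀ ρ, Metric.closedBall k ρ ⊆ V := by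
    intro k hk z hz
    refine hsub ?_
    rw [Metric.mem_ball] at hk ⊢
    rw [Metric.mem_closedBall] at hz
    have := dist_triangle z k k₀
    simp only [ρ] at hk hz
    linarith
  have hderiv : ∀ k ∈ Metric.ball k₀ ρ, ∀ n, ‖deriv (a n) k‖ * (2 * M) ^ n ≤ C / ρ := by
    intro k hk n
    have h1 : ‖deriv (a n) k‖ ≤ C / (2 * M) ^ n / ρ := by
      refine Complex.norm_deriv_le_of_forall_mem_sphere_norm_le hρ
        (DifferentiableOn.diffContOnCl ?_) fun z hz => ?_
      · rw [closure_ball k hρ.ne']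
        exact (ha n).mono (hin k hk)
      · rw [le_div_iff₀ (by positivity)]
        exact hC z (hin k hk (Metric.sphere_subset_closedBall hz)) n
    calc _ ≤ C / (2 * M) ^ n / ρ * (2 * M) ^ n := by gcongr
      _ = C / ρ := by field_simp
  set f' : ℕ → ℂ × ℂ → (ℂ × ℂ →L[ℂ] E) := fun n p =>
    p.2 ^ n • (ContinuousLinearMap.toSpanSingleton ℂ (deriv (a n) p.1)).comp
      (ContinuousLinearMap.fst ℂ ℂ ℂ) +
    ((n * p.2 ^ (n - 1)) • ContinuousLinearMap.snd ℂ ℂ ℂ).smulRight (a n p.1)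
  have hf : ∀ n, ∀ p ∈ Metric.ball k₀ ρ ×ˢ Metric.ball (0 : ℂ) M,
      HasFDerivAt (fun p : ℂ × ℂ => p.2 ^ n • a n p.1) (f' n p) p := by
    rintro n ⟨k, g⟩ ⟨hk, -⟩
    have h1 : HasDerivAt (a n) (deriv (a n) k) k :=
      ((ha n).differentiableAt (hV.mem_nhds (hin k hk (Metric.mem_closedBall_self hρ.le)))).hasDerivAt
    have h2 : HasFDerivAt (fun p : ℂ × ℂ => a n p.1)
        ((ContinuousLinearMap.toSpanSingleton ℂ (deriv (a n) k)).comp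
          (ContinuousLinearMap.fst ℂ ℂ ℂ)) (k, g) :=
      HasFDerivAt.comp (k, g) (g := a n) h1.hasFDerivAt hasFDerivAt_fst
    have h3 : HasFDerivAt (fun p : ℂ × ℂ => p.2 ^ n)
        ((n * g ^ (n - 1)) • ContinuousLinearMap.snd ℂ ℂ ℂ) (k, g) := by
      have := (hasDerivAt_pow n g).comp_hasFDerivAt (k, g) (hasFDerivAt_snd (𝕜 := ℂ))
      exact this
    exact h3.smul h2
  have hbound : ∀ n, ∀ p ∈ Metric.ball k₀ ρ ×ˢ Metric.ball (0 : ℂ) M,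
      ‖f' n p‖ ≤ C / ρ * (1 / 2) ^ n + C * (n * (1 / 2) ^ n) := by
    rintro n ⟨k, g⟩ ⟨hk, hg⟩
    rw [mem_ball_zero_iff] at hg
    have hkV : k ∈ V := hin k hk (Metric.mem_closedBall_self hρ.le)
    refine (norm_add_le _ _).trans (add_le_add ?_ ?_)
    · rw [norm_smul, norm_pow]
      have h1 : ‖(ContinuousLinearMap.toSpanSingleton ℂ (deriv (a n) k)).comp
          (ContinuousLinearMap.fst ℂ ℂ ℂ)‖ ≤ ‖deriv (a n) k‖ := by
        refine (ContinuousLinearMap.opNorm_comp_le _ _).trans ?_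
        rw [ContinuousLinearMap.norm_toSpanSingleton]
        exact mul_le_of_le_one_right (norm_nonneg _) (ContinuousLinearMap.norm_fst_le ℂ ℂ ℂ)
      have h2 := norm_pow_smul_le hg.le (hderiv k hk n)
      rw [norm_smul, norm_pow] at h2
      exact (mul_le_mul_of_nonneg_left h1 (by positivity)).trans h2
    · rw [ContinuousLinearMap.norm_smulRight_apply, norm_smul, norm_mul, norm_pow,
        Complex.norm_natCast]
      have h2 := norm_pow_smul_le (g := (M : ℂ))
        (by rw [Complex.norm_real, Real.norm_of_nonneg hM.le]) (hC k hkV n)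
      rw [norm_smul, norm_pow, Complex.norm_real, Real.norm_of_nonneg hM.le] at h2
      calc n * ‖g‖ ^ (n - 1) * ‖ContinuousLinearMap.snd ℂ ℂ ℂ‖ * ‖a n k‖
          ≤ n * M ^ n * 1 * ‖a n k‖ := by
            gcongr
            · calc ‖g‖ ^ (n - 1) ≤ M ^ (n - 1) := by gcongr
                _ ≤ M ^ n := pow_le_pow_right₀ hM1 (Nat.sub_le _ _)
            · exact ContinuousLinearMap.norm_snd_le ℂ ℂ ℂ
        _ = n * (M ^ n * ‖a n k‖) := by ring
        _ ≤ n * (C * (1 / 2) ^ n) := by gcongr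
        _ = _ := by ring
  have hu : Summable fun n : ℕ => C / ρ * (1 / 2 : ℝ) ^ n + C * (n * (1 / 2 : ℝ) ^ n) := by
    refine (summable_const_mul_geometric_two _).add (Summable.mul_left _ ?_)
    simpa using summable_pow_mul_geometric_of_norm_lt_one 1 (r := (1 / 2 : ℝ)) (by norm_num)
  have hmem : ((k₀, g₀) : ℂ × ℂ) ∈ Metric.ball k₀ ρ ×ˢ Metric.ball (0 : ℂ) M :=
    ⟨Metric.mem_ball_self hρ, by rw [mem_ball_zero_iff]; exact lt_add_one _⟩
  have h0 : Summable fun n => ((k₀, g₀) : ℂ × ℂ).2 ^ n • a n ((k₀, g₀) : ℂ × ℂ).1 :=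
    Summable.of_norm_bounded (summable_const_mul_geometric_two C) fun n =>
      norm_pow_smul_le (lt_add_one _).le (hC k₀ hk₀ n)
  exact (hasFDerivAt_tsum_of_isPreconnected hu (Metric.isOpen_ball.prod Metric.isOpen_ball)
    ((convex_ball k₀ ρ).isPreconnected.prod (convex_ball 0 M).isPreconnected) hf hbound hmem h0
    hmem).differentiableAt.differentiableWithinAt

end Series

/-! ### The Fredholm series of a square integrable kernel -/

section FredholmSeries

/-- The modified Fredholm determinant of a square integrable kernel. -/
def hsSigma (K : L2Kernel) (g : ℂ) : ℂ := ∑' n, g ^ n • sigmaCoeff (hsRho K) n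

/-- The numerator of the modified Fredholm formula of a square integrable kernel. -/
def hsN (K : L2Kernel) (g : ℂ) : L2Kernel := ∑' n, g ^ n • hsCoeff K n

theorem sigmaCoeff_hsRho_bound {K : L2Kernel} {C r : ℝ} (hK : ‖K‖ ≤ C) (hr : 0 < r) (n : ℕ) :
    ‖sigmaCoeff (hsRho K) n‖ * r ^ n ≤ Real.exp ((r * C) ^ 2 / 2) :=
  (norm_sigmaCoeff_hsRho_le K hr n).trans (by gcongr)

theorem hsCoeff_bound {K : L2Kernel} {C r : ℝ} (hK : ‖K‖ ≤ C) (hr : 0 < r) (n : ℕ) :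
    ‖hsCoeff K n‖ * r ^ n ≤ Real.exp ((r * C + 1) ^ 2 / 2) / r := by
  have hC : 0 ≤ C := (norm_nonneg _).trans hK
  rw [le_div_iff₀ hr, mul_assoc, ← pow_succ]
  exact (norm_hsCoeff_le K hr n).trans (by gcongr)

theorem summable_hsSigma (K : L2Kernel) (g : ℂ) :
    Summable fun n => ‖g ^ n • sigmaCoeff (hsRho K) n‖ :=
  Summable.of_nonneg_of_le (fun _ => norm_nonneg _)
    (fun n => norm_pow_smul_le (M := ‖g‖ + 1) (lt_add_one _).le
      (sigmaCoeff_hsRho_bound le_rfl (by positivity) n)) (summable_const_mul_geometric_two _)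

theorem summable_hsN (K : L2Kernel) (g : ℂ) : Summable fun n => ‖g ^ n • hsCoeff K n‖ :=
  Summable.of_nonneg_of_le (fun _ => norm_nonneg _)
    (fun n => norm_pow_smul_le (M := ‖g‖ + 1) (lt_add_one _).le
      (hsCoeff_bound le_rfl (by positivity) n)) (summable_const_mul_geometric_two _)

theorem norm_tsum_pow_smul_le {E : Type*} [NormedAddCommGroup E] [NormedSpace ℂ E] {a : ℕ → E}
    {g : ℂ} {C : ℝ} (h : ∀ n, ‖a n‖ * (2 * (‖g‖ + 1)) ^ n ≤ C) : ‖∑' n, g ^ n • a n‖ ≤ C * 2 :=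
  tsum_of_norm_bounded (hasSum_geometric_two.mul_left C)
    fun n => norm_pow_smul_le (lt_add_one _).le (h n)

theorem norm_hsSigma_le {K : L2Kernel} {C : ℝ} (hK : ‖K‖ ≤ C) (g : ℂ) :
    ‖hsSigma K g‖ ≤ Real.exp ((2 * (‖g‖ + 1) * C) ^ 2 / 2) * 2 :=
  norm_tsum_pow_smul_le fun n => sigmaCoeff_hsRho_bound hK (by positivity) n

theorem norm_hsN_le {K : L2Kernel} {C : ℝ} (hK : ‖K‖ ≤ C) (g : ℂ) :
    ‖hsN K g‖ ≤ Real.exp ((2 * (‖g‖ + 1) * C + 1) ^ 2 / 2) / (2 * (‖g‖ + 1)) * 2 :=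
  norm_tsum_pow_smul_le fun n => hsCoeff_bound hK (by positivity) n

theorem continuous_hsSigma : Continuous fun p : L2Kernel × ℂ => hsSigma p.1 p.2 := by
  refine continuous_tsum_pow_smul continuous_sigmaCoeff_hsRho fun K₀ =>
    ⟨Metric.closedBall 0 (‖K₀‖ + 1), ?_, fun r hr =>
      ⟨_, fun K hK n => sigmaCoeff_hsRho_bound (mem_closedBall_zero_iff.1 hK) hr n⟩⟩
  refine mem_of_superset (Metric.isOpen_ball.mem_nhds ?_) Metric.ball_subset_closedBall
  rw [mem_ball_zero_iff]
  exact lt_add_one _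

theorem continuous_hsN : Continuous fun p : L2Kernel × ℂ => hsN p.1 p.2 := by
  refine continuous_tsum_pow_smul continuous_hsCoeff fun K₀ =>
    ⟨Metric.closedBall 0 (‖K₀‖ + 1), ?_, fun r hr =>
      ⟨_, fun K hK n => hsCoeff_bound (mem_closedBall_zero_iff.1 hK) hr n⟩⟩
  refine mem_of_superset (Metric.isOpen_ball.mem_nhds ?_) Metric.ball_subset_closedBall
  rw [mem_ball_zero_iff]
  exact lt_add_one _

theorem hsPow_zero_kernel (n : ℕ) : hsPow 0 n = 0 := by
  rcases n with _ | n
  · rfl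
  · rw [hsPow, map_zero, _root_.zero_apply]

theorem hsRho_zero_kernel : hsRho 0 = 0 := by
  ext n
  rcases n with _ | _ | n
  · rfl
  · rfl
  · rw [hsRho, map_zero]; rfl

theorem hsN_zero_kernel (g : ℂ) : hsN 0 g = 0 := by
  simp [hsN, hsCoeff, hsPow_zero_kernel]

theorem hsSigma_zero_kernel (g : ℂ) : hsSigma 0 g = 1 := by
  rw [hsSigma, tsum_eq_single 0, hsRho_zero_kernel, sigmaCoeff_zero]
  · simp
  · intro n hn
    obtain ⟨n, rfl⟩ := Nat.exists_eq_succ_of_ne_zero hn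
    have h := sigmaCoeff_succ (hsRho 0) n
    rw [hsRho_zero_kernel] at h ⊢
    simp only [Pi.zero_apply, zero_mul, Finset.sum_const_zero, neg_zero, mul_eq_zero] at h
    rcases h with h | h
    · exact absurd h (by exact_mod_cast Nat.succ_ne_zero n)
    · rw [h, smul_zero]

variable {V : Set ℂ} {L : ℂ → L2Kernel}

theorem differentiableOn_hsPow (hL : DifferentiableOn ℂ L V) (n : ℕ) :
    DifferentiableOn ℂ (fun k => hsPow (L k) n) V := by
  induction n with
  | zero => exact hL
  | succ n ih => exact (compL.differentiable.comp_differentiableOn hL).clm_apply ih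

theorem differentiableOn_hsRho (hL : DifferentiableOn ℂ L V) (n : ℕ) :
    DifferentiableOn ℂ (fun k => hsRho (L k) n) V := by
  rcases n with _ | _ | n
  · exact differentiableOn_const _
  · exact differentiableOn_const _
  · exact (traceL.differentiable.comp_differentiableOn (differentiableOn_hsPow hL n)).clm_apply hL

theorem differentiableOn_sigmaCoeff_hsRho (hL : DifferentiableOn ℂ L V) (n : ℕ) :
    DifferentiableOn ℂ (fun k => sigmaCoeff (hsRho (L k)) n) V := by
  induction n using Nat.strong_induction_on with
  | _ n ih =>
    rcases n with _ | n
    · simp only [sigmaCoeff_zero]; exact differentiableOn_const _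
    · have h : ∀ k, sigmaCoeff (hsRho (L k)) (n + 1) = ((n : ℂ) + 1)⁻¹ *
          -∑ j ∈ Finset.range n, hsRho (L k) (j + 2) * sigmaCoeff (hsRho (L k)) (n - (j + 1)) := by
        intro k
        rw [← sigmaCoeff_succ, inv_mul_cancel_left₀ (by exact_mod_cast Nat.succ_ne_zero n)]
      simp only [h]
      refine (DifferentiableOn.fun_neg (DifferentiableOn.fun_sum fun j _ => ?_)).const_mul _
      exact (differentiableOn_hsRho hL _).fun_mul (ih _ (by omega))

theorem differentiableOn_hsCoeff (hL : DifferentiableOn ℂ L V) (n : ℕ) :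
    DifferentiableOn ℂ (fun k => hsCoeff (L k) n) V :=
  DifferentiableOn.fun_sum fun j _ =>
    (differentiableOn_sigmaCoeff_hsRho hL _).fun_smul (differentiableOn_hsPow hL j)

theorem differentiableOn_hsSigma (hV : IsOpen V) (hL : DifferentiableOn ℂ L V) {C : ℝ}
    (hC : ∀ k ∈ V, ‖L k‖ ≤ C) :
    DifferentiableOn ℂ (fun p : ℂ × ℂ => hsSigma (L p.1) p.2) (V ×ˢ univ) :=
  differentiableOn_tsum_pow_smul (a := fun n k => sigmaCoeff (hsRho (L k)) n) hV
    (differentiableOn_sigmaCoeff_hsRho hL) fun _ hr =>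
      ⟨_, fun k hk n => sigmaCoeff_hsRho_bound (hC k hk) hr n⟩

theorem differentiableOn_hsN (hV : IsOpen V) (hL : DifferentiableOn ℂ L V) {C : ℝ}
    (hC : ∀ k ∈ V, ‖L k‖ ≤ C) :
    DifferentiableOn ℂ (fun p : ℂ × ℂ => hsN (L p.1) p.2) (V ×ˢ univ) :=
  differentiableOn_tsum_pow_smul (a := fun n k => hsCoeff (L k) n) hV
    (differentiableOn_hsCoeff hL) fun _ hr =>
      ⟨_, fun k hk n => hsCoeff_bound (hC k hk) hr n⟩

end FredholmSeries

/-! ### The weighted spaces -/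

section Weights

open Function

/-! ### `L²` with respect to a density that is a square -/

section Density

variable {X : Type*} [MeasurableSpace X] {m : Measure X} {s : X → ℝ}

theorem eLpNorm_withDensity_sq (hs : Measurable s) (f : X → ℂ) :
    eLpNorm f 2 (m.withDensity fun x => ENNReal.ofReal (s x ^ 2)) =
      eLpNorm (fun x => (s x : ℂ) * f x) 2 m := by
  refine (ENNReal.pow_right_strictMono two_ne_zero).injective ?_
  rw [eLpNorm_two_sq, eLpNorm_two_sq, lintegral_withDensity_eq_lintegral_mul_non_measurable _
    (by fun_prop) (ae_of_all _ fun _ => ENNReal.ofReal_lt_top)]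
  refine lintegral_congr fun x => ?_
  rw [Pi.mul_apply, enorm_mul, mul_pow, ← enorm_sq_eq_ofReal, ← ofReal_norm (s x : ℂ),
    Complex.norm_real, ofReal_norm]

theorem memLp_withDensity_sq_iff (hs : Measurable s) (hpos : ∀ᵐ x ∂m, 0 < s x) {f : X → ℂ} :
    MemLp f 2 (m.withDensity fun x => ENNReal.ofReal (s x ^ 2)) ↔
      MemLp (fun x => (s x : ℂ) * f x) 2 m := by
  rw [MemLp, MemLp, eLpNorm_withDensity_sq hs]
  refine and_congr_left fun _ => ⟨fun h => ?_, fun h => ?_⟩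
  · have hac : m ≪ m.withDensity fun x => ENNReal.ofReal (s x ^ 2) := by
      refine withDensity_absolutelyContinuous' (by fun_prop) ?_
      filter_upwards [hpos] with x hx
      simp only [ne_eq, ENNReal.ofReal_eq_zero, not_le]
      positivity
    exact (Complex.measurable_ofReal.comp hs).aestronglyMeasurable.mul (h.mono_ac hac)
  · refine AEStronglyMeasurable.mono_ac (withDensity_absolutelyContinuous _ _) ?_
    have h2 : Measurable fun x => ((s x : ℂ))⁻¹ := (Complex.measurable_ofReal.comp hs).inv
    refine (h2.aestronglyMeasurable.mul h).congr ?_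
    filter_upwards [hpos] with x hx
    have : (s x : ℂ) ≠ 0 := by exact_mod_cast hx.ne'
    simp only [Pi.mul_apply]
    rw [inv_mul_cancel_left₀ this]

end Density

variable {ε α : ℝ}

/-- The square root of `μ(R) / μ(R')`. -/
def ratioWeight (ε α : ℝ) (p : ℝ × ℝ) : ℝ :=
  √(expWeight (weight ε) α p.1) / √(expWeight (weight ε) α p.2)

theorem measurable_ratioWeight (ε α : ℝ) : Measurable (ratioWeight ε α) := by
  have := measurable_expWeight ε α
  unfold ratioWeight
  fun_prop

theorem ratioWeight_pos (ε α : ℝ) {p : ℝ × ℝ} (hp : 0 < p.1 ∧ 0 < p.2) : 0 < ratioWeight ε α p :=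
  div_pos (Real.sqrt_pos.2 (expWeight_pos ε α hp.1)) (Real.sqrt_pos.2 (expWeight_pos ε α hp.2))

theorem ae_ratioWeight_pos (ε α : ℝ) : ∀ᵐ p ∂quadrant, 0 < ratioWeight ε α p :=
  ae_quadrant_pos.mono fun _ hp => ratioWeight_pos ε α hp

theorem hsMeasure_eq (ε α : ℝ) : hsMeasure (weight ε) α =
    quadrant.withDensity fun p => ENNReal.ofReal (ratioWeight ε α p ^ 2) := by
  refine withDensity_congr_ae ?_
  filter_upwards [ae_quadrant_pos] with p hp
  rw [ratioWeight, div_pow, Real.sq_sqrt (expWeight_pos ε α hp.1).le,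
    Real.sq_sqrt (expWeight_pos ε α hp.2).le]

theorem xMeasure_eq (ε α : ℝ) : xMeasure (weight ε) α =
    halfLine.withDensity fun R => ENNReal.ofReal (√(expWeight (weight ε) α R) ^ 2) := by
  refine withDensity_congr_ae ?_
  filter_upwards [ae_halfLine_pos] with R hR
  rw [Real.sq_sqrt (expWeight_pos ε α hR).le]

theorem ae_quadrant_of_ae_hsMeasure {P : ℝ × ℝ → Prop}
    (h : ∀ᵐ p ∂(hsMeasure (weight ε) α), P p) : ∀ᵐ p ∂quadrant, P p := by
  refine Measure.AbsolutelyContinuous.ae_le (withDensity_absolutelyContinuous' ?_ ?_) h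
  · have := measurable_expWeight ε α
    fun_prop
  · filter_upwards [ae_quadrant_pos] with p hp
    have := div_pos (expWeight_pos ε α hp.1) (expWeight_pos ε α hp.2)
    simp only [ne_eq, ENNReal.ofReal_eq_zero, not_le]
    exact this

theorem ae_hsMeasure_of_ae_quadrant {P : ℝ × ℝ → Prop} (h : ∀ᵐ p ∂quadrant, P p) :
    ∀ᵐ p ∂(hsMeasure (weight ε) α), P p :=
  Measure.AbsolutelyContinuous.ae_le (withDensity_absolutelyContinuous _ _) h

/-- The kernel `K` multiplied by the square root of `μ(R) / μ(R')`. -/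
def weighted (ε α : ℝ) (K : ℝ → ℝ → ℂ) (R R' : ℝ) : ℂ := (ratioWeight ε α (R, R') : ℂ) * K R R'

theorem memLp_hsMeasure_iff {K : ℝ → ℝ → ℂ} : MemLp (uncurry K) 2 (hsMeasure (weight ε) α) ↔
    MemLp (uncurry (weighted ε α K)) 2 quadrant := by
  rw [hsMeasure_eq]
  exact memLp_withDensity_sq_iff (measurable_ratioWeight ε α) (ae_ratioWeight_pos ε α)

theorem eLpNorm_hsMeasure (f : ℝ × ℝ → ℂ) : eLpNorm f 2 (hsMeasure (weight ε) α) =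
    eLpNorm (fun p => (ratioWeight ε α p : ℂ) * f p) 2 quadrant := by
  rw [hsMeasure_eq]
  exact eLpNorm_withDensity_sq (measurable_ratioWeight ε α) f

theorem ratioWeight_mul_inv (F : ℝ × ℝ → ℂ) :
    (fun p => (ratioWeight ε α p : ℂ) * ((ratioWeight ε α p : ℂ)⁻¹ * F p)) =ᵐ[quadrant] F := by
  filter_upwards [ae_ratioWeight_pos ε α] with p hp
  exact mul_inv_cancel_left₀ (by exact_mod_cast hp.ne') _

theorem memLp_inv_ratioWeight_mul (F : L2Kernel) :
    MemLp (fun p => (ratioWeight ε α p : ℂ)⁻¹ * F p) 2 (hsMeasure (weight ε) α) := by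
  rw [hsMeasure_eq, memLp_withDensity_sq_iff (measurable_ratioWeight ε α) (ae_ratioWeight_pos ε α)]
  exact (Lp.memLp F).ae_eq (ratioWeight_mul_inv _).symm

/-- The isometry from plain square integrable kernels to Hilbert-Schmidt kernels on the weighted
space. -/
def unweightL (ε α : ℝ) : L2Kernel →ₗᵢ[ℂ] HSKernel (weight ε) α where
  toFun F := (memLp_inv_ratioWeight_mul F).toLp _
  map_add' F G := by
    rw [← MemLp.toLp_add, MemLp.toLp_eq_toLp_iff]
    refine ae_hsMeasure_of_ae_quadrant ?_
    filter_upwards [Lp.coeFn_add F G] with p hp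
    simp only [hp, Pi.add_apply, mul_add]
  map_smul' c F := by
    rw [RingHom.id_apply, ← MemLp.toLp_const_smul, MemLp.toLp_eq_toLp_iff]
    refine ae_hsMeasure_of_ae_quadrant ?_
    filter_upwards [Lp.coeFn_smul c F] with p hp
    simp only [hp, Pi.smul_apply, smul_eq_mul]
    ring
  norm_map' F := by
    change ‖(memLp_inv_ratioWeight_mul F).toLp _‖ = _
    rw [Lp.norm_toLp, eLpNorm_hsMeasure, eLpNorm_congr_ae (ratioWeight_mul_inv _), Lp.norm_def]

theorem unweightL_toL2 {K : ℝ → ℝ → ℂ} (hK : MemLp (uncurry (weighted ε α K)) 2 quadrant) :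
    unweightL ε α (hK.toLp _) = toHS (weight ε) α K := by
  rw [toHS, dif_pos (memLp_hsMeasure_iff.2 hK)]
  change (memLp_inv_ratioWeight_mul (hK.toLp _)).toLp _ = _
  rw [MemLp.toLp_eq_toLp_iff]
  refine ae_hsMeasure_of_ae_quadrant ?_
  filter_upwards [hK.coeFn_toLp, ae_ratioWeight_pos ε α] with p hp hpos
  rw [hp]
  exact inv_mul_cancel_left₀ (by exact_mod_cast hpos.ne') _

/-- The weights at the intermediate variable cancel: `weighted` is conjugation by `√μ`, hence
multiplicative. -/
theorem kernelComp_weighted (ε α : ℝ) (K K' : ℝ → ℝ → ℂ) :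
    kernelComp (weighted ε α K) (weighted ε α K') = weighted ε α (kernelComp K K') := by
  ext R R'
  rw [kernelComp, weighted, kernelComp, ← integral_const_mul]
  refine integral_congr_ae ?_
  filter_upwards [ae_halfLine_pos] with y hy
  have : (√(expWeight (weight ε) α y) : ℂ) ≠ 0 := by
    exact_mod_cast (Real.sqrt_pos.2 (expWeight_pos ε α hy)).ne'
  simp only [weighted, ratioWeight]
  push_cast
  field_simp

theorem kernelPow_weighted (ε α : ℝ) (K : ℝ → ℝ → ℂ) (n : ℕ) :
    kernelPow (weighted ε α K) n = weighted ε α (kernelPow K n) := by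
  induction n with
  | zero => rfl
  | succ n ih => rw [kernelPow, ih, kernelComp_weighted]; rfl

theorem ratioWeight_mul_swap {p : ℝ × ℝ} (hp : 0 < p.1 ∧ 0 < p.2) :
    (ratioWeight ε α (p.1, p.2) : ℂ) * ratioWeight ε α (p.2, p.1) = 1 := by
  have h1 : (√(expWeight (weight ε) α p.1) : ℂ) ≠ 0 := by
    exact_mod_cast (Real.sqrt_pos.2 (expWeight_pos ε α hp.1)).ne'
  have h2 : (√(expWeight (weight ε) α p.2) : ℂ) ≠ 0 := by
    exact_mod_cast (Real.sqrt_pos.2 (expWeight_pos ε α hp.2)).ne'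
  simp only [ratioWeight]
  push_cast
  field_simp

theorem weighted_trace_integrand (ε α : ℝ) (K K' : ℝ → ℝ → ℂ) :
    (fun p : ℝ × ℝ => weighted ε α K p.1 p.2 * weighted ε α K' p.2 p.1) =ᵐ[quadrant]
      fun p => K p.1 p.2 * K' p.2 p.1 := by
  filter_upwards [ae_quadrant_pos] with p hp
  simp only [weighted]
  calc _ = ((ratioWeight ε α (p.1, p.2) : ℂ) * ratioWeight ε α (p.2, p.1)) *
        (K p.1 p.2 * K' p.2 p.1) := by ring
    _ = _ := by rw [ratioWeight_mul_swap hp, one_mul]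

/-- Traces are invariant under conjugation, so `σ_ℓ` may be computed from the weighted kernel. -/
theorem rho_weighted (ε α : ℝ) (K : ℝ → ℝ → ℂ) : rho (weighted ε α K) = rho K := by
  ext n
  rcases n with _ | _ | n
  · rfl
  · rfl
  · rw [rho, kernelPow_weighted]
    exact integral_congr_ae (weighted_trace_integrand ε α _ _)

theorem nCoeff_weighted (ε α : ℝ) (K : ℝ → ℝ → ℂ) (n : ℕ) :
    nCoeff (weighted ε α K) n = weighted ε α (nCoeff K n) := by
  ext R R'
  simp only [nCoeff, weighted, rho_weighted, kernelPow_weighted, Finset.mul_sum]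
  exact Finset.sum_congr rfl fun j _ => by ring

theorem kernel_apply_estimate {f : ℝ × ℝ → ℂ} {x : ℝ → ℂ} (hf : MemLp f 2 quadrant)
    (hx : MemLp x 2 halfLine) :
    (∀ᵐ R ∂halfLine, Integrable (fun y => f (R, y) * x y) halfLine) ∧
      MemLp (fun R => ∫ y, f (R, y) * x y ∂halfLine) 2 halfLine ∧
      eLpNorm (fun R => ∫ y, f (R, y) * x y ∂halfLine) 2 halfLine ≤
        eLpNorm f 2 quadrant * eLpNorm x 2 halfLine := by
  set a : ℝ → ℝ≥0∞ := fun R => ∫⁻ y, ‖f (R, y)‖ₑ ^ 2 ∂halfLine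
  have hm : AEMeasurable (fun p => ‖f p‖ₑ ^ 2) quadrant := hf.1.enorm.pow_const 2
  have ha : AEMeasurable a halfLine := hm.lintegral_prod_right'
  have hA : ∫⁻ R, a R ∂halfLine = eLpNorm f 2 quadrant ^ 2 := by
    rw [eLpNorm_two_sq, lintegral_prod _ hm]
  have hfin : ∀ᵐ R ∂halfLine, a R < ∞ := by
    refine ae_lt_top' ha ?_
    rw [hA]
    exact (ENNReal.pow_lt_top hf.2).ne
  have hsec : ∀ᵐ R ∂halfLine, AEStronglyMeasurable (fun y => f (R, y)) halfLine := hf.1.prodMk_left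
  have hcs : ∀ᵐ R ∂halfLine, (∫⁻ y, ‖f (R, y) * x y‖ₑ ∂halfLine) ^ 2 ≤
      a R * eLpNorm x 2 halfLine ^ 2 := by
    filter_upwards [hsec] with R hR
    simp only [enorm_mul]
    rw [eLpNorm_two_sq]
    exact lintegral_mul_sq_le hR.enorm hx.1.enorm
  have hle : eLpNorm (fun R => ∫ y, f (R, y) * x y ∂halfLine) 2 halfLine ≤
      eLpNorm f 2 quadrant * eLpNorm x 2 halfLine := by
    refine (ENNReal.pow_le_pow_left_iff two_ne_zero).1 ?_
    rw [eLpNorm_two_sq, mul_pow, ← hA, ← lintegral_mul_const'' _ ha]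
    refine lintegral_mono_ae ?_
    filter_upwards [hcs] with R hR
    exact (pow_le_pow_left₀ bot_le (enorm_integral_le_lintegral_enorm _) 2).trans hR
  refine ⟨?_, ⟨?_, hle.trans_lt (ENNReal.mul_lt_top hf.2 hx.2)⟩, hle⟩
  · filter_upwards [hcs, hfin, hsec] with R h1 h2 h3
    refine ⟨h3.mul hx.1, ?_⟩
    exact (ENNReal.pow_lt_top_iff.1 (h1.trans_lt
      (ENNReal.mul_lt_top h2 (ENNReal.pow_lt_top hx.2)))).resolve_right (by norm_num)
  · exact AEStronglyMeasurable.integral_prod_right' (f := fun p : ℝ × ℝ => f p * x p.2)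
      (hf.1.mul hx.1.comp_snd)

/-- Multiplication by `√μ` carries `X` to `L²(0,∞)` isometrically and `K` to a plain square
integrable kernel, for which Cauchy–Schwarz suffices. -/
theorem actsOnX (K : HSKernel (weight ε) α) : ActsOnX (weight ε) α K := by
  intro x hx
  have hs : Measurable fun R => √(expWeight (weight ε) α R) := (measurable_expWeight ε α).sqrt
  have hpos : ∀ᵐ R ∂halfLine, 0 < √(expWeight (weight ε) α R) :=
    ae_halfLine_pos.mono fun R hR => Real.sqrt_pos.2 (expWeight_pos ε α hR)
  set x' : ℝ → ℂ := fun R => (√(expWeight (weight ε) α R) : ℂ) * x R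
  set f : ℝ × ℝ → ℂ := fun p => (ratioWeight ε α p : ℂ) * K p
  have hf : MemLp f 2 quadrant := memLp_hsMeasure_iff (K := Function.curry K) |>.1 (Lp.memLp K)
  rw [xMeasure_eq] at hx ⊢
  obtain ⟨h1, h2, h3⟩ := kernel_apply_estimate hf ((memLp_withDensity_sq_iff hs hpos).1 hx)
  have hint : ∀ R, (fun y => f (R, y) * x' y) =ᵐ[halfLine]
      fun y => (√(expWeight (weight ε) α R) : ℂ) * (K (R, y) * x y) := by
    intro R
    filter_upwards [hpos] with y hy
    have : (√(expWeight (weight ε) α y) : ℂ) ≠ 0 := by exact_mod_cast hy.ne'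
    simp only [f, x', ratioWeight]
    push_cast
    field_simp
  have hT : (fun R => ∫ y, f (R, y) * x' y ∂halfLine) =
      fun R => (√(expWeight (weight ε) α R) : ℂ) * ∫ y, K (R, y) * x y ∂halfLine := by
    ext R
    rw [integral_congr_ae (hint R), integral_const_mul]
  refine ⟨?_, (memLp_withDensity_sq_iff hs hpos).2 ?_, ?_⟩
  · filter_upwards [h1, hpos] with R h hR
    have hR' : (√(expWeight (weight ε) α R) : ℂ) ≠ 0 := by exact_mod_cast hR.ne'
    refine ((h.congr (hint R)).const_mul (√(expWeight (weight ε) α R) : ℂ)⁻¹).congr ?_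
    exact ae_of_all _ fun y => inv_mul_cancel_left₀ hR' _
  · rw [← hT]
    exact h2
  · rw [eLpNorm_withDensity_sq hs, eLpNorm_withDensity_sq hs, ← hT, Lp.enorm_def,
      eLpNorm_hsMeasure]
    exact h3

end Weights

/-! ### The Lippmann-Schwinger kernels as square integrable kernels -/

section LippmannSchwinger

open Function

variable {ε α : ℝ} {U : ℝ → ℝ → ℝ → ℝ}

/-- Inserting `√μ(y) / √μ(y)` at the intermediate radius splits the kernel into two square
integrable factors; the dependence on `k` sits in the second one only. -/
theorem weighted_lsKernel (ε α : ℝ) (U : ℝ → ℝ → ℝ → ℝ) (ℓ : ℕ) (k : ℂ) :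
    weighted ε α (lsKernel U ℓ k) =
      kernelComp (wPotential ε α U ℓ) (wGreen ε α ℓ (planeExp k)) := by
  ext R R'
  rw [kernelComp, weighted, lsKernel, ← integral_const_mul]
  refine integral_congr_ae ?_
  filter_upwards [ae_halfLine_pos] with y hy
  have : (√(expWeight (weight ε) α y) : ℂ) ≠ 0 := by
    exact_mod_cast (Real.sqrt_pos.2 (expWeight_pos ε α hy)).ne'
  have hg : greenOf ℓ (planeExp k) = green ℓ k := rfl
  simp only [wPotential, wGreen, ratioWeight, hg]
  push_cast
  field_simp

/-- The weighted Lippmann-Schwinger kernel as an element of `L2Kernel`. -/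
def lsL (ε α : ℝ) (U : ℝ → ℝ → ℝ → ℝ) (ℓ : ℕ) (k : ℂ) : L2Kernel :=
  compL (toL2 (wPotential ε α U ℓ)) (greenL2 ε α ℓ k)

theorem memLp_weighted_lsKernel (hε : 0 < ε) (hα : 0 < α)
    (hU : MemPotentialClass (weight ε) α U) (ℓ : ℕ) {k : ℂ} (hk : k ∈ closedHalfPlane α) :
    MemLp (uncurry (weighted ε α (lsKernel U ℓ k))) 2 quadrant := by
  rw [weighted_lsKernel]
  exact kernelComp_memLp ((exists_wPotential_bound hU).1 ℓ) (memLp_wGreen_planeExp hε hα ℓ hk)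

theorem lsL_eq (hε : 0 < ε) (hα : 0 < α)
    (hU : MemPotentialClass (weight ε) α U) (ℓ : ℕ) {k : ℂ} (hk : k ∈ closedHalfPlane α) :
    lsL ε α U ℓ k = (memLp_weighted_lsKernel hε hα hU ℓ hk).toLp _ := by
  rw [lsL, greenL2, toL2_eq ((exists_wPotential_bound hU).1 ℓ),
    toL2_eq (memLp_wGreen_planeExp hε hα ℓ hk), compL_toLp, MemLp.toLp_eq_toLp_iff,
    weighted_lsKernel]

theorem exists_norm_lsL_le (hε : 0 < ε) (hα : 0 < α)
    (hU : MemPotentialClass (weight ε) α U) :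
    ∃ C : ℝ, ∀ ℓ : ℕ, ∀ k ∈ closedHalfPlane α, ‖lsL ε α U ℓ k‖ ≤ C := by
  obtain ⟨-, ⟨C, hC0, hC⟩, -⟩ := exists_wPotential_bound hU
  refine ⟨C * (eLpNorm (greenBound ε) 2 quadrant).toReal, fun ℓ k hk => ?_⟩
  refine (norm_compL_le _ _).trans ?_
  gcongr
  · exact hC ℓ
  · exact norm_greenL2_le hε hα ℓ hk

theorem tendsto_lsL_highFilter (hε : 0 < ε) (hα : 0 < α)
    (hU : MemPotentialClass (weight ε) α U) :
    Tendsto (fun q : ℕ × ℂ => lsL ε α U q.1 q.2) (highFilter α) (𝓝 0) := by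
  obtain ⟨-, ⟨C, hC0, hC⟩, -⟩ := exists_wPotential_bound hU
  have h := (tendsto_zero_iff_norm_tendsto_zero.1
    (tendsto_greenL2_highFilter hε hα)).const_mul C
  rw [mul_zero] at h
  refine squeeze_zero_norm (fun q => (norm_compL_le _ _).trans ?_) h
  gcongr
  exact hC q.1

theorem rho_lsKernel (hε : 0 < ε) (hα : 0 < α)
    (hU : MemPotentialClass (weight ε) α U) (ℓ : ℕ) {k : ℂ} (hk : k ∈ closedHalfPlane α) :
    rho (lsKernel U ℓ k) = hsRho (lsL ε α U ℓ k) := by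
  rw [lsL_eq hε hα hU ℓ hk, hsRho_toLp, rho_weighted]

theorem memLp_weighted_nCoeff (hε : 0 < ε) (hα : 0 < α)
    (hU : MemPotentialClass (weight ε) α U) (ℓ : ℕ) {k : ℂ} (hk : k ∈ closedHalfPlane α) (n : ℕ) :
    MemLp (uncurry (weighted ε α (nCoeff (lsKernel U ℓ k) n))) 2 quadrant := by
  rw [← nCoeff_weighted]
  exact nCoeff_memLp (memLp_weighted_lsKernel hε hα hU ℓ hk) n

theorem toHS_nCoeff (hε : 0 < ε) (hα : 0 < α)
    (hU : MemPotentialClass (weight ε) α U) (ℓ : ℕ) {k : ℂ} (hk : k ∈ closedHalfPlane α) (n : ℕ) :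
    toHS (weight ε) α (nCoeff (lsKernel U ℓ k) n) = unweightL ε α (hsCoeff (lsL ε α U ℓ k) n) := by
  rw [← unweightL_toL2 (memLp_weighted_nCoeff hε hα hU ℓ hk n), lsL_eq hε hα hU ℓ hk, hsCoeff_toLp]
  congr 1
  rw [MemLp.toLp_eq_toLp_iff, nCoeff_weighted]

theorem sigma_eq (hε : 0 < ε) (hα : 0 < α)
    (hU : MemPotentialClass (weight ε) α U) (ℓ : ℕ) {k : ℂ} (hk : k ∈ closedHalfPlane α) (g : ℂ) :
    sigma U ℓ k g = hsSigma (lsL ε α U ℓ k) g := by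
  rw [sigma, hsSigma, rho_lsKernel hε hα hU ℓ hk]
  exact tsum_congr fun n => mul_comm _ _

theorem smithiesN_eq (hε : 0 < ε) (hα : 0 < α)
    (hU : MemPotentialClass (weight ε) α U) (ℓ : ℕ) {k : ℂ} (hk : k ∈ closedHalfPlane α) (g : ℂ) :
    smithiesN (weight ε) α U ℓ k g = unweightL ε α (hsN (lsL ε α U ℓ k) g) := by
  have h := (unweightL ε α).toContinuousLinearMap.map_tsum (summable_hsN (lsL ε α U ℓ k) g).of_norm
  refine Eq.trans (tsum_congr fun n => ?_) h.symm
  rw [toHS_nCoeff hε hα hU ℓ hk]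
  exact ((unweightL ε α).map_smul _ _).symm

theorem smithiesWellDefined (hε : 0 < ε) (hα : 0 < α)
    (hU : MemPotentialClass (weight ε) α U) (ℓ : ℕ) {k : ℂ} (hk : k ∈ closedHalfPlane α) :
    SmithiesWellDefined (weight ε) α U ℓ k := by
  have hK := memLp_weighted_lsKernel hε hα hU ℓ hk
  -- The weighted and unweighted integrands differ by the factor `ratioWeight ε α p`, constant in
  -- `y` and nonzero.
  have hsplit : ∀ {F H : ℝ → ℝ → ℂ}, (∀ᵐ p ∂quadrant, Integrable
      (fun y => weighted ε α F p.1 y * weighted ε α H y p.2) halfLine) →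
      ∀ᵐ p ∂quadrant, Integrable (fun y => F p.1 y * H y p.2) halfLine := by
    intro F H h
    filter_upwards [h, ae_ratioWeight_pos ε α] with p h hp
    have hp' : (ratioWeight ε α p : ℂ) ≠ 0 := by exact_mod_cast hp.ne'
    refine (h.const_mul (ratioWeight ε α p : ℂ)⁻¹).congr ?_
    filter_upwards [ae_halfLine_pos] with y hy
    have hy' : (√(expWeight (weight ε) α y) : ℂ) ≠ 0 := by
      exact_mod_cast (Real.sqrt_pos.2 (expWeight_pos ε α hy)).ne'
    have : weighted ε α F p.1 y * weighted ε α H y p.2 =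
        (ratioWeight ε α p : ℂ) * (F p.1 y * H y p.2) := by
      simp only [weighted, ratioWeight]
      push_cast
      field_simp
    rw [this, inv_mul_cancel_left₀ hp']
  refine ⟨(exists_wPotential_bound hU).2.2 ℓ, fun R R' hR hR' => ?_, ?_, fun n => ?_, fun n => ?_,
    fun n => ?_, fun n => ?_, fun g => ?_, fun g => ?_⟩
  · exact greenOf_intervalIntegrable ℓ (continuous_planeExp k) hR hR'
  · have h := (kernelComp_estimate ((exists_wPotential_bound hU).1 ℓ)
      (memLp_wGreen_planeExp hε hα ℓ hk)).1
    filter_upwards [h, ae_ratioWeight_pos ε α] with p h hp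
    have hp' : (ratioWeight ε α p : ℂ) ≠ 0 := by exact_mod_cast hp.ne'
    refine (h.const_mul (ratioWeight ε α p : ℂ)⁻¹).congr ?_
    filter_upwards [ae_halfLine_pos] with y hy
    have hy' : (√(expWeight (weight ε) α y) : ℂ) ≠ 0 := by
      exact_mod_cast (Real.sqrt_pos.2 (expWeight_pos ε α hy)).ne'
    have hg : greenOf ℓ (planeExp k) = green ℓ k := rfl
    have : wPotential ε α U ℓ p.1 y * wGreen ε α ℓ (planeExp k) y p.2 =
        (ratioWeight ε α p : ℂ) * ((partialPotential U ℓ p.1 y : ℂ) * green ℓ k y p.2) := by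
      simp only [wPotential, wGreen, ratioWeight, hg]
      push_cast
      field_simp
    rw [this, inv_mul_cancel_left₀ hp']
  · refine hsplit ?_
    rw [← kernelPow_weighted]
    exact (kernelComp_estimate hK (kernelPow_memLp hK n)).1
  · rw [memLp_hsMeasure_iff, ← kernelPow_weighted]
    exact kernelPow_memLp hK n
  · refine (traceProd_integrable (kernelPow_memLp hK n) hK).congr ?_
    rw [kernelPow_weighted]
    exact weighted_trace_integrand ε α _ _
  · exact memLp_hsMeasure_iff.2 (memLp_weighted_nCoeff hε hα hU ℓ hk n)
  · rw [rho_lsKernel hε hα hU ℓ hk]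
    exact (summable_hsSigma (lsL ε α U ℓ k) g).congr fun n => by rw [smul_eq_mul, mul_comm]
  · refine (summable_hsN (lsL ε α U ℓ k) g).congr fun n => ?_
    rw [toHS_nCoeff hε hα hU ℓ hk, norm_smul, norm_smul, LinearIsometry.norm_map]

theorem continuousOn_lsL (hε : 0 < ε) (hα : 0 < α) (ℓ : ℕ) : ContinuousOn (lsL ε α U ℓ) (closedHalfPlane α) :=
  (compL (toL2 (wPotential ε α U ℓ))).continuous.comp_continuousOn (continuousOn_greenL2 hε hα ℓ)

theorem differentiableOn_lsL (hε : 0 < ε) (hα : 0 < α) (ℓ : ℕ) : DifferentiableOn ℂ (lsL ε α U ℓ) (halfPlane α) :=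
  (compL (toL2 (wPotential ε α U ℓ))).differentiable.comp_differentiableOn
    (differentiableOn_greenL2 hε hα ℓ)

end LippmannSchwinger

/-! ### Complex conjugation -/

section Conjugation

open Function

theorem kernelComp_conj (K K' : ℝ → ℝ → ℂ) :
    kernelComp (fun x y => conj (K x y)) (fun x y => conj (K' x y)) =
      fun x y => conj (kernelComp K K' x y) := by
  ext x y
  simp only [kernelComp, ← integral_conj, map_mul]

theorem kernelPow_conj (K : ℝ → ℝ → ℂ) (n : ℕ) :
    kernelPow (fun x y => conj (K x y)) n = fun x y => conj (kernelPow K n x y) := by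
  induction n with
  | zero => rfl
  | succ n ih => rw [kernelPow, ih, kernelComp_conj]; rfl

theorem rho_conj (K : ℝ → ℝ → ℂ) (n : ℕ) : rho (fun x y => conj (K x y)) n = conj (rho K n) := by
  rcases n with _ | _ | n
  · exact (map_zero _).symm
  · exact (map_zero _).symm
  · rw [rho, kernelPow_conj, rho]
    simp only [traceProd, ← integral_conj, map_mul]

theorem sigmaCoeff_conj {ρ ρ' : ℕ → ℂ} (h : ∀ n, ρ' n = conj (ρ n)) (n : ℕ) :
    sigmaCoeff ρ' n = conj (sigmaCoeff ρ n) := by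
  induction n using Nat.strong_induction_on with
  | _ n ih =>
    rcases n with _ | n
    · simp only [sigmaCoeff_zero, map_one]
    · have hn : (n : ℂ) + 1 ≠ 0 := by exact_mod_cast Nat.succ_ne_zero n
      refine mul_left_cancel₀ hn ?_
      have h1 := congrArg conj (sigmaCoeff_succ ρ n)
      rw [map_mul, map_add, map_one, Complex.conj_natCast, map_neg, map_sum] at h1
      rw [h1, sigmaCoeff_succ]
      congr 1
      refine Finset.sum_congr rfl fun j _ => ?_
      rw [map_mul, h, ih _ (by omega)]

theorem nCoeff_conj (K : ℝ → ℝ → ℂ) (n : ℕ) :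
    nCoeff (fun x y => conj (K x y)) n = fun x y => conj (nCoeff K n x y) := by
  ext x y
  simp only [nCoeff_eq, map_sum, map_mul, kernelPow_conj, sigmaCoeff_conj (rho_conj K)]

/-- Because `i(-k̄)` is the conjugate of `ik`, while the distance `u` and `P_ℓ` are real. -/
theorem green_neg_conj (ℓ : ℕ) (k : ℂ) (R R' : ℝ) :
    green ℓ (-conj k) R R' = conj (green ℓ k R R') := by
  have hexp : ∀ u : ℝ, Complex.exp (Complex.I * -conj k * u) =
      conj (Complex.exp (Complex.I * k * u)) := by
    intro u
    rw [← Complex.exp_conj]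
    simp
  simp only [green, freeGreen, hexp, intervalIntegral.integral_of_le (show (-1 : ℝ) ≤ 1 by norm_num)]
  simp only [map_mul, map_neg, Complex.conj_ofReal, ← integral_conj, map_div₀, Complex.conj_ofNat]

theorem lsKernel_neg_conj (U : ℝ → ℝ → ℝ → ℝ) (ℓ : ℕ) (k : ℂ) :
    lsKernel U ℓ (-conj k) = fun x y => conj (lsKernel U ℓ k x y) := by
  ext x y
  simp only [lsKernel, green_neg_conj, ← integral_conj, map_mul, Complex.conj_ofReal]

theorem sigma_conj (U : ℝ → ℝ → ℝ → ℝ) (ℓ : ℕ) (k g : ℂ) :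
    conj (sigma U ℓ k g) = sigma U ℓ (-conj k) (conj g) := by
  rw [sigma, sigma, lsKernel_neg_conj, Complex.conj_tsum]
  refine tsum_congr fun n => ?_
  rw [map_mul, map_pow, sigmaCoeff_conj (rho_conj _)]

/-- Complex conjugation of Hilbert-Schmidt kernels. -/
def conjHS (w : ℝ → ℝ) (α : ℝ) : HSKernel w α →L[ℝ] HSKernel w α :=
  (Complex.conjCLE : ℂ →L[ℝ] ℂ).compLpL 2 (hsMeasure w α)

theorem coeFn_conjHS {w : ℝ → ℝ} {α : ℝ} (F : HSKernel w α) :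
    conjHS w α F =ᵐ[hsMeasure w α] fun p => conj (F p) :=
  ContinuousLinearMap.coeFn_compLpL _ F

theorem conjHS_smul_toHS {w : ℝ → ℝ} {α : ℝ} {f : ℝ → ℝ → ℂ}
    (hf : MemLp (uncurry f) 2 (hsMeasure w α)) (c : ℂ) :
    conjHS w α (c • toHS w α f) = conj c • toHS w α (fun x y => conj (f x y)) := by
  have hf' : MemLp (uncurry fun x y => conj (f x y)) 2 (hsMeasure w α) := hf.star
  rw [toHS, toHS, dif_pos hf, dif_pos hf', Lp.ext_iff]
  filter_upwards [coeFn_conjHS (c • hf.toLp (uncurry f)), Lp.coeFn_smul c (hf.toLp (uncurry f)),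
    Lp.coeFn_smul (conj c) (hf'.toLp _), hf.coeFn_toLp, hf'.coeFn_toLp] with p h1 h2 h3 h4 h5
  rw [h1, h2, h3, Pi.smul_apply, Pi.smul_apply, h4, h5, smul_eq_mul, smul_eq_mul, map_mul]
  rfl

theorem conjHS_smithiesN {ε α : ℝ} {U : ℝ → ℝ → ℝ → ℝ} {ℓ : ℕ} {k : ℂ}
    (h : SmithiesWellDefined (weight ε) α U ℓ k) (g : ℂ) :
    conjHS (weight ε) α (smithiesN (weight ε) α U ℓ k g) =
      smithiesN (weight ε) α U ℓ (-conj k) (conj g) := by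
  rw [smithiesN, smithiesN, ContinuousLinearMap.map_tsum _ (h.summable_smithiesN g).of_norm,
    lsKernel_neg_conj]
  refine tsum_congr fun n => ?_
  rw [conjHS_smul_toHS (h.nCoeff_memLp n), map_pow, nCoeff_conj]

theorem smithiesN_conj_ae {ε α : ℝ} {U : ℝ → ℝ → ℝ → ℝ} {ℓ : ℕ} {k : ℂ}
    (h : SmithiesWellDefined (weight ε) α U ℓ k) (g : ℂ) :
    ∀ᵐ p ∂quadrant, conj (smithiesN (weight ε) α U ℓ k g p) =
      smithiesN (weight ε) α U ℓ (-conj k) (conj g) p := by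
  rw [← conjHS_smithiesN h g]
  exact ae_quadrant_of_ae_hsMeasure ((coeFn_conjHS _).mono fun p hp => hp.symm)

end Conjugation

/-! ### Bounds, regularity and limits of `σ_ℓ` and `N_ℓ` on the half-planes -/

theorem tendsto_iSup_of_highFilter {α : ℝ} {f : ℕ → ℂ → ℝ≥0∞}
    (h : Tendsto (fun q : ℕ × ℂ => f q.1 q.2) (highFilter α) (𝓝 0)) :
    Tendsto (fun r : ℝ => ⨆ (ℓ : ℕ) (k : ℂ) (_ : k ∈ closedHalfPlane α)
      (_ : r ≤ max ‖k‖ (ℓ : ℝ)), f ℓ k) atTop (𝓝 0) := by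
  rw [ENNReal.tendsto_nhds_zero] at h ⊢
  intro η hη
  obtain ⟨r₀, hr₀⟩ := eventually_highFilter.1 (h η hη)
  filter_upwards [eventually_ge_atTop r₀] with r hr
  exact iSup_le fun ℓ => iSup_le fun k => iSup_le fun hk => iSup_le fun hle =>
    hr₀ ℓ k hk (hr.trans hle)

theorem eventually_highFilter_mem (α : ℝ) : ∀ᶠ q in highFilter α, q.2 ∈ closedHalfPlane α :=
  mem_inf_of_right (mem_principal_self _)

section Properties

variable {ε α : ℝ} {U : ℝ → ℝ → ℝ → ℝ}

theorem exists_sigma_bound (hε : 0 < ε) (hα : 0 < α) (hU : MemPotentialClass (weight ε) α U)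
    (ℓ : ℕ) : ∃ Φ : ℝ → ℝ, ∀ k ∈ closedHalfPlane α, ∀ g : ℂ, ‖sigma U ℓ k g‖ ≤ Φ ‖g‖ := by
  obtain ⟨C, hC⟩ := exists_norm_lsL_le hε hα hU
  refine ⟨fun r => Real.exp ((2 * (r + 1) * C) ^ 2 / 2) * 2, fun k hk g => ?_⟩
  rw [sigma_eq hε hα hU ℓ hk]
  exact norm_hsSigma_le (hC ℓ k hk) g

theorem exists_smithiesN_bound (hε : 0 < ε) (hα : 0 < α)
    (hU : MemPotentialClass (weight ε) α U) (ℓ : ℕ) :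
    ∃ Ψ : ℝ → ℝ, ∀ k ∈ closedHalfPlane α, ∀ g : ℂ,
      ‖smithiesN (weight ε) α U ℓ k g‖ ≤ Ψ ‖g‖ := by
  obtain ⟨C, hC⟩ := exists_norm_lsL_le hε hα hU
  refine ⟨fun r => Real.exp ((2 * (r + 1) * C + 1) ^ 2 / 2) / (2 * (r + 1)) * 2,
    fun k hk g => ?_⟩
  rw [smithiesN_eq hε hα hU ℓ hk, LinearIsometry.norm_map]
  exact norm_hsN_le (hC ℓ k hk) g

theorem continuousOn_lsL_prod (hε : 0 < ε) (hα : 0 < α) (U : ℝ → ℝ → ℝ → ℝ) (ℓ : ℕ) :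
    ContinuousOn (fun p : ℂ × ℂ => (lsL ε α U ℓ p.1, p.2)) (closedHalfPlane α ×ˢ univ) :=
  ((continuousOn_lsL hε hα ℓ).comp continuousOn_fst fun _ hp => hp.1).prodMk continuousOn_snd

theorem continuousOn_sigma (hε : 0 < ε) (hα : 0 < α) (hU : MemPotentialClass (weight ε) α U)
    (ℓ : ℕ) : ContinuousOn (fun p : ℂ × ℂ => sigma U ℓ p.1 p.2) (closedHalfPlane α ×ˢ univ) :=
  (continuous_hsSigma.comp_continuousOn (continuousOn_lsL_prod hε hα U ℓ)).congr
    fun p hp => sigma_eq hε hα hU ℓ hp.1 p.2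

theorem continuousOn_smithiesN (hε : 0 < ε) (hα : 0 < α)
    (hU : MemPotentialClass (weight ε) α U) (ℓ : ℕ) :
    ContinuousOn (fun p : ℂ × ℂ => smithiesN (weight ε) α U ℓ p.1 p.2)
      (closedHalfPlane α ×ˢ univ) :=
  ((unweightL ε α).continuous.comp_continuousOn
    (continuous_hsN.comp_continuousOn (continuousOn_lsL_prod hε hα U ℓ))).congr
    fun p hp => smithiesN_eq hε hα hU ℓ hp.1 p.2

theorem differentiableOn_sigma (hε : 0 < ε) (hα : 0 < α)
    (hU : MemPotentialClass (weight ε) α U) (ℓ : ℕ) :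
    DifferentiableOn ℂ (fun p : ℂ × ℂ => sigma U ℓ p.1 p.2) (halfPlane α ×ˢ univ) := by
  obtain ⟨C, hC⟩ := exists_norm_lsL_le hε hα hU
  exact (differentiableOn_hsSigma (isOpen_halfPlane α) (differentiableOn_lsL hε hα ℓ)
    fun k hk => hC ℓ k (halfPlane_subset α hk)).congr
    fun p hp => sigma_eq hε hα hU ℓ (halfPlane_subset α hp.1) p.2

theorem differentiableOn_smithiesN (hε : 0 < ε) (hα : 0 < α)
    (hU : MemPotentialClass (weight ε) α U) (ℓ : ℕ) :
    DifferentiableOn ℂ (fun p : ℂ × ℂ => smithiesN (weight ε) α U ℓ p.1 p.2)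
      (halfPlane α ×ˢ univ) := by
  obtain ⟨C, hC⟩ := exists_norm_lsL_le hε hα hU
  exact ((unweightL ε α).toContinuousLinearMap.differentiable.comp_differentiableOn
    (differentiableOn_hsN (isOpen_halfPlane α) (differentiableOn_lsL hε hα ℓ)
      fun k hk => hC ℓ k (halfPlane_subset α hk))).congr
    fun p hp => smithiesN_eq hε hα hU ℓ (halfPlane_subset α hp.1) p.2

/-- For fixed `g`, `hsSigma` is continuous in the kernel with value `1` at zero, and `lsL` tends to
zero along the filter. The limit for `N` follows in the same way. -/
theorem tendsto_sigma_highFilter (hε : 0 < ε) (hα : 0 < α)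
    (hU : MemPotentialClass (weight ε) α U) (g : ℂ) :
    Tendsto (fun q : ℕ × ℂ => ‖sigma U q.1 q.2 g - 1‖ₑ) (highFilter α) (𝓝 0) := by
  have h : Continuous fun K : L2Kernel => ‖hsSigma K g - 1‖ₑ :=
    ((continuous_hsSigma.comp (by fun_prop : Continuous fun K : L2Kernel => (K, g))).sub
      continuous_const).enorm
  refine ((h.tendsto' 0 0 ?_).comp (tendsto_lsL_highFilter hε hα hU)).congr' ?_
  · rw [hsSigma_zero_kernel, sub_self, enorm_zero]
  · filter_upwards [eventually_highFilter_mem α] with q hq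
    rw [sigma_eq hε hα hU q.1 hq]
    rfl

theorem tendsto_smithiesN_highFilter (hε : 0 < ε) (hα : 0 < α)
    (hU : MemPotentialClass (weight ε) α U) (g : ℂ) :
    Tendsto (fun q : ℕ × ℂ => ‖smithiesN (weight ε) α U q.1 q.2 g‖ₑ) (highFilter α) (𝓝 0) := by
  have h : Continuous fun K : L2Kernel => ‖unweightL ε α (hsN K g)‖ₑ :=
    ((unweightL ε α).continuous.comp
      (continuous_hsN.comp (by fun_prop : Continuous fun K : L2Kernel => (K, g)))).enorm
  refine ((h.tendsto' 0 0 ?_).comp (tendsto_lsL_highFilter hε hα hU)).congr' ?_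
  · rw [hsN_zero_kernel, map_zero, enorm_zero]
  · filter_upwards [eventually_highFilter_mem α] with q hq
    rw [smithiesN_eq hε hα hU q.1 hq]
    rfl

end Properties

end NonlocalPotential

end

theorem mainTheorem8 (ε α : ℝ) (hε : 0 < ε) (hα : 0 < α) (U : ℝ → ℝ → ℝ → ℝ)
    (hU : NonlocalPotential.MemPotentialClass (NonlocalPotential.weight ε) α U) :
    -- all objects are well defined on the closed half-plane
    (∀ (ℓ : ℕ), ∀ k ∈ NonlocalPotential.closedHalfPlane α,
      NonlocalPotential.SmithiesWellDefined (NonlocalPotential.weight ε) α U ℓ k) ∧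
    -- properties of `σ_ℓ(k;g)`
    ((∀ ℓ : ℕ,
        (∃ Φ : ℝ → ℝ, ∀ k ∈ NonlocalPotential.closedHalfPlane α, ∀ g : ℂ,
          ‖NonlocalPotential.sigma U ℓ k g‖ ≤ Φ ‖g‖) ∧
        ContinuousOn (fun p : ℂ × ℂ => NonlocalPotential.sigma U ℓ p.1 p.2)
          (NonlocalPotential.closedHalfPlane α ×ˢ Set.univ) ∧
        DifferentiableOn ℂ (fun p : ℂ × ℂ => NonlocalPotential.sigma U ℓ p.1 p.2)
          (NonlocalPotential.halfPlane α ×ˢ Set.univ) ∧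
        (∀ k ∈ NonlocalPotential.closedHalfPlane α, ∀ g : ℂ,
          conj (NonlocalPotential.sigma U ℓ k g) =
            NonlocalPotential.sigma U ℓ (-conj k) (conj g))) ∧
      (∀ g : ℂ, Tendsto
        (fun r : ℝ => ⨆ (ℓ : ℕ) (k : ℂ) (_ : k ∈ NonlocalPotential.closedHalfPlane α)
          (_ : r ≤ max ‖k‖ (ℓ : ℝ)), ‖NonlocalPotential.sigma U ℓ k g - 1‖ₑ)
        atTop (𝓝 (0 : ℝ≥0∞)))) ∧
    -- properties of `N_ℓ(k;g)`
    ((∀ ℓ : ℕ,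
        (∀ k ∈ NonlocalPotential.closedHalfPlane α, ∀ g : ℂ,
          NonlocalPotential.ActsOnX (NonlocalPotential.weight ε) α
            (NonlocalPotential.smithiesN (NonlocalPotential.weight ε) α U ℓ k g)) ∧
        (∃ Ψ : ℝ → ℝ, ∀ k ∈ NonlocalPotential.closedHalfPlane α, ∀ g : ℂ,
          ‖NonlocalPotential.smithiesN (NonlocalPotential.weight ε) α U ℓ k g‖ ≤ Ψ ‖g‖) ∧
        ContinuousOn
          (fun p : ℂ × ℂ =>
            NonlocalPotential.smithiesN (NonlocalPotential.weight ε) α U ℓ p.1 p.2)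
          (NonlocalPotential.closedHalfPlane α ×ˢ Set.univ) ∧
        DifferentiableOn ℂ
          (fun p : ℂ × ℂ =>
            NonlocalPotential.smithiesN (NonlocalPotential.weight ε) α U ℓ p.1 p.2)
          (NonlocalPotential.halfPlane α ×ˢ Set.univ) ∧
        (∀ k ∈ NonlocalPotential.closedHalfPlane α, ∀ g : ℂ,
          ∀ᵐ p : ℝ × ℝ ∂(NonlocalPotential.halfLine.prod NonlocalPotential.halfLine),
            conj (NonlocalPotential.smithiesN (NonlocalPotential.weight ε) α U ℓ k g p) =
              NonlocalPotential.smithiesN (NonlocalPotential.weight ε) α U ℓ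
                (-conj k) (conj g) p)) ∧
      (∀ g : ℂ, Tendsto
        (fun r : ℝ => ⨆ (ℓ : ℕ) (k : ℂ) (_ : k ∈ NonlocalPotential.closedHalfPlane α)
          (_ : r ≤ max ‖k‖ (ℓ : ℝ)),
            ‖NonlocalPotential.smithiesN (NonlocalPotential.weight ε) α U ℓ k g‖ₑ)
        atTop (𝓝 (0 : ℝ≥0∞)))) := by
  have hwd : ∀ (ℓ : ℕ), ∀ k ∈ NonlocalPotential.closedHalfPlane α,
      NonlocalPotential.SmithiesWellDefined (NonlocalPotential.weight ε) α U ℓ k :=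
    fun ℓ k hk => NonlocalPotential.smithiesWellDefined hε hα hU ℓ hk
  refine ⟨hwd, ⟨fun ℓ => ⟨NonlocalPotential.exists_sigma_bound hε hα hU ℓ,
      NonlocalPotential.continuousOn_sigma hε hα hU ℓ,
      NonlocalPotential.differentiableOn_sigma hε hα hU ℓ,
      fun k _ g => NonlocalPotential.sigma_conj U ℓ k g⟩, fun g => ?_⟩,
    ⟨fun ℓ => ⟨fun k _ g => NonlocalPotential.actsOnX _,
      NonlocalPotential.exists_smithiesN_bound hε hα hU ℓ,
      NonlocalPotential.continuousOn_smithiesN hε hα hU ℓ,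
      NonlocalPotential.differentiableOn_smithiesN hε hα hU ℓ,
      fun k hk g => NonlocalPotential.smithiesN_conj_ae (hwd ℓ k hk) g⟩, fun g => ?_⟩⟩
  · exact NonlocalPotential.tendsto_iSup_of_highFilter
      (NonlocalPotential.tendsto_sigma_highFilter hε hα hU g)
  · exact NonlocalPotential.tendsto_iSup_of_highFilter
      (NonlocalPotential.tendsto_smithiesN_highFilter hε hα hU g)
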